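/- Let $(\Omega,\mathcal F,P)$ be a probability space carrying a two-sided Brownian motion $B=(B_t)_{t\in\mathbb R}$ and an a.s. strictly positive random variable $A$ independent of $B$. Let $\mathcal L[A](t)=E[e^{-tA}]$, let $I(f)=\int_{\mathbb R} f\,dB$ denote the Wiener integral of $f\in L^2(\mathbb R)$, and let $L^2_A=L^2(\Omega,\sigma(B,A),P)$. Let $R_A\in[0,\infty]$ be the largest radius such that $\mathcal L[A]$ extends holomorphically to $\{z\in\mathbb C:|z|<R_A\}$. Let $D_A$ be the set of real Schwartz functions $\eta$ on $\mathbb R$ with $2\|\eta\|_{L^2}^2<R_A$, and put $$S_A[\Theta](\eta)=\frac{E\big[\Theta\, e^{\sqrt A\, I(\eta)}\big]}{E\big[e^{\sqrt A\, I(\eta)}\big]},\qquad \eta\in D_A .$$ Let $H\in(0,1)$ and $$K_H=\Gamma(H+\tfrac12)\Big(\int_0^\infty\big((1+s)^{H-1/2}-s^{H-1/2}\big)^2ds+\tfrac1{2H}\Big)^{-1/2}.$$ Define, for $f:\mathbb R\to\mathbb R$ for which the expressions exist for almost every $x$: $M^{1/2}_\pm f=f$ if $H=\frac12$; $$M_-^Hf(x)=\tfrac{K_H}{\Gamma(H-1/2)}\int_x^\infty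 f(t)(t-x)^{H-3/2}dt,\qquad M_+^Hf(x)=\tfrac{K_H}{\Gamma(H-1/2)}\int_{-\infty}^x f(t)(x-t)^{H-3/2}dt$$ if $H>\frac12$; and $$M_\pm^Hf(x)=\lim_{\epsilon\downarrow0}\tfrac{K_H(1/2-H)}{\Gamma(1/2+H)}\int_\epsilon^\infty\frac{f(x)-f(x\mp t)}{t^{3/2-H}}dt$$ if $H<\frac12$. Let $X=\sqrt A\,B^H$ be the randomly scaled fractional Brownian motion, where $B^H$ is a continuous version of $t\mapsto I(M_-^H\mathbf 1_{[0,t)})$. For a Borel set $M\subset\mathbb R$ and a process $Y:M\to L^2_A$, the fractional Itô integral $\int_M Y_s\,dX_s$ is the element $\Theta\in L^2_A$ (unique if it exists) such that, for every $\eta\in D_A$, the function $s\mapsto S_A[AY_s](\eta)\,(M_+^H\eta)(s)$ is in $L^1(M)$ and $$S_A[\Theta](\eta)=\int_M S_A[AY_s](\eta)\,(M_+^H\eta)(s)\,ds .$$ Let $\nu:[0,\infty)\to\mathbb R$ be continuous if $H\ge\frac12$ and constant if $H<\frac12$, and let $Z_t=\int_{[0,t)}\nu(s)\,dX_s$, $t\ge0$.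 Assume that $$\sigma_\nu(t)=\big\|M_-^H(\nu\mathbf 1_{[0,t)})\big\|_{L^2(\mathbb R)}^{1/H},\qquad t\ge0,$$ is monotonically increasing (in the weak sense). Let $k:(0,\infty)\times(0,\infty)\to\mathbb R$ be Borel measurable and homogeneous of degree $2H-1\in(-1,1)$, i.e. $k(t,ts)=t^{2H-1}k(1,s)$ for $t>0$, $s\in(0,1)$, with $k(1,\cdot)\in L^{1+\epsilon}(0,1)$ for some $\epsilon>0$. Let $$\Phi_k(z)=\sum_{n=0}^\infty c_n(-z)^n,\qquad c_0=1,\quad c_n=c_{n-1}\int_0^1k(1,s)\,s^{2H(n-1)}ds\quad(n\ge1).$$ Assume that $\Phi_k$ is completely monotone on $(0,\infty)$ and that $\mathcal L[A]=\Phi_k$ on $[0,\infty)$. Let $u_0$ be a real Schwartz function on $\mathbb R$. Then $$u(t,x)=E[u_0(x+Z_t)],\qquad t\ge0,\ x\in\mathbb R,$$ is a continuous solution of $$u(t,x)=u_0(x)+\int_0^tk(\sigma_\nu(t),\sigma_\nu(s))\,\sigma_\nu'(s)\,\tfrac12\,\partial_x^2u(s,x)\,ds,\qquad t>0,\ x\in\mathbb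 R .$$ That is: $u$ is continuous on $[0,\infty)\times\mathbb R$ and twice continuously differentiable in $x$; for all $t>0$ and $x\in\mathbb R$ the integrand is integrable over $(0,t)$; and the equation holds. Here the integrand is read as $0$ where $\sigma_\nu'(s)=0$; $\sigma_\nu$ is differentiable on $(0,\infty)$ except possibly at one point. -/

import Mathlib

open MeasureTheory ProbabilityTheory Filter Set
open scoped ENNReal Topology SchwartzMap

namespace FracIto

/-! ### Fractional operators -/

/-- The normalizing constant `K_H`. -/
noncomputable def constK (H : ℝ) : ℝ :=
  Real.Gamma (H + 1 / 2) *
    ((∫ s in Ioi (0 : ℝ), ((1 + s) ^ (H - 1 / 2) - s ^ (H - 1 / 2)) ^ 2) + 1 / (2 * H))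
      ^ (-(1 / 2 : ℝ))

/-- The operator `M_-^H`: a Weyl fractional integral for `H > 1/2`, the identity for `H = 1/2`,
and a Marchaud fractional derivative (a limit of truncated integrals) for `H < 1/2`. -/
noncomputable def opMinus (H : ℝ) (f : ℝ → ℝ) (x : ℝ) : ℝ :=
  if H = 1 / 2 then f x
  else if 1 / 2 < H then
    constK H / Real.Gamma (H - 1 / 2) * ∫ t in Ioi x, f t * (t - x) ^ (H - 3 / 2)
  else
    limUnder (𝓝[>] (0 : ℝ)) fun ε =>
      constK H * (1 / 2 - H) / Real.Gamma (1 / 2 + H) *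
        ∫ t in Ioi ε, (f x - f (x + t)) / t ^ (3 / 2 - H)

/-- The operator `M_+^H`, the mirror image of `M_-^H`. -/
noncomputable def opPlus (H : ℝ) (f : ℝ → ℝ) (x : ℝ) : ℝ :=
  if H = 1 / 2 then f x
  else if 1 / 2 < H then
    constK H / Real.Gamma (H - 1 / 2) * ∫ t in Iio x, f t * (x - t) ^ (H - 3 / 2)
  else
    limUnder (𝓝[>] (0 : ℝ)) fun ε =>
      constK H * (1 / 2 - H) / Real.Gamma (1 / 2 + H) *
        ∫ t in Ioi ε, (f x - f (x - t)) / t ^ (3 / 2 - H)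

/-- The time change `σ_ν(t) = ‖M_-^H (ν 1_{[0,t)})‖_{L²(ℝ)}^{1/H}`. -/
noncomputable def timeChange (H : ℝ) (ν : ℝ → ℝ) (t : ℝ) : ℝ :=
  (eLpNorm (opMinus H ((Ico 0 t).indicator ν)) 2 volume).toReal ^ (1 / H)

/-! ### Brownian motion and the Wiener integral -/

/-- Two-sided (real) Brownian motion: a centered Gaussian process indexed by `ℝ` with covariance
`(|s| + |t| - |s - t|) / 2` and almost surely continuous paths. -/
structure IsTwoSidedBrownian {Ω : Type*} [MeasurableSpace Ω] (B : ℝ → Ω → ℝ) (P : Measure Ω) :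
    Prop where
  measurable : ∀ t, Measurable (B t)
  gaussian : IsGaussianProcess B P
  centered : ∀ t, ∫ ω, B t ω ∂P = 0
  covariance : ∀ s t, cov[B s, B t; P] = (|s| + |t| - |s - t|) / 2
  continuous_paths : ∀ᵐ ω ∂P, Continuous fun t => B t ω

/-- A step function `∑ i, c i • 1_{[a i, b i)}` on the real line. -/
structure StepFunction where
  n : ℕ
  c : Fin n → ℝ
  a : Fin n → ℝ
  b : Fin n → ℝ
  a_le_b : ∀ i, a i ≤ b i

/-- The values of a step function. -/
noncomputable def StepFunction.eval (φ : StepFunction) (x : ℝ) : ℝ :=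
  ∑ i, φ.c i * (Ico (φ.a i) (φ.b i)).indicator (fun _ => (1 : ℝ)) x

/-- The elementary stochastic integral of a step function. -/
def StepFunction.integral {Ω : Type*} (φ : StepFunction) (B : ℝ → Ω → ℝ) (ω : Ω) : ℝ :=
  ∑ i, φ.c i * (B (φ.b i) ω - B (φ.a i) ω)

/-- `Y` is a version of the Wiener integral `∫ f dB`: the `L²(P)`-limit of the elementary
integrals of some sequence of step functions that converges to `f` in `L²(ℝ)`. -/
def IsWienerIntegral {Ω : Type*} [MeasurableSpace Ω] (B : ℝ → Ω → ℝ) (P : Measure Ω)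
    (f : ℝ → ℝ) (Y : Ω → ℝ) : Prop :=
  MemLp Y 2 P ∧ ∃ φ : ℕ → StepFunction,
    Tendsto (fun m => eLpNorm (fun x => f x - (φ m).eval x) 2 volume) atTop (𝓝 0) ∧
    Tendsto (fun m => eLpNorm (fun ω => Y ω - (φ m).integral B ω) 2 P) atTop (𝓝 0)

/-- The Wiener integral `I(f) = ∫ f dB` (it is determined up to almost sure equality, and a
version is chosen). -/
noncomputable def wienerIntegral {Ω : Type*} [MeasurableSpace Ω] (B : ℝ → Ω → ℝ) (P : Measure Ω)
    (f : ℝ → ℝ) : Ω → ℝ :=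
  Classical.epsilon fun Y => IsWienerIntegral B P f Y

/-! ### Laplace transform, `S_A`-transform and the fractional Itô integral -/

/-- The Laplace transform `t ↦ E[exp(-t A)]` of a nonnegative random variable. -/
noncomputable def laplace {Ω : Type*} [MeasurableSpace Ω] (A : Ω → ℝ) (P : Measure Ω)
    (t : ℝ) : ℝ :=
  ∫ ω, Real.exp (-t * A ω) ∂P

/-- `R_A`: the largest radius of an open ball around `0` in `ℂ` on which the Laplace transform
of `A` is (extends to) a holomorphic function. -/
noncomputable def laplaceRadius {Ω : Type*} [MeasurableSpace Ω] (A : Ω → ℝ) (P : Measure Ω) :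
    ℝ≥0∞ :=
  sSup {R | ∃ f : ℂ → ℂ, DifferentiableOn ℂ f {z | ‖z‖ₑ < R} ∧
    ∀ t : ℝ, 0 ≤ t → ENNReal.ofReal t < R → f (t : ℂ) = (laplace A P t : ℂ)}

/-- The admissible test functions `D_A`: Schwartz functions with `2 ‖η‖₂² < R_A`. -/
def admissible {Ω : Type*} [MeasurableSpace Ω] (A : Ω → ℝ) (P : Measure Ω) : Set 𝓢(ℝ, ℝ) :=
  {η | 2 * eLpNorm (fun x => η x) 2 volume ^ 2 < laplaceRadius A P}

/-- The `σ`-algebra `σ(B, A)`. -/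
abbrev sigmaBA {Ω : Type*} (A : Ω → ℝ) (B : ℝ → Ω → ℝ) : MeasurableSpace Ω :=
  MeasurableSpace.comap A inferInstance ⊔ ⨆ t, MeasurableSpace.comap (B t) inferInstance

/-- Membership in `L²_A = L²(Ω, σ(B, A), P)`: square integrable and almost surely equal to a
`σ(B, A)`-measurable random variable. -/
def MemL2A {Ω : Type*} [MeasurableSpace Ω] (A : Ω → ℝ) (B : ℝ → Ω → ℝ) (P : Measure Ω)
    (Θ : Ω → ℝ) : Prop :=
  MemLp Θ 2 P ∧ AEStronglyMeasurable[sigmaBA A B] Θ P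

/-- The Wick-`A` exponential `W_A(η)`. -/
noncomputable def wickExp {Ω : Type*} [MeasurableSpace Ω] (A : Ω → ℝ) (B : ℝ → Ω → ℝ)
    (P : Measure Ω) (η : 𝓢(ℝ, ℝ)) (ω : Ω) : ℝ :=
  Real.exp (√(A ω) * wienerIntegral B P (fun x => η x) ω) /
    ∫ ω', Real.exp (√(A ω') * wienerIntegral B P (fun x => η x) ω') ∂P

/-- The `S_A`-transform `S_A[Θ](η) = E[Θ W_A(η)]`. -/
noncomputable def sTransform {Ω : Type*} [MeasurableSpace Ω] (A : Ω → ℝ) (B : ℝ → Ω → ℝ)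
    (P : Measure Ω) (Θ : Ω → ℝ) (η : 𝓢(ℝ, ℝ)) : ℝ :=
  ∫ ω, Θ ω * wickExp A B P η ω ∂P

/-- `Θ` is (a version of) the fractional Itô integral `∫_M Y_s dX_s` of the `L²_A`-valued process
`Y` with respect to the randomly scaled fractional Brownian motion `X = √A B^H`, where `B^H` is
the fractional Brownian motion `t ↦ I(M_-^H 1_{[0,t)})` constructed from `B`. -/
def IsFracItoIntegral {Ω : Type*} [MeasurableSpace Ω] (A : Ω → ℝ) (B : ℝ → Ω → ℝ)
    (P : Measure Ω) (H : ℝ) (M : Set ℝ) (Y : ℝ → Ω → ℝ) (Θ : Ω → ℝ) : Prop :=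
  (∀ s ∈ M, MemL2A A B P (Y s)) ∧ MemL2A A B P Θ ∧
  ∀ η ∈ admissible A P,
    IntegrableOn
      (fun s => sTransform A B P (fun ω => A ω * Y s ω) η * opPlus H (fun x => η x) s) M ∧
    sTransform A B P Θ η =
      ∫ s in M, sTransform A B P (fun ω => A ω * Y s ω) η * opPlus H (fun x => η x) s

/-- The process `(Z_t)_{t ≥ 0}` belongs to the class `DI_∞(X)` and results from integrating the
deterministic function `ν` : `Z_t = ∫_0^t ν(s) dX_s`, where `ν` is continuous on `[0, ∞)` if
`H ≥ 1/2`, and constant if `H < 1/2`. -/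
def IsDI {Ω : Type*} [MeasurableSpace Ω] (A : Ω → ℝ) (B : ℝ → Ω → ℝ)
    (P : Measure Ω) (H : ℝ) (ν : ℝ → ℝ) (Z : ℝ → Ω → ℝ) : Prop :=
  (1 / 2 ≤ H → ContinuousOn ν (Ici 0)) ∧
  (H < 1 / 2 → ∃ c : ℝ, ∀ s, 0 ≤ s → ν s = c) ∧
  ∀ t, 0 ≤ t → IsFracItoIntegral A B P H (Ico 0 t) (fun s _ => ν s) (Z t)

/-! ### Homogeneous kernels -/

/-- `k : (0,∞) × (0,∞) → ℝ` is Borel measurable and homogeneous of degree `γ`: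
`k(t, ts) = t ^ γ k(1, s)` for `t > 0` and `0 < s < 1`. (Values of `k` outside `(0,∞) × (0,∞)`
are irrelevant.) -/
structure IsHomogeneousKernel (k : ℝ → ℝ → ℝ) (γ : ℝ) : Prop where
  measurable : Measurable fun p : Ioi (0 : ℝ) × Ioi (0 : ℝ) => k p.1 p.2
  homogeneous : ∀ t s : ℝ, 0 < t → 0 < s → s < 1 → k t (t * s) = t ^ γ * k 1 s

/-- The coefficients `c_0 = 1`, `c_n = c_{n-1} ∫_0^1 k(1,s) s^{θ(n-1)} ds`. -/
noncomputable def phiCoeff (k : ℝ → ℝ → ℝ) (θ : ℝ) : ℕ → ℝ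
  | 0 => 1
  | n + 1 => phiCoeff k θ n * ∫ s in Ioo (0 : ℝ) 1, k 1 s * s ^ (θ * n)

/-- The power series `Φ_k(z) = ∑ c_n (-z)^n`, at real arguments. -/
noncomputable def phi (k : ℝ → ℝ → ℝ) (θ : ℝ) (z : ℝ) : ℝ :=
  ∑' n : ℕ, phiCoeff k θ n * (-z) ^ n

/-- Complete monotonicity on `(0, ∞)`. -/
def IsCompletelyMonotone (f : ℝ → ℝ) : Prop :=
  ContDiffOn ℝ ((⊤ : ℕ∞) : WithTop ℕ∞) f (Ioi 0) ∧
    ∀ (n : ℕ) (t : ℝ), 0 < t → 0 ≤ (-1) ^ n * iteratedDerivWithin n f (Ioi 0) t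

/-- `u(t, x) = E[u₀(x + Z_t)]`. -/
noncomputable def expectationFlow {Ω : Type*} [MeasurableSpace Ω] (P : Measure Ω)
    (Z : ℝ → Ω → ℝ) (u₀ : ℝ → ℝ) (t x : ℝ) : ℝ :=
  ∫ ω, u₀ (x + Z t ω) ∂P

/-- `u : [0,∞) × ℝ → ℝ` is a continuous solution of
`u(t,x) = u₀(x) + ∫_0^t k(σ(t),σ(s)) σ'(s) (1/2) ∂_x² u(s,x) ds`, `t > 0`, `x ∈ ℝ`:
it is jointly continuous, twice continuously differentiable in `x`, the integral converges
absolutely, and the equation holds. -/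
structure IsContinuousSolution (k : ℝ → ℝ → ℝ) (σ : ℝ → ℝ) (u₀ : ℝ → ℝ) (u : ℝ → ℝ → ℝ) :
    Prop where
  continuousOn : ContinuousOn (fun p : ℝ × ℝ => u p.1 p.2) (Ici 0 ×ˢ univ)
  contDiff : ∀ t, 0 ≤ t → ContDiff ℝ 2 (u t)
  integrable : ∀ t x : ℝ, 0 < t → IntervalIntegrable
    (fun s => k (σ t) (σ s) * deriv σ s * (1 / 2 * iteratedDeriv 2 (u s) x)) volume 0 t
  equation : ∀ t x : ℝ, 0 < t → u t x =
    u₀ x + ∫ s in (0 : ℝ)..t, k (σ t) (σ s) * deriv σ s * (1 / 2 * iteratedDeriv 2 (u s) x)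

end FracIto

namespace FracIto

/-! ### Square integrable functions -/

/-! Write θ = 2H and Φ = Φ_k. The heart is a functional equation. Integrating the series of Φ
termwise, the recursion for its coefficients becomes Φ(z) = 1 - z ∫_0^1 k(1,r) Φ(z r^θ) dr
(`phi_eq_one_sub`). If Z_t has characteristic function ξ ↦ Φ(ξ² σ(t)^θ / 2), Fourier inversion
writes u(t,x) as the integral over ξ of exp(2πiξx) û₀(ξ) Φ(2π²ξ² σ(t)^θ). Since ∂_x² multiplies the
transform by -4π²ξ², the functional equation turns into an integral equation in the variable v =
σ(t)^θ (`fourierFlow_eq`). The substitution r = σ(s)/σ(t) and the homogeneity of k give the asserted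
equation (`integral_timeChange`).

It remains to find the law of Z_t, which is specified only through its S_A-transform. The ratios of
the coefficients of Φ tend to 0, so Φ is entire. As Φ is the Laplace transform of A, all exponential
moments of A are finite (`integrable_exp_mul_of_entire`), R_A is infinite and every Schwartz
function is admissible. The exponentials exp(√A I(η)) are then total in L²_A
(`ae_eq_zero_of_integral_mul_exp_eq_zero`). Fractional integration by parts shows that √A I(M_-^H(ν
1_{[0,t)})) has the same S_A-transform as Z_t, so the two agree almost surely
(`IsFracItoIntegral.ae_eq`). Given A, this is a centred Gaussian variable of variance A σ(t)^θ,
which yields the characteristic function.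

The analytic input on M_±^H is collected in `IsEnergy`: square integrability, integration by parts,
and regularity of the energy V = σ^θ. It is proved separately for H = 1/2, for H > 1/2 (Riesz
kernels) and for H < 1/2 (scaling of the Marchaud derivative of an indicator). -/

theorem eLpNorm_two_toReal_sq {α : Type*} [MeasurableSpace α] {μ : Measure α} {f : α → ℝ}
    (hf : MemLp f 2 μ) : (eLpNorm f 2 μ).toReal ^ 2 = ∫ x, f x ^ 2 ∂μ := by
  have h := hf.eLpNorm_eq_integral_rpow_norm two_ne_zero ENNReal.ofNat_ne_top
  have h0 : 0 ≤ ∫ x, f x ^ 2 ∂μ := integral_nonneg fun x => sq_nonneg _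
  simp only [ENNReal.toReal_ofNat, Real.rpow_two, Real.norm_eq_abs, sq_abs] at h
  rw [h, ENNReal.toReal_ofReal (by positivity), ← Real.rpow_natCast, ← Real.rpow_mul h0]
  norm_num

theorem tendsto_eLpNorm_of_tendsto_sub {α : Type*} [MeasurableSpace α] {μ : Measure α}
    {f : α → ℝ} {g : ℕ → α → ℝ} (hf : MemLp f 2 μ) (hg : ∀ m, MemLp (g m) 2 μ)
    (h : Tendsto (fun m => eLpNorm (fun x => f x - g m x) 2 μ) atTop (𝓝 0)) :
    Tendsto (fun m => (eLpNorm (g m) 2 μ).toReal) atTop (𝓝 (eLpNorm f 2 μ).toReal) := by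
  have h1 : Tendsto (fun m => (hg m).toLp) atTop (𝓝 hf.toLp) := by
    rw [Lp.tendsto_Lp_iff_tendsto_eLpNorm'']
    refine h.congr fun m => ?_
    rw [← eLpNorm_neg]
    congr 1
    ext x
    simp
  have h2 := h1.norm
  simpa [Lp.norm_toLp] using h2

/-! ### Step functions -/

namespace StepFunction

/-- The linear combination `r φ + s ψ` of two step functions. -/
def comb (r s : ℝ) (φ ψ : StepFunction) : StepFunction where
  n := φ.n + ψ.n
  c := Fin.append (fun i => r * φ.c i) (fun i => s * ψ.c i)
  a := Fin.append φ.a ψ.a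
  b := Fin.append φ.b ψ.b
  a_le_b i := by
    refine Fin.addCases (fun i => ?_) (fun i => ?_) i
    · simpa using φ.a_le_b i
    · simpa using ψ.a_le_b i

theorem comb_eval (r s : ℝ) (φ ψ : StepFunction) (x : ℝ) :
    (comb r s φ ψ).eval x = r * φ.eval x + s * ψ.eval x := by
  refine (Fin.sum_univ_add (a := φ.n) (b := ψ.n) _).trans ?_
  simp [comb, eval, Finset.mul_sum, mul_assoc]

theorem comb_integral {Ω : Type*} (B : ℝ → Ω → ℝ) (r s : ℝ) (φ ψ : StepFunction) (ω : Ω) :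
    (comb r s φ ψ).integral B ω = r * φ.integral B ω + s * ψ.integral B ω := by
  refine (Fin.sum_univ_add (a := φ.n) (b := ψ.n) _).trans ?_
  simp [comb, integral, Finset.mul_sum, mul_assoc]

theorem memLp_eval (φ : StepFunction) : MemLp φ.eval 2 volume := by
  have : φ.eval = fun x =>
      ∑ i, φ.c i * (Ico (φ.a i) (φ.b i)).indicator (fun _ => (1 : ℝ)) x := rfl
  rw [this]
  refine memLp_finsetSum _ fun i _ => MemLp.const_mul ?_ _
  exact memLp_indicator_const 2 measurableSet_Ico 1 (Or.inr (by simp))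

end StepFunction

/-! ### Brownian increments and the Itô isometry for step functions. -/

variable {Ω : Type*} [MeasurableSpace Ω] {P : Measure Ω} {B : ℝ → Ω → ℝ}

theorem IsTwoSidedBrownian.memLp (hB : IsTwoSidedBrownian B P) (t : ℝ) : MemLp (B t) 2 P :=
  (hB.gaussian.hasGaussianLaw_eval t).memLp_two

theorem IsTwoSidedBrownian.integral_mul (hB : IsTwoSidedBrownian B P) (s t : ℝ) :
    ∫ ω, B s ω * B t ω ∂P = (|s| + |t| - |s - t|) / 2 := by
  rw [← hB.covariance s t, ProbabilityTheory.covariance, hB.centered, hB.centered]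
  simp only [sub_zero]

/-- The length of the overlap is written in the same absolute values as the covariance of two
increments in `integral_increment_mul`; this coincidence is the Itô isometry for indicators. -/
theorem integral_indicator_mul_indicator (a b c d : ℝ) (hab : a ≤ b) (hcd : c ≤ d) :
    ∫ x, (Ico a b).indicator (fun _ => (1 : ℝ)) x * (Ico c d).indicator (fun _ => (1 : ℝ)) x =
      (|b - c| + |a - d| - |b - d| - |a - c|) / 2 := by
  have : (fun x => (Ico a b).indicator (fun _ => (1 : ℝ)) x *
      (Ico c d).indicator (fun _ => (1 : ℝ)) x) = (Ico (max a c) (min b d)).indicator 1 := by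
    rw [← Ico_inter_Ico]
    ext x
    rw [inter_indicator_one]
    rfl
  rw [this, integral_indicator_one measurableSet_Ico, Real.volume_real_Ico]
  grind

theorem IsTwoSidedBrownian.integral_increment_mul (hB : IsTwoSidedBrownian B P)
    (a b c d : ℝ) :
    ∫ ω, (B b ω - B a ω) * (B d ω - B c ω) ∂P =
      (|b - c| + |a - d| - |b - d| - |a - c|) / 2 := by
  have hi : ∀ s t, Integrable (fun ω => B s ω * B t ω) P := fun s t =>
    (hB.memLp s).integrable_mul (hB.memLp t)
  have : (fun ω => (B b ω - B a ω) * (B d ω - B c ω)) = fun ω =>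
      B b ω * B d ω - B b ω * B c ω - (B a ω * B d ω - B a ω * B c ω) := by
    ext ω; ring
  have hd : ∀ s t u, Integrable (fun ω => B s ω * B t ω - B s ω * B u ω) P := fun s t u =>
    (hi _ _).sub (hi _ _)
  rw [this, integral_sub (hd _ _ _) (hd _ _ _),
    integral_sub (hi _ _) (hi _ _), integral_sub (hi _ _) (hi _ _)]
  simp only [hB.integral_mul]
  ring

namespace StepFunction

theorem measurable_integral (hB : IsTwoSidedBrownian B P) (φ : StepFunction) :
    Measurable (φ.integral B) := by
  unfold integral
  have := hB.measurable
  fun_prop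

theorem hasGaussianLaw_integral (hB : IsTwoSidedBrownian B P) (φ : StepFunction) :
    HasGaussianLaw (φ.integral B) P := by
  -- Doubling the index by `Bool` separates the two endpoints, so that the integral is one linear
  -- combination of values of the Gaussian process.
  let τ : Fin φ.n × Bool → ℝ := fun p => if p.2 then φ.b p.1 else φ.a p.1
  let r : Fin φ.n × Bool → ℝ := fun p => if p.2 then φ.c p.1 else -φ.c p.1
  have h := (((hB.gaussian.comp_right τ).smul r).hasGaussianLaw_fun_sum (I := Finset.univ))
  refine h.congr (ae_of_all _ fun ω => ?_)
  simp only [Fintype.sum_prod_type, integral]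
  refine Finset.sum_congr rfl fun i _ => ?_
  simp [τ, r]
  ring

theorem memLp_integral (hB : IsTwoSidedBrownian B P) (φ : StepFunction) :
    MemLp (φ.integral B) 2 P :=
  (φ.hasGaussianLaw_integral hB).memLp_two

theorem integral_integral (hB : IsTwoSidedBrownian B P) (φ : StepFunction) :
    ∫ ω, φ.integral B ω ∂P = 0 := by
  have := hB.gaussian.isProbabilityMeasure
  have hi : ∀ t, Integrable (B t) P := fun t => (hB.memLp t).integrable one_le_two
  have hd : ∀ s t r, Integrable (fun ω => r * (B t ω - B s ω)) P := fun s t r =>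
    ((hi _).sub (hi _)).const_mul _
  simp only [integral]
  rw [integral_finsetSum _ fun i _ => hd _ _ _]
  refine Finset.sum_eq_zero fun i _ => ?_
  rw [integral_const_mul, integral_sub (hi _) (hi _), hB.centered, hB.centered]
  simp

/-- The Itô isometry: both squares expand into the same double sum, whose terms agree interval by
interval. -/
theorem integral_integral_sq (hB : IsTwoSidedBrownian B P) (φ : StepFunction) :
    ∫ ω, φ.integral B ω ^ 2 ∂P = ∫ x, φ.eval x ^ 2 := by
  have hi : ∀ s t s' t', Integrable (fun ω => (B t ω - B s ω) * (B t' ω - B s' ω)) P :=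
    fun s t s' t' =>
      ((hB.memLp t).sub (hB.memLp s)).integrable_mul ((hB.memLp t').sub (hB.memLp s'))
  have hind : ∀ a b : ℝ, MemLp ((Ico a b).indicator fun _ => (1 : ℝ)) 2 volume := fun a b =>
    memLp_indicator_const 2 measurableSet_Ico 1 (Or.inr (by simp))
  have hj : ∀ a b c d : ℝ, Integrable (fun x => (Ico a b).indicator (fun _ => (1 : ℝ)) x *
      (Ico c d).indicator (fun _ => (1 : ℝ)) x) volume := fun a b c d =>
    (hind a b).integrable_mul (hind c d)
  simp only [sq, integral, eval, Finset.sum_mul_sum, mul_mul_mul_comm]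
  rw [integral_finsetSum _ fun i _ => integrable_finsetSum _ fun j _ => (hi _ _ _ _).const_mul _,
    integral_finsetSum _ fun i _ => integrable_finsetSum _ fun j _ => (hj _ _ _ _).const_mul _]
  refine Finset.sum_congr rfl fun i _ => ?_
  rw [integral_finsetSum _ fun j _ => (hi _ _ _ _).const_mul _,
    integral_finsetSum _ fun j _ => (hj _ _ _ _).const_mul _]
  refine Finset.sum_congr rfl fun j _ => ?_
  rw [integral_const_mul, integral_const_mul, hB.integral_increment_mul,
    integral_indicator_mul_indicator _ _ _ _ (φ.a_le_b i) (φ.a_le_b j)]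

theorem toReal_eLpNorm_integral (hB : IsTwoSidedBrownian B P) (φ : StepFunction) :
    (eLpNorm (φ.integral B) 2 P).toReal = (eLpNorm φ.eval 2 volume).toReal := by
  rw [← sq_eq_sq₀ ENNReal.toReal_nonneg ENNReal.toReal_nonneg,
    eLpNorm_two_toReal_sq (φ.memLp_integral hB), eLpNorm_two_toReal_sq φ.memLp_eval,
    φ.integral_integral_sq hB]

theorem map_integral (hB : IsTwoSidedBrownian B P) (φ : StepFunction) :
    P.map (φ.integral B) = gaussianReal 0 ((eLpNorm φ.eval 2 volume).toReal ^ 2).toNNReal := by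
  have := hB.gaussian.isProbabilityMeasure
  rw [(φ.hasGaussianLaw_integral hB).map_eq_gaussianReal, φ.integral_integral hB,
    variance_of_integral_eq_zero (φ.measurable_integral hB).aemeasurable (φ.integral_integral hB),
    eLpNorm_two_toReal_sq φ.memLp_eval, φ.integral_integral_sq hB]

/-- Step functions are dense in `L²(ℝ)`. -/
theorem exists_eLpNorm_sub_le {f : ℝ → ℝ} (hf : MemLp f 2 volume) {ε : ℝ≥0∞} (hε : ε ≠ 0) :
    ∃ φ : StepFunction, eLpNorm (fun x => f x - φ.eval x) 2 volume ≤ ε := by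
  have hε2 : ε / 2 ≠ 0 := by simpa using hε
  obtain ⟨g, hgs, hgf, hgc, hg⟩ := hf.exists_hasCompactSupport_eLpNorm_sub_le
    ENNReal.ofNat_ne_top hε2
  obtain ⟨R, hR⟩ := hgs.isCompact.isBounded.subset_closedBall 0
  obtain ⟨N, hN⟩ := exists_nat_gt R
  have hsupp : Function.support g ⊆ Ico (-N : ℝ) N := fun x hx => by
    have := hR (subset_tsupport g hx)
    rw [mem_closedBall_zero_iff, Real.norm_eq_abs, abs_le] at this
    exact ⟨by linarith, by linarith⟩
  have hvol : volume (Ico (-N : ℝ) N) ^ (1 / (2 : ℝ≥0∞).toReal) ≠ ⊤ :=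
    ENNReal.rpow_ne_top_of_nonneg (by simp) (by simp)
  -- A uniform error `c` on `[-N, N)` costs at most `ε / 2` in L².
  obtain ⟨c, hc0, hc⟩ : ∃ c : ℝ, 0 < c ∧
      ENNReal.ofReal c * volume (Ico (-N : ℝ) N) ^ (1 / (2 : ℝ≥0∞).toReal) ≤ ε / 2 := by
    have ht : Tendsto (fun c : ℝ =>
        ENNReal.ofReal c * volume (Ico (-N : ℝ) N) ^ (1 / (2 : ℝ≥0∞).toReal)) (𝓝[>] 0)
        (𝓝 0) := by
      have := ENNReal.Tendsto.mul_const (ENNReal.tendsto_ofReal (tendsto_id (x := 𝓝 (0 : ℝ))))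
        (Or.inr hvol)
      simp only [ENNReal.ofReal_zero, zero_mul] at this
      exact this.mono_left nhdsWithin_le_nhds
    obtain ⟨c, h1, h2⟩ :=
      ((ht.eventually_le_const hε2.bot_lt).and self_mem_nhdsWithin).exists
    exact ⟨c, h2, h1⟩
  obtain ⟨δ, hδ, hgδ⟩ := Metric.uniformContinuous_iff.1
    (hgs.uniformContinuous_of_continuous hgc) c hc0
  obtain ⟨M, hM⟩ := exists_nat_one_div_lt hδ
  set m : ℝ := (M : ℝ) + 1
  have hm : 0 < m := by positivity
  -- `2N(M+1)` cells of length `1 / m < δ` tile `[-N, N)`; each carries the value of `g` at its left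
  -- endpoint.
  let φ : StepFunction :=
    { n := 2 * N * (M + 1)
      c := fun i => g (-N + i / m)
      a := fun i => -N + i / m
      b := fun i => -N + (i + 1) / m
      a_le_b := fun i => by gcongr; linarith }
  have hcell : ∀ (x : ℝ) (i : ℕ), x ∈ Ico (-N + i / m : ℝ) (-N + (i + 1) / m) ↔
      (i : ℝ) ≤ (x + N) * m ∧ (x + N) * m < i + 1 := by
    intro x i
    rw [mem_Ico, ← div_le_iff₀ hm, ← lt_div_iff₀ hm]
    constructor <;> rintro ⟨h1, h2⟩ <;> constructor <;> linarith
  have hφ0 : ∀ x, x ∉ Ico (-N : ℝ) N → φ.eval x = 0 := by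
    intro x hx
    refine Finset.sum_eq_zero fun i _ => ?_
    rw [indicator_of_notMem, mul_zero]
    intro hxi
    obtain ⟨h1, h2⟩ := (hcell x i).1 hxi
    have hi : ((i : ℕ) : ℝ) + 1 ≤ 2 * N * m := by
      have := i.2
      simp only [φ, m] at this ⊢
      exact_mod_cast this
    refine hx ⟨?_, ?_⟩
    · have : 0 ≤ (x + N) * m := le_trans (by positivity) h1
      linarith [nonneg_of_mul_nonneg_left this hm]
    · have : (x + N) * m < (2 * N) * m := by linarith
      linarith [lt_of_mul_lt_mul_right this hm.le]
  have hφ1 : ∀ x ∈ Ico (-N : ℝ) N, ∃ y, dist x y < δ ∧ φ.eval x = g y := by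
    intro x hx
    have hx0 : 0 ≤ (x + N) * m := mul_nonneg (by linarith [hx.1]) hm.le
    have hlt : ⌊(x + N) * m⌋₊ < 2 * N * (M + 1) := by
      rw [Nat.floor_lt hx0]
      push_cast
      exact mul_lt_mul_of_pos_right (by linarith [hx.2]) hm
    have hmem : x ∈ Ico (-N + ⌊(x + N) * m⌋₊ / m : ℝ) (-N + (⌊(x + N) * m⌋₊ + 1) / m) :=
      (hcell x _).2 ⟨Nat.floor_le hx0, Nat.lt_floor_add_one _⟩
    refine ⟨-N + ⌊(x + N) * m⌋₊ / m, ?_, ?_⟩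
    · rw [Real.dist_eq, abs_of_nonneg (by linarith [hmem.1])]
      have := hmem.2
      rw [add_div] at this
      linarith
    · refine (Finset.sum_eq_single (⟨_, hlt⟩ : Fin φ.n) (fun j _ hj => ?_) (by simp)).trans ?_
      · rw [indicator_of_notMem, mul_zero]
        intro hxj
        obtain ⟨h1, h2⟩ := (hcell x j).1 hxj
        exact hj (Fin.ext ((Nat.floor_eq_iff hx0).2 ⟨h1, h2⟩).symm)
      · rw [indicator_of_mem hmem, mul_one]
  refine ⟨φ, ?_⟩
  have e : (fun x => f x - φ.eval x) = (f - g) + (g - φ.eval) := by ext x; simp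
  rw [e, ← ENNReal.add_halves ε]
  refine (eLpNorm_add_le (hf.sub hg).aestronglyMeasurable
    (hg.sub φ.memLp_eval).aestronglyMeasurable one_le_two).trans (add_le_add hgf ?_)
  refine (eLpNorm_sub_le_of_dist_bdd volume ENNReal.ofNat_ne_top measurableSet_Ico hc0.le
    (fun x => ?_) hsupp fun x hx => ?_).trans hc
  · by_cases hx : x ∈ Ico (-N : ℝ) N
    · obtain ⟨y, hy, he⟩ := hφ1 x hx
      rw [he]
      exact (hgδ hy).le
    · have : g x = 0 := by
        by_contra h
        exact hx (hsupp h)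
      rw [this, hφ0 x hx, dist_self]
      exact hc0.le
  · by_contra h
    exact hx (hφ0 x h)

end StepFunction

/-! ### The Wiener integral -/

/-- The isometry carries the Cauchy property of approximating step functions over to their
integrals, and L²(P) is complete. Hence the choice in `wienerIntegral` is a genuine version. -/
theorem exists_isWienerIntegral (hB : IsTwoSidedBrownian B P) {f : ℝ → ℝ}
    (hf : MemLp f 2 volume) : ∃ Y, IsWienerIntegral B P f Y := by
  have hex : ∀ m : ℕ, ∃ φ : StepFunction,
      eLpNorm (fun x => f x - φ.eval x) 2 volume ≤ ((m : ℝ≥0∞) + 1)⁻¹ := fun m =>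
    StepFunction.exists_eLpNorm_sub_le hf (by simp)
  choose φ hφ using hex
  have h1 : Tendsto (fun m => eLpNorm (fun x => f x - (φ m).eval x) 2 volume) atTop (𝓝 0) := by
    refine tendsto_of_tendsto_of_tendsto_of_le_of_le tendsto_const_nhds ?_ (fun _ => zero_le) hφ
    have := ENNReal.tendsto_inv_nat_nhds_zero.comp (tendsto_add_atTop_nat 1)
    refine this.congr fun m => by simp
  have h2 : CauchySeq fun m => ((φ m).memLp_eval).toLp := by
    refine Tendsto.cauchySeq (x := hf.toLp) ?_
    rw [Lp.tendsto_Lp_iff_tendsto_eLpNorm'']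
    refine h1.congr fun m => ?_
    rw [← eLpNorm_neg]
    congr 1
    ext x
    simp
  have h3 : CauchySeq fun m => ((φ m).memLp_integral hB).toLp := by
    rw [Metric.cauchySeq_iff] at h2 ⊢
    refine fun ε hε => (h2 ε hε).imp fun N hN m hm n hn => ?_
    refine lt_of_eq_of_lt ?_ (hN m hm n hn)
    rw [Lp.dist_def, Lp.dist_def,
      eLpNorm_congr_ae ((MemLp.coeFn_toLp _).sub (MemLp.coeFn_toLp _)),
      eLpNorm_congr_ae ((MemLp.coeFn_toLp ((φ m).memLp_eval)).sub
        (MemLp.coeFn_toLp ((φ n).memLp_eval)))]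
    have e1 : (φ m).integral B - (φ n).integral B =
        (StepFunction.comb 1 (-1) (φ m) (φ n)).integral B := by
      ext ω; simp [StepFunction.comb_integral, sub_eq_add_neg]
    have e2 : (φ m).eval - (φ n).eval = (StepFunction.comb 1 (-1) (φ m) (φ n)).eval := by
      ext ω; simp [StepFunction.comb_eval, sub_eq_add_neg]
    rw [e1, e2, StepFunction.toReal_eLpNorm_integral hB]
  obtain ⟨Y, hY⟩ := cauchySeq_tendsto_of_complete h3
  refine ⟨Y, Lp.memLp Y, φ, h1, ?_⟩
  rw [Lp.tendsto_Lp_iff_tendsto_eLpNorm'] at hY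
  refine hY.congr fun m => ?_
  rw [← eLpNorm_neg]
  refine eLpNorm_congr_ae ?_
  filter_upwards [MemLp.coeFn_toLp ((φ m).memLp_integral hB)] with ω hω
  simp [hω]

theorem isWienerIntegral_wienerIntegral (hB : IsTwoSidedBrownian B P) {f : ℝ → ℝ}
    (hf : MemLp f 2 volume) : IsWienerIntegral B P f (wienerIntegral B P f) :=
  Classical.epsilon_spec (exists_isWienerIntegral hB hf)

theorem isWienerIntegral_step (hB : IsTwoSidedBrownian B P) (φ : StepFunction) :
    IsWienerIntegral B P φ.eval (φ.integral B) :=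
  ⟨φ.memLp_integral hB, fun _ => φ, by simp, by simp⟩

theorem tendsto_eLpNorm_comb {α : Type*} [MeasurableSpace α] {μ : Measure α} {f g : α → ℝ}
    {u v : ℕ → α → ℝ} (r s : ℝ) (hf : MemLp f 2 μ) (hg : MemLp g 2 μ)
    (hu : ∀ m, MemLp (u m) 2 μ) (hv : ∀ m, MemLp (v m) 2 μ)
    (h1 : Tendsto (fun m => eLpNorm (fun x => f x - u m x) 2 μ) atTop (𝓝 0))
    (h2 : Tendsto (fun m => eLpNorm (fun x => g x - v m x) 2 μ) atTop (𝓝 0)) :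
    Tendsto (fun m => eLpNorm (fun x => (r * f x + s * g x) - (r * u m x + s * v m x)) 2 μ)
      atTop (𝓝 0) := by
  have h3 : Tendsto (fun m => ‖r‖ₑ * eLpNorm (fun x => f x - u m x) 2 μ +
      ‖s‖ₑ * eLpNorm (fun x => g x - v m x) 2 μ) atTop (𝓝 0) := by
    have a1 := ENNReal.Tendsto.const_mul (a := ‖r‖ₑ) h1 (Or.inr enorm_ne_top)
    have a2 := ENNReal.Tendsto.const_mul (a := ‖s‖ₑ) h2 (Or.inr enorm_ne_top)
    simpa using a1.add a2
  refine tendsto_of_tendsto_of_tendsto_of_le_of_le tendsto_const_nhds h3 (fun _ => zero_le)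
    fun m => ?_
  have e : (fun x => (r * f x + s * g x) - (r * u m x + s * v m x)) =
      r • (fun x => f x - u m x) + s • (fun x => g x - v m x) := by
    ext x; simp; ring
  rw [e]
  refine (eLpNorm_add_le ((hf.sub (hu m)).aestronglyMeasurable.const_smul r)
    ((hg.sub (hv m)).aestronglyMeasurable.const_smul s) one_le_two).trans ?_
  rw [eLpNorm_const_smul, eLpNorm_const_smul]
  exact le_rfl

theorem IsWienerIntegral.comb (hB : IsTwoSidedBrownian B P) {f g : ℝ → ℝ} {Y W : Ω → ℝ}
    (hf : MemLp f 2 volume) (hg : MemLp g 2 volume) (hY : IsWienerIntegral B P f Y)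
    (hW : IsWienerIntegral B P g W) (r s : ℝ) :
    IsWienerIntegral B P (fun x => r * f x + s * g x) (fun ω => r * Y ω + s * W ω) := by
  obtain ⟨hY0, φ, h1, h2⟩ := hY
  obtain ⟨hW0, ψ, h3, h4⟩ := hW
  refine ⟨(hY0.const_mul r).add (hW0.const_mul s),
    fun m => StepFunction.comb r s (φ m) (ψ m), ?_, ?_⟩
  · simp only [StepFunction.comb_eval]
    exact tendsto_eLpNorm_comb r s hf hg (fun m => (φ m).memLp_eval)
      (fun m => (ψ m).memLp_eval) h1 h3
  · simp only [StepFunction.comb_integral]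
    exact tendsto_eLpNorm_comb r s hY0 hW0 (fun m => (φ m).memLp_integral hB)
      (fun m => (ψ m).memLp_integral hB) h2 h4

theorem exists_subseq_ae_tendsto {α : Type*} [MeasurableSpace α] {μ : Measure α} {f : α → ℝ}
    {u : ℕ → α → ℝ} (hf : MemLp f 2 μ) (hu : ∀ m, MemLp (u m) 2 μ)
    (h : Tendsto (fun m => eLpNorm (fun x => f x - u m x) 2 μ) atTop (𝓝 0)) :
    ∃ ns : ℕ → ℕ, StrictMono ns ∧
      ∀ᵐ x ∂μ, Tendsto (fun m => u (ns m) x) atTop (𝓝 (f x)) := by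
  refine (tendstoInMeasure_of_tendsto_eLpNorm (p := 2) two_ne_zero
    (fun m => (hu m).aestronglyMeasurable) hf.aestronglyMeasurable ?_).exists_seq_tendsto_ae
  refine h.congr fun m => ?_
  rw [← eLpNorm_neg]
  congr 1
  ext x
  simp

/-- Along an almost surely convergent subsequence, the characteristic functions of the Gaussian step
integrals tend to that of `Y`. They also tend to the Gaussian one, because the variances converge.
-/
theorem IsWienerIntegral.map_eq (hB : IsTwoSidedBrownian B P) {f : ℝ → ℝ} {Y : Ω → ℝ}
    (hf : MemLp f 2 volume) (hY : IsWienerIntegral B P f Y) :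
    P.map Y = gaussianReal 0 ((eLpNorm f 2 volume).toReal ^ 2).toNNReal := by
  have := hB.gaussian.isProbabilityMeasure
  obtain ⟨hY0, φ, h1, h2⟩ := hY
  obtain ⟨ns, hns, hae⟩ := exists_subseq_ae_tendsto hY0 (fun m => (φ m).memLp_integral hB) h2
  have hN := (tendsto_eLpNorm_of_tendsto_sub hf (fun m => (φ m).memLp_eval) h1).comp
    hns.tendsto_atTop
  have hYm : AEMeasurable Y P := hY0.aestronglyMeasurable.aemeasurable
  have : IsProbabilityMeasure (P.map Y) := Measure.isProbabilityMeasure_map hYm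
  refine Measure.ext_of_charFun ?_
  ext ξ
  have hcf : ∀ {X : Ω → ℝ}, AEMeasurable X P →
      charFun (P.map X) ξ = ∫ ω, Complex.exp (ξ * X ω * Complex.I) ∂P := fun {X} hX => by
    rw [charFun_apply_real, integral_map hX (by fun_prop)]
  have t1 : Tendsto (fun m => charFun (P.map ((φ (ns m)).integral B)) ξ) atTop
      (𝓝 (charFun (P.map Y) ξ)) := by
    rw [hcf hYm]
    simp only [fun m => hcf ((φ (ns m)).measurable_integral hB).aemeasurable]
    refine tendsto_integral_of_dominated_convergence (fun _ => 1) (fun m => ?_)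
      (integrable_const _) (fun m => ae_of_all _ fun ω => ?_) ?_
    · have := (φ (ns m)).measurable_integral hB
      fun_prop
    · rw [← Complex.ofReal_mul, Complex.norm_exp_ofReal_mul_I]
    · filter_upwards [hae] with ω hω
      have : Continuous fun y : ℝ => Complex.exp (ξ * y * Complex.I) := by fun_prop
      exact (this.tendsto _).comp hω
  refine tendsto_nhds_unique t1 ?_
  simp only [StepFunction.map_integral hB, charFun_gaussianReal]
  have : Continuous fun y : ℝ =>
      Complex.exp (ξ * (0 : ℝ) * Complex.I - ((y ^ 2).toNNReal : ℝ) * ξ ^ 2 / 2) := by fun_prop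
  exact (this.tendsto _).comp hN

/-- Taking the limsup of the step integrals on path space makes the Wiener integral a measurable
functional of the whole path. This gives both independence of `A` and measurability with respect to
σ(B, A). -/
theorem IsWienerIntegral.exists_ae_eq_comp (hB : IsTwoSidedBrownian B P) {f : ℝ → ℝ}
    {Y : Ω → ℝ} (hY : IsWienerIntegral B P f Y) :
    ∃ G : (ℝ → ℝ) → ℝ, Measurable G ∧ Y =ᵐ[P] fun ω => G fun t => B t ω := by
  obtain ⟨hY0, φ, h1, h2⟩ := hY
  obtain ⟨ns, hns, hae⟩ := exists_subseq_ae_tendsto hY0 (fun m => (φ m).memLp_integral hB) h2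
  refine ⟨fun w => limsup (fun m => (φ (ns m)).integral (fun t (w : ℝ → ℝ) => w t) w) atTop,
    ?_, ?_⟩
  · refine Measurable.limsup fun m => ?_
    unfold StepFunction.integral
    fun_prop
  · filter_upwards [hae] with ω hω
    exact hω.limsup_eq.symm

theorem IsWienerIntegral.indepFun (hB : IsTwoSidedBrownian B P) {A : Ω → ℝ}
    (hAB : IndepFun A (fun ω t => B t ω) P) {f : ℝ → ℝ}
    {Y : Ω → ℝ} (hY : IsWienerIntegral B P f Y) : IndepFun A Y P := by
  obtain ⟨G, hG, hYG⟩ := hY.exists_ae_eq_comp hB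
  exact (hAB.comp measurable_id hG).congr (ae_eq_refl _) hYG.symm

/-! ### The power series `Φ_k` -/

section Series

variable {k : ℝ → ℝ → ℝ} {θ : ℝ}

theorem integrableOn_kernel_mul_rpow (hk : IntegrableOn (k 1) (Ioo 0 1)) (hθ : 0 < θ) (n : ℕ) :
    IntegrableOn (fun s => k 1 s * s ^ (θ * n)) (Ioo 0 1) := by
  refine hk.mul_bdd (c := 1) (by fun_prop) ?_
  filter_upwards [ae_restrict_mem measurableSet_Ioo] with s hs
  rw [Real.norm_of_nonneg (Real.rpow_nonneg hs.1.le _)]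
  exact Real.rpow_le_one hs.1.le hs.2.le (by positivity)

/-- These integrals are the ratios of successive coefficients of Φ_k, so their decay gives an
infinite radius of convergence. It follows by dominated convergence, since s^θ < 1 on (0,1). -/
theorem tendsto_integral_kernel_mul_rpow (hk : IntegrableOn (k 1) (Ioo 0 1)) (hθ : 0 < θ) :
    Tendsto (fun n : ℕ => ∫ s in Ioo (0 : ℝ) 1, k 1 s * s ^ (θ * n)) atTop (𝓝 0) := by
  suffices Tendsto (fun n : ℕ => ∫ s in Ioo (0 : ℝ) 1, k 1 s * s ^ (θ * n)) atTop
      (𝓝 (∫ _ in Ioo (0 : ℝ) 1, (0 : ℝ))) by simpa using this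
  refine tendsto_integral_of_dominated_convergence (fun s => ‖k 1 s‖)
    (fun n => (integrableOn_kernel_mul_rpow hk hθ n).aestronglyMeasurable) hk.norm
    (fun n => ?_) ?_
  · filter_upwards [ae_restrict_mem measurableSet_Ioo] with s hs
    rw [norm_mul, Real.norm_of_nonneg (Real.rpow_nonneg hs.1.le _)]
    exact mul_le_of_le_one_right (norm_nonneg _)
      (Real.rpow_le_one hs.1.le hs.2.le (by positivity))
  · filter_upwards [ae_restrict_mem measurableSet_Ioo] with s hs
    have h1 := tendsto_pow_atTop_nhds_zero_of_lt_one (Real.rpow_nonneg hs.1.le θ)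
      (Real.rpow_lt_one hs.1.le hs.2 hθ)
    have h2 := h1.const_mul (k 1 s)
    rw [mul_zero] at h2
    exact h2.congr fun n => by rw [Real.rpow_mul hs.1.le, Real.rpow_natCast]

theorem summable_phiCoeff_mul_pow (hk : IntegrableOn (k 1) (Ioo 0 1)) (hθ : 0 < θ) (R : ℝ) :
    Summable fun n => ‖phiCoeff k θ n * R ^ n‖ := by
  have h := (tendsto_integral_kernel_mul_rpow hk hθ).const_mul R
  rw [mul_zero] at h
  have h2 := h.norm
  rw [norm_zero] at h2
  refine Summable.norm (summable_of_ratio_norm_eventually_le (r := 1 / 2) (by norm_num) ?_)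
  filter_upwards [h2.eventually_le_const (show (0 : ℝ) < 1 / 2 by norm_num)] with n hn
  have e : phiCoeff k θ (n + 1) * R ^ (n + 1) =
      (R * ∫ s in Ioo (0 : ℝ) 1, k 1 s * s ^ (θ * n)) * (phiCoeff k θ n * R ^ n) := by
    rw [phiCoeff, pow_succ]; ring
  rw [e, norm_mul]
  gcongr

/-- The entire extension of `Φ_k`. -/
noncomputable def phiC (k : ℝ → ℝ → ℝ) (θ : ℝ) (z : ℂ) : ℂ :=
  ∑' n : ℕ, (phiCoeff k θ n : ℂ) * (-z) ^ n

theorem phiC_ofReal (z : ℝ) : phiC k θ z = (phi k θ z : ℂ) := by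
  simp [phiC, phi, Complex.ofReal_tsum]

theorem differentiable_phiC (hk : IntegrableOn (k 1) (Ioo 0 1)) (hθ : 0 < θ) :
    Differentiable ℂ (phiC k θ) := by
  intro z
  have h : DifferentiableOn ℂ (phiC k θ) (Metric.ball 0 (‖z‖ + 1)) := by
    refine Complex.differentiableOn_tsum_of_summable_norm
      (summable_phiCoeff_mul_pow hk hθ (‖z‖ + 1)) (fun n => by fun_prop) Metric.isOpen_ball
      fun n w hw => ?_
    rw [norm_mul, norm_mul, norm_pow, norm_pow, norm_neg, Complex.norm_real,
      Real.norm_of_nonneg (by positivity : 0 ≤ ‖z‖ + 1)]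
    have := (mem_ball_zero_iff.1 hw).le
    gcongr
  exact h.differentiableAt (Metric.isOpen_ball.mem_nhds (by simp))

theorem continuous_phi (hk : IntegrableOn (k 1) (Ioo 0 1)) (hθ : 0 < θ) :
    Continuous (phi k θ) := by
  have h : phi k θ = fun z : ℝ => (phiC k θ z).re := by
    ext z; rw [phiC_ofReal, Complex.ofReal_re]
  rw [h]
  exact Complex.continuous_re.comp
    ((differentiable_phiC hk hθ).continuous.comp Complex.continuous_ofReal)

/-- Termwise integration of the series raises the coefficient index by one, by the recursion; the
factor `-z` supplies the missing power. This is the equation for `u` seen at a single frequency. -/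
theorem phi_eq_one_sub (hk : IntegrableOn (k 1) (Ioo 0 1)) (hθ : 0 < θ) (z : ℝ) :
    phi k θ z = 1 - z * ∫ r in Ioo (0 : ℝ) 1, k 1 r * phi k θ (z * r ^ θ) := by
  have hs := summable_phiCoeff_mul_pow hk hθ z
  have hs' : Summable fun n => phiCoeff k θ n * (-z) ^ n := by
    refine Summable.of_norm (hs.congr fun n => ?_)
    simp
  have hint : ∀ n : ℕ, IntegrableOn
      (fun r => phiCoeff k θ n * (-z) ^ n * (k 1 r * r ^ (θ * n))) (Ioo 0 1) := fun n =>
    (integrableOn_kernel_mul_rpow hk hθ n).const_mul _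
  have hsum : HasSum (fun n : ℕ => ∫ r in Ioo (0 : ℝ) 1,
      phiCoeff k θ n * (-z) ^ n * (k 1 r * r ^ (θ * n)))
      (∫ r in Ioo (0 : ℝ) 1, ∑' n : ℕ, phiCoeff k θ n * (-z) ^ n * (k 1 r * r ^ (θ * n))) := by
    refine hasSum_integral_of_summable_integral_norm hint ?_
    refine Summable.of_nonneg_of_le (fun n => integral_nonneg fun r => norm_nonneg _)
      (fun n => ?_) (hs.mul_right (∫ r in Ioo (0 : ℝ) 1, ‖k 1 r‖))
    rw [← integral_const_mul]
    refine setIntegral_mono_on (hint n).norm (hk.norm.const_mul _) measurableSet_Ioo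
      fun r hr => ?_
    rw [norm_mul, norm_mul, norm_mul, norm_mul, norm_pow, norm_pow, norm_neg,
      Real.norm_of_nonneg (Real.rpow_nonneg hr.1.le _)]
    gcongr
    exact mul_le_of_le_one_right (norm_nonneg _)
      (Real.rpow_le_one hr.1.le hr.2.le (by positivity))
  have hrhs : ∫ r in Ioo (0 : ℝ) 1, ∑' n : ℕ, phiCoeff k θ n * (-z) ^ n * (k 1 r * r ^ (θ * n)) =
      ∫ r in Ioo (0 : ℝ) 1, k 1 r * phi k θ (z * r ^ θ) := by
    refine setIntegral_congr_fun measurableSet_Ioo fun r hr => ?_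
    simp only [phi]
    rw [← tsum_mul_left]
    refine tsum_congr fun n => ?_
    rw [Real.rpow_mul hr.1.le, Real.rpow_natCast, ← neg_mul, mul_pow]
    ring
  rw [hrhs] at hsum
  have h2 := (hsum.mul_left (-z)).tsum_eq
  rw [phi, hs'.tsum_eq_zero_add, sub_eq_add_neg, ← neg_mul, ← h2]
  congr 1
  · simp [phiCoeff]
  · refine tsum_congr fun n => ?_
    rw [integral_const_mul, phiCoeff, pow_succ]
    ring

end Series

/-! ### Exponential moments of `A` -/

section Moments

variable {Ω : Type*} [MeasurableSpace Ω] {P : Measure Ω} {A : Ω → ℝ}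

theorem laplaceRadius_eq_top {F : ℂ → ℂ} (hF : Differentiable ℂ F)
    (hLA : ∀ t : ℝ, 0 ≤ t → F t = (laplace A P t : ℂ)) : laplaceRadius A P = ⊤ := by
  refine top_le_iff.1 (le_sSup ⟨F, hF.differentiableOn, fun t ht _ => hLA t ht⟩)

variable [IsProbabilityMeasure P]

theorem integrable_exp_mul_of_nonpos (hA : Measurable A) (hApos : ∀ᵐ ω ∂P, 0 < A ω) {t : ℝ}
    (ht : t ≤ 0) : Integrable (fun ω => Real.exp (t * A ω)) P := by
  refine Integrable.of_bound (by fun_prop) 1 ?_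
  filter_upwards [hApos] with ω hω
  rw [Real.norm_of_nonneg (Real.exp_pos _).le, Real.exp_le_one_iff]
  exact mul_nonpos_of_nonpos_of_nonneg ht hω.le

/-- If the Laplace transform of a positive random variable extends to an entire function, then
all its exponential moments are finite. -/
theorem integrable_exp_mul_of_entire (hA : Measurable A) (hApos : ∀ᵐ ω ∂P, 0 < A ω)
    {F : ℂ → ℂ} (hF : Differentiable ℂ F)
    (hLA : ∀ t : ℝ, 0 ≤ t → F t = (laplace A P t : ℂ)) (c : ℝ) :
    Integrable (fun ω => Real.exp (c * A ω)) P := by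
  rcases le_total c 0 with hc | hc
  · exact integrable_exp_mul_of_nonpos hA hApos hc
  have hI : Iio 0 ⊆ interior (integrableExpSet A P) :=
    interior_maximal (fun t ht => integrable_exp_mul_of_nonpos hA hApos (le_of_lt ht)) isOpen_Iio
  have hU : AnalyticOnNhd ℂ (complexMGF A P) {z | z.re < 0} := fun z hz =>
    analyticAt_complexMGF (hI hz)
  have hG : Differentiable ℂ fun z => F (-z) := hF.comp differentiable_neg
  have hopen : IsOpen {z : ℂ | z.re < 0} := isOpen_lt Complex.continuous_re continuous_const
  have hmem : (-1 : ℂ) ∈ {z : ℂ | z.re < 0} := by simp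
  -- Identity theorem: both functions are holomorphic on the left half-plane and agree at real
  -- points accumulating at -1.
  have heq : EqOn (complexMGF A P) (fun z => F (-z)) {z | z.re < 0} := by
    refine hU.eqOn_of_preconnected_of_frequently_eq (fun z _ => hG.analyticAt z)
      (convex_halfSpace_re_lt 0).isPreconnected hmem ?_
    have h1 : ∀ᶠ t : ℝ in 𝓝[≠] (-1), complexMGF A P t = F (-t) := by
      filter_upwards [nhdsWithin_le_nhds (Iio_mem_nhds (show (-1 : ℝ) < 0 by norm_num))] with t ht
      rw [complexMGF_ofReal, ← Complex.ofReal_neg, hLA _ (by simpa using le_of_lt ht), mgf, laplace]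
      simp
    have h2 : Tendsto (fun t : ℝ => (t : ℂ)) (𝓝[≠] (-1)) (𝓝[≠] (-1)) := by
      refine tendsto_nhdsWithin_iff.2 ⟨?_, ?_⟩
      · have := (Complex.continuous_ofReal.tendsto (-1 : ℝ))
        simp only [Complex.ofReal_neg, Complex.ofReal_one] at this
        exact this.mono_left nhdsWithin_le_nhds
      · filter_upwards [self_mem_nhdsWithin] with t ht h
        exact ht (by simpa using (Complex.ofReal_inj (w := -1)).1 (by simpa using h))
    exact h2.frequently h1.frequently
  -- The derivatives of the entire function at -1 are the moments of A weighted by exp(-A), hence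
  -- nonnegative.
  have hder : ∀ n, iteratedDeriv n (fun z => F (-z)) (-1) =
      ((∫ ω, A ω ^ n * Real.exp (-1 * A ω) ∂P : ℝ) : ℂ) := fun n => by
    rw [← (heq.eventuallyEq_of_mem (hopen.mem_nhds hmem)).iteratedDeriv_eq,
      iteratedDeriv_complexMGF (hI (by simp)), ← integral_complex_ofReal]
    simp
  have hint : ∀ n, Integrable (fun ω => A ω ^ n * Real.exp (-1 * A ω)) P := fun n =>
    integrable_pow_mul_exp_of_mem_interior_integrableExpSet (hI (by simp)) n
  -- The Taylor series about -1 is evaluated at `c`, at distance `c + 1`; as `c ≥ 0`, all its terms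
  -- are nonnegative.
  have hsum := (Complex.hasSum_taylorSeries_of_entire hG (-1) ((c + 1 : ℝ) - 1 : ℂ)).summable
  have hsum' : Summable fun n : ℕ => ((n.factorial : ℝ)⁻¹ * (c + 1) ^ n) *
      ∫ ω, A ω ^ n * Real.exp (-1 * A ω) ∂P := by
    rw [← Complex.summable_ofReal]
    refine hsum.congr fun n => ?_
    rw [hder]
    push_cast
    simp only [smul_eq_mul]
    ring
  refine ⟨by fun_prop, ?_⟩
  rw [hasFiniteIntegral_iff_ofReal (ae_of_all _ fun ω => (Real.exp_pos _).le)]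
  -- Expand exp(cA) = exp(-A) exp((c+1)A). The terms are nonnegative, so Tonelli identifies the
  -- expectation with the convergent Taylor series.
  have hterm : ∀ᵐ ω ∂P, ENNReal.ofReal (Real.exp (c * A ω)) = ∑' n : ℕ,
      ENNReal.ofReal (((n.factorial : ℝ)⁻¹ * (c + 1) ^ n) *
        (A ω ^ n * Real.exp (-1 * A ω))) := by
    filter_upwards [hApos] with ω hω
    have h1 := (NormedSpace.expSeries_div_hasSum_exp ((c + 1) * A ω)).mul_right
      (Real.exp (-1 * A ω))
    rw [← Real.exp_eq_exp_ℝ, ← Real.exp_add] at h1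
    have h2 : HasSum (fun n : ℕ => ((n.factorial : ℝ)⁻¹ * (c + 1) ^ n) *
        (A ω ^ n * Real.exp (-1 * A ω))) (Real.exp (c * A ω)) := by
      convert! h1 using 1
      · ext n; rw [mul_pow]; ring
      · ring_nf
    rw [← h2.tsum_eq, ENNReal.ofReal_tsum_of_nonneg (fun n => by positivity) h2.summable]
  rw [lintegral_congr_ae hterm, lintegral_tsum (fun n => by fun_prop)]
  have hterm2 : ∀ n : ℕ, ∫⁻ ω, ENNReal.ofReal (((n.factorial : ℝ)⁻¹ * (c + 1) ^ n) *
      (A ω ^ n * Real.exp (-1 * A ω))) ∂P = ENNReal.ofReal (((n.factorial : ℝ)⁻¹ * (c + 1) ^ n) *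
      ∫ ω, A ω ^ n * Real.exp (-1 * A ω) ∂P) := fun n => by
    rw [← integral_const_mul, ofReal_integral_eq_lintegral_ofReal ((hint n).const_mul _)]
    filter_upwards [hApos] with ω hω
    positivity
  simp only [hterm2]
  rw [← ENNReal.ofReal_tsum_of_nonneg (fun n => ?_) hsum']
  · exact ENNReal.ofReal_lt_top
  · refine mul_nonneg (by positivity) (integral_nonneg_of_ae ?_)
    filter_upwards [hApos] with ω hω
    positivity

end Moments

/-! ### Signed densities -/

section Signed

variable {Ω : Type*} [MeasurableSpace Ω] {P : Measure Ω} {D : Ω → ℝ}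

/-- `ENNReal.ofReal` truncates at zero, so the two measures are the positive and negative parts of
the signed measure with density `D`. Uniqueness theorems for positive measures thereby become
applicable to `D`. -/
theorem integral_withDensity_sub {E : Type*} [NormedAddCommGroup E] [NormedSpace ℝ E]
    (hD : AEMeasurable D P) {g : Ω → E} (hg : AEStronglyMeasurable g P)
    (hDg : Integrable (fun ω => D ω • g ω) P) :
    (∫ ω, g ω ∂P.withDensity fun ω => ENNReal.ofReal (D ω)) -
      (∫ ω, g ω ∂P.withDensity fun ω => ENNReal.ofReal (-D ω)) = ∫ ω, D ω • g ω ∂P := by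
  have hi : ∀ {D' : Ω → ℝ}, AEMeasurable D' P → (∀ ω, |D' ω| ≤ |D ω|) →
      Integrable (fun ω => D' ω • g ω) P := fun {D'} hD' hle => by
    refine hDg.mono (hD'.aestronglyMeasurable.smul hg) (ae_of_all _ fun ω => ?_)
    rw [norm_smul, norm_smul]
    exact mul_le_mul_of_nonneg_right (hle ω) (norm_nonneg _)
  rw [integral_withDensity_eq_integral_toReal_smul₀ hD.ennreal_ofReal (by simp),
    integral_withDensity_eq_integral_toReal_smul₀ (f := fun ω => ENNReal.ofReal (-D ω))
      (by fun_prop) (by simp),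
    ← integral_sub]
  · refine integral_congr_ae (ae_of_all _ fun ω => ?_)
    simp only [ENNReal.toReal_ofReal', ← sub_smul]
    congr 1
    grind
  · refine hi (by fun_prop) fun ω => ?_
    rw [ENNReal.toReal_ofReal']
    grind
  · refine hi (by fun_prop) fun ω => ?_
    rw [ENNReal.toReal_ofReal']
    grind

theorem isFiniteMeasure_withDensity_neg_ofReal (hD : Integrable D P) :
    IsFiniteMeasure (P.withDensity fun ω => ENNReal.ofReal (-D ω)) :=
  isFiniteMeasure_withDensity_ofReal hD.neg.2

theorem integral_eq_of_integral_smul_eq_zero {E : Type*} [NormedAddCommGroup E]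
    [NormedSpace ℝ E] (hD : AEMeasurable D P) {g : Ω → E} (hg : AEStronglyMeasurable g P)
    (hDg : Integrable (fun ω => D ω • g ω) P) (h : ∫ ω, D ω • g ω ∂P = 0) :
    (∫ ω, g ω ∂P.withDensity fun ω => ENNReal.ofReal (D ω)) =
      ∫ ω, g ω ∂P.withDensity fun ω => ENNReal.ofReal (-D ω) :=
  sub_eq_zero.1 ((integral_withDensity_sub hD hg hDg).trans h)

/-- If a signed density `D` integrates every exponential `exp (s X)` to zero, then it integrates
`exp (i X)` to zero. -/
theorem integral_mul_cexp_eq_zero_of_forall_exp (hD : Integrable D P) {X : Ω → ℝ}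
    (hX : AEMeasurable X P) (hint : ∀ s : ℝ, Integrable (fun ω => D ω * Real.exp (s * X ω)) P)
    (h : ∀ s : ℝ, ∫ ω, D ω * Real.exp (s * X ω) ∂P = 0) :
    ∫ ω, (D ω : ℂ) * Complex.exp (X ω * Complex.I) ∂P = 0 := by
  set μ := P.withDensity fun ω => ENNReal.ofReal (D ω) with hμdef
  set μ' := P.withDensity fun ω => ENNReal.ofReal (-D ω) with hμ'def
  have hDm := hD.1.aemeasurable
  have : IsFiniteMeasure μ := isFiniteMeasure_withDensity_ofReal hD.2
  have : IsFiniteMeasure μ' := isFiniteMeasure_withDensity_neg_ofReal hD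
  have hmgf : mgf X μ = mgf X μ' := by
    ext s
    exact integral_eq_of_integral_smul_eq_zero hDm
      (g := fun ω => Real.exp (s * X ω)) (by fun_prop) (hint s) (h s)
  have hset : ∀ D' : Ω → ℝ, AEMeasurable D' P → (∀ ω, |D' ω| = |D ω|) →
      integrableExpSet X (P.withDensity fun ω => ENNReal.ofReal (D' ω)) = univ := by
    intro D' hD' hle
    refine eq_univ_of_forall fun s => ?_
    rw [integrableExpSet, mem_ofPred_eq,
      integrable_withDensity_iff_integrable_smul₀' hD'.ennreal_ofReal (by simp)]
    refine (hint s).mono (by fun_prop) (ae_of_all _ fun ω => ?_)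
    rw [norm_smul, norm_mul, ENNReal.toReal_ofReal', Real.norm_eq_abs]
    refine mul_le_mul_of_nonneg_right ?_ (norm_nonneg _)
    rw [Real.norm_eq_abs, ← hle]
    grind
  have hs1 : integrableExpSet X μ = univ := hset D hDm fun ω => rfl
  -- At 0 the moment generating functions are the total masses.
  have hzero : μ = 0 ↔ μ' = 0 := by
    have h0 := congr_fun hmgf 0
    simp only [mgf_zero', measureReal_def] at h0
    rw [ENNReal.toReal_eq_toReal_iff' (measure_ne_top _ _) (measure_ne_top _ _)] at h0
    rw [← Measure.measure_univ_eq_zero, ← Measure.measure_univ_eq_zero, h0]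
  -- The generating functions are finite and equal on all of ℝ, so their analytic continuations
  -- agree on ℂ; evaluate at i.
  have heq := eqOn_complexMGF_of_mgf' hmgf hzero (x := Complex.I) (by simp [hs1])
  simp only [complexMGF] at heq
  have hDi : Integrable (fun ω => D ω • Complex.exp (Complex.I * X ω)) P := by
    refine hD.norm.mono' (by fun_prop) (ae_of_all _ fun ω => ?_)
    rw [norm_smul, mul_comm Complex.I, Complex.norm_exp_ofReal_mul_I, mul_one]
  have := integral_withDensity_sub hDm (g := fun ω => Complex.exp (Complex.I * X ω))
    (by fun_prop) hDi
  rw [heq, sub_self] at this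
  rw [this]
  exact integral_congr_ae (ae_of_all _ fun ω => by simp [mul_comm])

/-- If a signed density `D` integrates all trigonometric monomials of a family of random variables
to zero, then it integrates to zero over every set generated by the family. -/
theorem setIntegral_eq_zero_of_forall_cexp (hD : Integrable D P) {ι : Type*} {X : ι → Ω → ℝ}
    (hX : ∀ i, Measurable (X i))
    (h : ∀ (I : Finset ι) (r : I → ℝ),
      ∫ ω, (D ω : ℂ) * Complex.exp ((∑ i, r i * X i ω : ℝ) * Complex.I) ∂P = 0)
    {S : Set Ω} (hS : MeasurableSet[⨆ i, MeasurableSpace.comap (X i) inferInstance] S) :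
    ∫ ω in S, D ω ∂P = 0 := by
  set μ := P.withDensity fun ω => ENNReal.ofReal (D ω) with hμdef
  set μ' := P.withDensity fun ω => ENNReal.ofReal (-D ω) with hμ'def
  have hDm := hD.1.aemeasurable
  have : IsFiniteMeasure μ := isFiniteMeasure_withDensity_ofReal hD.2
  have : IsFiniteMeasure μ' := isFiniteMeasure_withDensity_neg_ofReal hD
  let Y : Ω → ι → ℝ := fun ω i => X i ω
  have hY : Measurable Y := measurable_pi_iff.2 hX
  have hcomap : (⨆ i, MeasurableSpace.comap (X i) inferInstance) =
      MeasurableSpace.comap Y MeasurableSpace.pi := by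
    simp only [MeasurableSpace.pi, MeasurableSpace.comap_iSup, MeasurableSpace.comap_comp]
    rfl
  -- The hypothesis says that all finite-dimensional marginals have equal characteristic functions,
  -- and the marginals determine a finite measure on the product space.
  have hmap : μ.map Y = μ'.map Y := by
    refine IsProjectiveLimit.unique (P := fun I => (μ.map Y).map I.restrict) (fun I => rfl)
      fun I => ?_
    have hr : Measurable (I.restrict (π := fun _ : ι => ℝ)) := Finset.measurable_restrict I
    refine Measure.ext_of_charFunDual ?_
    ext L
    simp only [charFunDual_apply]
    rw [integral_map hr.aemeasurable (by fun_prop), integral_map hr.aemeasurable (by fun_prop),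
      integral_map hY.aemeasurable (by fun_prop), integral_map hY.aemeasurable (by fun_prop)]
    classical
    have hL : ∀ ω, L (I.restrict (Y ω)) = ∑ i : I, L (Pi.single i 1) * X i ω := fun ω => by
      conv_lhs => rw [← Finset.univ_sum_single (I.restrict (Y ω)), map_sum]
      refine Finset.sum_congr rfl fun i _ => ?_
      have : (Pi.single i (I.restrict (Y ω) i) : I → ℝ) = X i ω • Pi.single i 1 := by
        rw [← Pi.single_smul, smul_eq_mul, mul_one]; rfl
      rw [this, map_smul, smul_eq_mul, mul_comm]
    have hm : Measurable fun ω => Complex.exp (L (I.restrict (Y ω)) * Complex.I) := by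
      fun_prop
    refine (integral_eq_of_integral_smul_eq_zero hDm hm.aestronglyMeasurable ?_ ?_).symm
    · refine hD.norm.mono' (hD.1.smul hm.aestronglyMeasurable) (ae_of_all _ fun ω => ?_)
      rw [norm_smul, Complex.norm_exp_ofReal_mul_I, mul_one]
    · rw [← h I fun i => L (Pi.single i 1)]
      refine integral_congr_ae (ae_of_all _ fun ω => ?_)
      simp only [hL, Complex.real_smul]
  rw [hcomap] at hS
  obtain ⟨T, hT, rfl⟩ := hS
  have hST : MeasurableSet (Y ⁻¹' T) := hY hT
  have h1 := integral_withDensity_sub hDm (g := (Y ⁻¹' T).indicator fun _ => (1 : ℝ))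
    (by measurability) ?_
  · rw [integral_indicator hST, integral_indicator hST] at h1
    simp only [integral_const, smul_eq_mul, mul_one, measureReal_restrict_apply_univ] at h1
    have h2 := congr_arg (fun m => Measure.real m T) hmap
    simp only [measureReal_def, Measure.map_apply hY hT] at h2
    rw [measureReal_def, measureReal_def, h2, sub_self] at h1
    rw [← integral_indicator hST, h1]
    refine integral_congr_ae (ae_of_all _ fun ω => ?_)
    by_cases hω : ω ∈ Y ⁻¹' T <;> simp [hω]
  · refine (hD.indicator hST).congr (ae_of_all _ fun ω => ?_)
    by_cases hω : ω ∈ Y ⁻¹' T <;> simp [hω]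

end Signed

/-! ### Mixed exponentials of Wiener integrals -/

section Mixed

variable {Ω : Type*} [MeasurableSpace Ω] {P : Measure Ω} {B : ℝ → Ω → ℝ} {A : Ω → ℝ}

theorem IsWienerIntegral.aemeasurable {f : ℝ → ℝ} {Y : Ω → ℝ} (hY : IsWienerIntegral B P f Y) :
    AEMeasurable Y P :=
  hY.1.aestronglyMeasurable.aemeasurable

theorem IsWienerIntegral.map_prod_eq (hB : IsTwoSidedBrownian B P) (hA : Measurable A)
    (hAB : IndepFun A (fun ω t => B t ω) P) {f : ℝ → ℝ} {Y : Ω → ℝ}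
    (hf : MemLp f 2 volume) (hY : IsWienerIntegral B P f Y) :
    P.map (fun ω => (A ω, Y ω)) = (P.map A).prod
      (gaussianReal 0 ((eLpNorm f 2 volume).toReal ^ 2).toNNReal) := by
  have := hB.gaussian.isProbabilityMeasure
  rw [(indepFun_iff_map_prod_eq_prod_map_map hA.aemeasurable hY.aemeasurable).1
    (hY.indepFun hB hAB), hY.map_eq hB hf]

theorem integral_exp_mul_gaussianReal (v : ℝ) (hv : 0 ≤ v) (t : ℝ) :
    ∫ x, Real.exp (t * x) ∂gaussianReal 0 v.toNNReal = Real.exp (t ^ 2 * v / 2) := by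
  have := mgf_gaussianReal (p := gaussianReal 0 v.toNNReal) (X := id)
    (μ := 0) (v := v.toNNReal) Measure.map_id t
  rw [mgf] at this
  simp only [id] at this
  rw [this, Real.coe_toNNReal _ hv]
  congr 1
  ring

/-- Integration of `w(A) exp(√A I(f))`. -/
theorem IsWienerIntegral.integral_mul_exp (hB : IsTwoSidedBrownian B P) (hA : Measurable A)
    (hApos : ∀ᵐ ω ∂P, 0 < A ω) (hAB : IndepFun A (fun ω t => B t ω) P) {f : ℝ → ℝ} {Y : Ω → ℝ}
    (hf : MemLp f 2 volume) (hY : IsWienerIntegral B P f Y) {w : ℝ → ℝ} (hw : Measurable w)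
    (hint : Integrable (fun ω => w (A ω) *
      Real.exp ((eLpNorm f 2 volume).toReal ^ 2 / 2 * A ω)) P) :
    Integrable (fun ω => w (A ω) * Real.exp (√(A ω) * Y ω)) P ∧
    ∫ ω, w (A ω) * Real.exp (√(A ω) * Y ω) ∂P =
      ∫ ω, w (A ω) * Real.exp ((eLpNorm f 2 volume).toReal ^ 2 / 2 * A ω) ∂P := by
  have := hB.gaussian.isProbabilityMeasure
  set v := (eLpNorm f 2 volume).toReal ^ 2 with hv
  have hv0 : 0 ≤ v := sq_nonneg _
  have hm := hY.map_prod_eq hB hA hAB hf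
  have hF : Measurable fun p : ℝ × ℝ => w p.1 * Real.exp (√p.1 * p.2) := by fun_prop
  have hAY : AEMeasurable (fun ω => (A ω, Y ω)) P := hA.aemeasurable.prodMk hY.aemeasurable
  have hsq : ∀ᵐ a ∂P.map A, √a ^ 2 = a := by
    rw [ae_map_iff hA.aemeasurable (by measurability)]
    filter_upwards [hApos] with ω hω
    exact Real.sq_sqrt hω.le
  -- By independence, conditioning on A = a leaves a Gaussian integral with exponent √a.
  have hin : ∀ᵐ a ∂P.map A, ∫ y, w a * Real.exp (√a * y) ∂gaussianReal 0 v.toNNReal =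
      w a * Real.exp (v / 2 * a) := by
    filter_upwards [hsq] with a ha
    rw [integral_const_mul, integral_exp_mul_gaussianReal v hv0, ha]
    ring_nf
  have hprod : Integrable (fun p : ℝ × ℝ => w p.1 * Real.exp (√p.1 * p.2))
      ((P.map A).prod (gaussianReal 0 v.toNNReal)) := by
    rw [integrable_prod_iff hF.aestronglyMeasurable]
    refine ⟨ae_of_all _ fun a => (integrable_exp_mul_gaussianReal (√a)).const_mul (w a), ?_⟩
    have h1 : Integrable (fun a => ‖w a * Real.exp (v / 2 * a)‖) (P.map A) := by
      rw [integrable_map_measure (by fun_prop) hA.aemeasurable]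
      exact hint.norm
    refine h1.congr ?_
    filter_upwards [hsq] with a ha
    simp only [norm_mul, Real.norm_of_nonneg (Real.exp_pos _).le]
    rw [integral_const_mul, integral_exp_mul_gaussianReal v hv0, ha]
    ring_nf
  constructor
  · have h2 := hprod
    rw [← hm, integrable_map_measure hF.aestronglyMeasurable hAY] at h2
    exact h2
  · have h3 := integral_map hAY (f := fun p : ℝ × ℝ => w p.1 * Real.exp (√p.1 * p.2))
      hF.aestronglyMeasurable
    rw [← h3, hm, integral_prod _ hprod, integral_congr_ae hin,
      integral_map hA.aemeasurable (by fun_prop)]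

/-- The characteristic function of `√A I(f)` in terms of the Laplace transform of `A`. -/
theorem IsWienerIntegral.integral_cexp (hB : IsTwoSidedBrownian B P) (hA : Measurable A)
    (hApos : ∀ᵐ ω ∂P, 0 < A ω) (hAB : IndepFun A (fun ω t => B t ω) P) {f : ℝ → ℝ} {Y : Ω → ℝ}
    (hf : MemLp f 2 volume) (hY : IsWienerIntegral B P f Y) (ξ : ℝ) :
    ∫ ω, Complex.exp ((ξ * (√(A ω) * Y ω) : ℝ) * Complex.I) ∂P =
      (laplace A P (ξ ^ 2 * (eLpNorm f 2 volume).toReal ^ 2 / 2) : ℂ) := by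
  have := hB.gaussian.isProbabilityMeasure
  have : IsProbabilityMeasure (P.map A) := Measure.isProbabilityMeasure_map hA.aemeasurable
  set v := (eLpNorm f 2 volume).toReal ^ 2 with hv
  have hv0 : 0 ≤ v := sq_nonneg _
  have hm := hY.map_prod_eq hB hA hAB hf
  have hF : Measurable fun p : ℝ × ℝ => Complex.exp ((ξ * (√p.1 * p.2) : ℝ) * Complex.I) := by
    fun_prop
  have hAY : AEMeasurable (fun ω => (A ω, Y ω)) P := hA.aemeasurable.prodMk hY.aemeasurable
  have hin : ∀ᵐ a ∂P.map A, ∫ y, Complex.exp ((ξ * (√a * y) : ℝ) * Complex.I)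
      ∂gaussianReal 0 v.toNNReal = ((Real.exp (-(ξ ^ 2 * v / 2) * a) : ℝ) : ℂ) := by
    rw [ae_map_iff hA.aemeasurable (measurableSet_eq_fun
      (StronglyMeasurable.integral_prod_right hF.stronglyMeasurable).measurable (by fun_prop))]
    filter_upwards [hApos] with ω hω
    have h1 := charFun_gaussianReal (μ := 0) (v := v.toNNReal) (ξ * √(A ω))
    rw [charFun_apply_real] at h1
    have h2 : √(A ω) ^ 2 = A ω := Real.sq_sqrt hω.le
    rw [Real.coe_toNNReal _ hv0] at h1
    calc _ = ∫ x : ℝ, Complex.exp (((ξ * √(A ω) : ℝ) : ℂ) * x * Complex.I)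
          ∂gaussianReal 0 v.toNNReal := by
          refine integral_congr_ae (ae_of_all _ fun x => ?_)
          push_cast; ring_nf
      _ = _ := by
          rw [h1, Complex.ofReal_exp]
          congr 1
          conv_rhs => rw [← h2]
          push_cast
          ring
  have hprod : Integrable (fun p : ℝ × ℝ => Complex.exp ((ξ * (√p.1 * p.2) : ℝ) * Complex.I))
      ((P.map A).prod (gaussianReal 0 v.toNNReal)) :=
    Integrable.of_bound hF.aestronglyMeasurable 1
      (ae_of_all _ fun p => by rw [Complex.norm_exp_ofReal_mul_I])
  have h3 := integral_map hAY
    (f := fun p : ℝ × ℝ => Complex.exp ((ξ * (√p.1 * p.2) : ℝ) * Complex.I))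
    hF.aestronglyMeasurable
  rw [← h3, hm, integral_prod _ hprod, integral_congr_ae hin,
    integral_map hA.aemeasurable (by fun_prop), integral_complex_ofReal]
  rfl

/-- The isometry on all of L², read off from the variance of the Gaussian law. -/
theorem IsWienerIntegral.eLpNorm_eq (hB : IsTwoSidedBrownian B P) {f : ℝ → ℝ} {Y : Ω → ℝ}
    (hf : MemLp f 2 volume) (hY : IsWienerIntegral B P f Y) :
    eLpNorm Y 2 P = eLpNorm f 2 volume := by
  rw [← ENNReal.toReal_eq_toReal_iff' hY.1.eLpNorm_ne_top hf.eLpNorm_ne_top,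
    ← sq_eq_sq₀ ENNReal.toReal_nonneg ENNReal.toReal_nonneg, eLpNorm_two_toReal_sq hY.1]
  have h1 := integral_map hY.aemeasurable (f := fun x : ℝ => x ^ 2) (by fun_prop)
  have h2 := variance_id_gaussianReal (μ := 0) (v := ((eLpNorm f 2 volume).toReal ^ 2).toNNReal)
  rw [variance_of_integral_eq_zero aemeasurable_id (by simp)] at h2
  rw [← h1, hY.map_eq hB hf]
  simpa using h2

/-- By linearity `Y - Y'` is a Wiener integral of 0, so the isometry gives it norm 0. -/
theorem IsWienerIntegral.ae_eq (hB : IsTwoSidedBrownian B P) {f : ℝ → ℝ} {Y Y' : Ω → ℝ}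
    (hf : MemLp f 2 volume) (hY : IsWienerIntegral B P f Y) (hY' : IsWienerIntegral B P f Y') :
    Y =ᵐ[P] Y' := by
  have h := hY.comb hB hf hf hY' 1 (-1)
  have h0 := h.eLpNorm_eq hB (by simp)
  rw [show (fun x => 1 * f x + -1 * f x) = 0 by ext; simp, eLpNorm_zero,
    eLpNorm_eq_zero_iff h.1.aestronglyMeasurable two_ne_zero] at h0
  filter_upwards [h0] with ω hω
  simp only [Pi.zero_apply] at hω
  linarith

end Mixed

/-! ### Totality of the exponentials exp(√A I(η)) in L²_A. -/

section Uniqueness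

variable {Ω : Type*} [MeasurableSpace Ω] {P : Measure Ω} {B : ℝ → Ω → ℝ} {A : Ω → ℝ}

theorem IsWienerIntegral.integrable_exp (hB : IsTwoSidedBrownian B P) (hA : Measurable A)
    (hApos : ∀ᵐ ω ∂P, 0 < A ω) (hAB : IndepFun A (fun ω t => B t ω) P)
    (hexp : ∀ c : ℝ, Integrable (fun ω => Real.exp (c * A ω)) P) {f : ℝ → ℝ} {Y : Ω → ℝ}
    (hf : MemLp f 2 volume) (hY : IsWienerIntegral B P f Y) :
    Integrable (fun ω => Real.exp (√(A ω) * Y ω)) P := by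
  simpa using (hY.integral_mul_exp hB hA hApos hAB hf (w := fun _ => 1) (by fun_prop)
    (by simpa using hexp _)).1

theorem IsWienerIntegral.integral_exp (hB : IsTwoSidedBrownian B P) (hA : Measurable A)
    (hApos : ∀ᵐ ω ∂P, 0 < A ω) (hAB : IndepFun A (fun ω t => B t ω) P)
    (hexp : ∀ c : ℝ, Integrable (fun ω => Real.exp (c * A ω)) P) {f : ℝ → ℝ} {Y : Ω → ℝ}
    (hf : MemLp f 2 volume) (hY : IsWienerIntegral B P f Y) :
    ∫ ω, Real.exp (√(A ω) * Y ω) ∂P = mgf A P ((eLpNorm f 2 volume).toReal ^ 2 / 2) := by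
  simpa [mgf] using (hY.integral_mul_exp hB hA hApos hAB hf (w := fun _ => 1) (by fun_prop)
    (by simpa using hexp _)).2

theorem IsWienerIntegral.const_mul (hB : IsTwoSidedBrownian B P) {f : ℝ → ℝ} {Y : Ω → ℝ}
    (hf : MemLp f 2 volume) (hY : IsWienerIntegral B P f Y) (s : ℝ) :
    IsWienerIntegral B P (fun x => s * f x) (fun ω => s * Y ω) := by
  simpa using hY.comb hB hf hf hY s 0

/-- The square of the exponential belonging to `f` is the exponential belonging to `2f`. -/
theorem IsWienerIntegral.memLp_exp (hB : IsTwoSidedBrownian B P) (hA : Measurable A)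
    (hApos : ∀ᵐ ω ∂P, 0 < A ω) (hAB : IndepFun A (fun ω t => B t ω) P)
    (hexp : ∀ c : ℝ, Integrable (fun ω => Real.exp (c * A ω)) P) {f : ℝ → ℝ} {Y : Ω → ℝ}
    (hf : MemLp f 2 volume) (hY : IsWienerIntegral B P f Y) :
    MemLp (fun ω => Real.exp (√(A ω) * Y ω)) 2 P := by
  have hYm := hY.aemeasurable
  rw [memLp_two_iff_integrable_sq (by fun_prop)]
  refine ((hY.const_mul hB hf 2).integrable_exp hB hA hApos hAB hexp
    (hf.const_mul 2)).congr (ae_of_all _ fun ω => ?_)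
  simp only
  rw [← Real.exp_nat_mul]
  congr 1
  push_cast
  ring

/-- A square integrable `D` that is orthogonal to all exponentials `exp(√A I(η))` with Schwartz
`η` is orthogonal to all `exp(i √A I(g))` with `g ∈ L²`. -/
theorem integral_mul_cexp_eq_zero (hB : IsTwoSidedBrownian B P) (hA : Measurable A)
    (hApos : ∀ᵐ ω ∂P, 0 < A ω) (hAB : IndepFun A (fun ω t => B t ω) P)
    (hexp : ∀ c : ℝ, Integrable (fun ω => Real.exp (c * A ω)) P) {D : Ω → ℝ}
    (hD : MemLp D 2 P)
    (h : ∀ η : 𝓢(ℝ, ℝ), ∫ ω, D ω *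
      Real.exp (√(A ω) * wienerIntegral B P (fun x => η x) ω) ∂P = 0)
    {g : ℝ → ℝ} {Y : Ω → ℝ} (hg : MemLp g 2 volume) (hY : IsWienerIntegral B P g Y) :
    ∫ ω, (D ω : ℂ) * Complex.exp ((√(A ω) * Y ω : ℝ) * Complex.I) ∂P = 0 := by
  have := hB.gaussian.isProbabilityMeasure
  have hS : ∀ η : 𝓢(ℝ, ℝ), MemLp (fun x => η x) 2 volume := fun η => η.memLp 2 volume
  have hW : ∀ η : 𝓢(ℝ, ℝ), IsWienerIntegral B P (fun x => η x)
    (wienerIntegral B P fun x => η x) := fun η => isWienerIntegral_wienerIntegral hB (hS η)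
  -- Testing with `s • η` for every real `s` gives a vanishing generating function, which continues
  -- analytically to imaginary arguments.
  have key : ∀ η : 𝓢(ℝ, ℝ), ∫ ω, (D ω : ℂ) * Complex.exp
      ((√(A ω) * wienerIntegral B P (fun x => η x) ω : ℝ) * Complex.I) ∂P = 0 := by
    intro η
    have hm := (hW η).aemeasurable
    have hsη : ∀ s : ℝ, (fun ω => D ω *
        Real.exp (s * (√(A ω) * wienerIntegral B P (fun x => η x) ω))) =ᵐ[P] fun ω =>
        D ω * Real.exp (√(A ω) * wienerIntegral B P (fun x => (s • η) x) ω) := fun s => by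
      have h1 := ((hW η).const_mul hB (hS η) s).ae_eq hB ((hS η).const_mul s) (hW (s • η))
      filter_upwards [h1] with ω hω
      rw [← hω]
      ring_nf
    refine integral_mul_cexp_eq_zero_of_forall_exp (hD.integrable one_le_two) (by fun_prop)
      (fun s => ?_) fun s => ?_
    · exact (integrable_congr (hsη s)).2
        (hD.integrable_mul ((hW (s • η)).memLp_exp hB hA hApos hAB hexp (hS _)))
    · rw [integral_congr_ae (hsη s), h]
  -- Oscillating exponentials are bounded, so the identity passes from Schwartz functions to L²
  -- limits, dominated by `|D|`.
  have hdense := SchwartzMap.denseRange_toLpCLM (E := ℝ) (F := ℝ) (p := 2) (μ := volume)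
    ENNReal.ofNat_ne_top hg.toLp
  obtain ⟨u, hu, hlim⟩ := mem_closure_iff_seq_limit.1 hdense
  choose η hη using hu
  have hlim2 : Tendsto (fun m => eLpNorm (fun x => g x - η m x) 2 volume) atTop (𝓝 0) := by
    rw [Lp.tendsto_Lp_iff_tendsto_eLpNorm'] at hlim
    refine hlim.congr fun m => ?_
    rw [← eLpNorm_neg, ← hη]
    refine eLpNorm_congr_ae ?_
    filter_upwards [hg.coeFn_toLp, (η m).coeFn_toLp 2 volume] with x hx hx'
    simp [hx, hx', SchwartzMap.toLpCLM_apply]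
  have hlim3 : Tendsto (fun m => eLpNorm (fun ω => Y ω -
      wienerIntegral B P (fun x => η m x) ω) 2 P) atTop (𝓝 0) := by
    refine hlim2.congr fun m => ?_
    have h1 := (hY.comb hB hg (hS (η m)) (hW (η m)) 1 (-1)).eLpNorm_eq hB
      ((hg.const_mul 1).add ((hS (η m)).const_mul (-1)))
    have e1 : (fun x => g x - η m x) = fun x => 1 * g x + -1 * η m x := by ext; ring
    have e2 : (fun ω => Y ω - wienerIntegral B P (fun x => η m x) ω) =
        fun ω => 1 * Y ω + -1 * wienerIntegral B P (fun x => η m x) ω := by ext; ring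
    rw [e1, e2, h1]
    rfl
  obtain ⟨ns, -, hae⟩ := exists_subseq_ae_tendsto hY.1 (fun m => (hW (η m)).1) hlim3
  have hYm := hY.aemeasurable
  have hDm := hD.1
  have t1 : Tendsto (fun m => ∫ ω, (D ω : ℂ) * Complex.exp ((√(A ω) *
      wienerIntegral B P (fun x => η (ns m) x) ω : ℝ) * Complex.I) ∂P) atTop
      (𝓝 (∫ ω, (D ω : ℂ) * Complex.exp ((√(A ω) * Y ω : ℝ) * Complex.I) ∂P)) := by
    refine tendsto_integral_of_dominated_convergence (fun ω => ‖D ω‖) (fun m => ?_)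
      (hD.integrable one_le_two).norm (fun m => ae_of_all _ fun ω => ?_) ?_
    · have := (hW (η (ns m))).aemeasurable
      have h3 : AEStronglyMeasurable (fun ω => Complex.exp ((√(A ω) *
        wienerIntegral B P (fun x => η (ns m) x) ω : ℝ) * Complex.I)) P := by fun_prop
      exact (Complex.continuous_ofReal.comp_aestronglyMeasurable hDm).mul h3
    · rw [norm_mul, Complex.norm_exp_ofReal_mul_I, mul_one, Complex.norm_real]
    · filter_upwards [hae] with ω hω
      have : Continuous fun y : ℝ => (D ω : ℂ) * Complex.exp ((√(A ω) * y : ℝ) * Complex.I) := by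
        fun_prop
      exact (this.tendsto _).comp hω
  simp only [key] at t1
  exact (tendsto_nhds_unique t1 tendsto_const_nhds)

theorem IsWienerIntegral.sum (hB : IsTwoSidedBrownian B P) {ι : Type*} (s : Finset ι)
    {f : ι → ℝ → ℝ} {Y : ι → Ω → ℝ} (hf : ∀ i, MemLp (f i) 2 volume)
    (hY : ∀ i, IsWienerIntegral B P (f i) (Y i)) (r : ι → ℝ) :
    IsWienerIntegral B P (fun x => ∑ i ∈ s, r i * f i x) (fun ω => ∑ i ∈ s, r i * Y i ω) := by
  have := hB.gaussian.isProbabilityMeasure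
  classical
  induction s using Finset.induction_on with
  | empty =>
    refine ⟨by simp, fun _ => ⟨0, 0, 0, 0, fun _ => le_rfl⟩, ?_, ?_⟩
    · simp [StepFunction.eval]
    · simp [StepFunction.integral]
  | insert i s hi ih =>
    have h1 := (hY i).comb hB (hf i) (memLp_finsetSum s fun j _ => (hf j).const_mul (r j))
      ih (r i) 1
    simpa [Finset.sum_insert hi] using h1

theorem isWienerIntegral_increment (hB : IsTwoSidedBrownian B P) {a b : ℝ} (hab : a ≤ b) :
    IsWienerIntegral B P ((Ico a b).indicator fun _ => 1) (fun ω => B b ω - B a ω) := by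
  let φ : StepFunction := ⟨1, fun _ => 1, fun _ => a, fun _ => b, fun _ => hab⟩
  have h := isWienerIntegral_step hB φ
  have e1 : φ.eval = (Ico a b).indicator fun _ => 1 := by
    ext x; simp [StepFunction.eval, φ]
  have e2 : φ.integral B = fun ω => B b ω - B a ω := by
    ext x; simp [StepFunction.integral, φ]
  rwa [e1, e2] at h

theorem memLp_indicator_Ico (a b : ℝ) :
    MemLp ((Ico a b).indicator fun _ => (1 : ℝ)) 2 volume :=
  memLp_indicator_const 2 measurableSet_Ico 1 (Or.inr (by simp))

theorem IsTwoSidedBrownian.zero_ae (hB : IsTwoSidedBrownian B P) : B 0 =ᵐ[P] 0 := by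
  have h := hB.integral_mul 0 0
  simp only [abs_zero, sub_zero, add_zero, zero_div] at h
  rw [integral_eq_zero_iff_of_nonneg (fun ω => mul_self_nonneg _)
    ((hB.memLp 0).integrable_mul (hB.memLp 0))] at h
  filter_upwards [h] with ω hω
  simpa using hω

/-- The law of large numbers for the squared unit increments. -/
theorem IsTwoSidedBrownian.tendsto_average_sq (hB : IsTwoSidedBrownian B P) :
    ∀ᵐ ω ∂P, Tendsto (fun n : ℕ =>
      (∑ i ∈ Finset.range n, (B (i + 1) ω - B i ω) ^ 2) / n) atTop (𝓝 1) := by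
  have := hB.gaussian.isProbabilityMeasure
  have hm := hB.measurable
  have hW : ∀ i : ℕ, IsWienerIntegral B P ((Ico (i : ℝ) (i + 1)).indicator fun _ => 1)
      (fun ω => B (i + 1) ω - B i ω) := fun i => isWienerIntegral_increment hB (by simp)
  have hG : IsGaussianProcess (fun (i : ℕ) ω => B (i + 1) ω - B i ω) P := by
    refine hB.gaussian.of_isGaussianProcess fun i => ⟨{(i : ℝ) + 1, (i : ℝ)},
      ContinuousLinearMap.proj ⟨(i : ℝ) + 1, by simp⟩ - ContinuousLinearMap.proj ⟨(i : ℝ), by simp⟩,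
      fun ω => by simp⟩
  have h1 : ∫ ω, (B ((0 : ℕ) + 1) ω - B (0 : ℕ) ω) ^ 2 ∂P = 1 := by
    have := hB.integral_increment_mul 0 1 0 1
    simp only [← sq] at this
    simpa using this
  have hvar : ∀ i : ℕ, (eLpNorm ((Ico (i : ℝ) (i + 1)).indicator fun _ => (1 : ℝ)) 2
      volume).toReal ^ 2 = 1 := fun i => by
    rw [eLpNorm_two_toReal_sq (memLp_indicator_Ico _ _)]
    simp only [sq]
    rw [integral_indicator_mul_indicator _ _ _ _ (by simp) (by simp)]
    simp
  have hlaw : ∀ i : ℕ, P.map (fun ω => B (i + 1) ω - B i ω) = gaussianReal 0 1 := fun i => by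
    rw [(hW i).map_eq hB (memLp_indicator_Ico _ _), hvar]
    simp
  have h := strong_law_ae_real (μ := P) (fun (i : ℕ) ω => (B (i + 1) ω - B i ω) ^ 2)
    ((hB.memLp _).sub (hB.memLp _)).integrable_sq ?_ ?_
  · rw [h1] at h
    exact h
  · intro i j hij
    -- Jointly Gaussian and uncorrelated, because the intervals are disjoint.
    have hind : IndepFun (fun ω => B (i + 1) ω - B i ω) (fun ω => B (j + 1) ω - B j ω) P := by
      refine (hG.hasGaussianLaw_prodMk (s := i) (t := j)).indepFun_of_covariance_eq_zero ?_
      have h0 : ∀ i : ℕ, ∫ ω, B (i + 1) ω - B i ω ∂P = 0 := fun i => by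
        rw [integral_sub ((hB.memLp _).integrable one_le_two) ((hB.memLp _).integrable one_le_two),
          hB.centered, hB.centered, sub_zero]
      rw [ProbabilityTheory.covariance, h0, h0]
      simp only [sub_zero]
      rw [hB.integral_increment_mul]
      rcases lt_or_gt_of_ne hij with hlt | hlt
      · have : (i : ℝ) + 1 ≤ j := by exact_mod_cast hlt
        grind
      · have : (j : ℝ) + 1 ≤ i := by exact_mod_cast hlt
        grind
    exact hind.comp (φ := fun x => x ^ 2) (ψ := fun x => x ^ 2) (by fun_prop) (by fun_prop)
  · intro i
    have : IdentDistrib (fun ω => B (i + 1) ω - B i ω) (fun ω => B ((0 : ℕ) + 1) ω - B (0 : ℕ) ω)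
        P P := ⟨by fun_prop, by fun_prop, by rw [hlaw, hlaw]⟩
    exact this.comp (u := fun x => x ^ 2) (by fun_prop)

/-- The `σ`-algebra generated by a family of random variables. -/
abbrev sigmaFamily {Ω ι : Type*} (X : ι → Ω → ℝ) : MeasurableSpace Ω :=
  ⨆ i, MeasurableSpace.comap (X i) inferInstance

/-- The family `{exp(√A I(η)) : η Schwartz}` is total in `L²_A`. -/
theorem ae_eq_zero_of_integral_mul_exp_eq_zero (hB : IsTwoSidedBrownian B P) (hA : Measurable A)
    (hApos : ∀ᵐ ω ∂P, 0 < A ω) (hAB : IndepFun A (fun ω t => B t ω) P)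
    (hexp : ∀ c : ℝ, Integrable (fun ω => Real.exp (c * A ω)) P) {D : Ω → ℝ}
    (hD : MemL2A A B P D)
    (h : ∀ η : 𝓢(ℝ, ℝ), ∫ ω, D ω *
      Real.exp (√(A ω) * wienerIntegral B P (fun x => η x) ω) ∂P = 0) : D =ᵐ[P] 0 := by
  have := hB.gaussian.isProbabilityMeasure
  have hBm := hB.measurable
  -- Orthogonality controls `D` on the σ-algebra of the increments of √A B. The remaining task is to
  -- recover both A and B from these increments.
  let X : {p : ℝ × ℝ // p.1 ≤ p.2} → Ω → ℝ := fun p ω => √(A ω) * (B p.1.2 ω - B p.1.1 ω)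
  have hX : ∀ p, Measurable (X p) := fun p => by fun_prop
  have hDi := hD.1.integrable one_le_two
  have hzero : ∀ S, MeasurableSet[sigmaFamily X] S → ∫ ω in S, D ω ∂P = 0 := by
    intro S hS
    refine setIntegral_eq_zero_of_forall_cexp hDi hX (fun I r => ?_) hS
    have hW : ∀ i : I, IsWienerIntegral B P ((Ico i.1.1.1 i.1.1.2).indicator fun _ => 1)
        (fun ω => B i.1.1.2 ω - B i.1.1.1 ω) := fun i => isWienerIntegral_increment hB i.1.2
    have hsum := IsWienerIntegral.sum hB Finset.univ (fun i : I => memLp_indicator_Ico _ _) hW r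
    rw [← integral_mul_cexp_eq_zero hB hA hApos hAB hexp hD.1 h
      (memLp_finsetSum _ fun i _ => (memLp_indicator_Ico _ _).const_mul _) hsum]
    refine integral_congr_ae (ae_of_all _ fun ω => ?_)
    simp only [X, Finset.mul_sum]
    congr 6
    ext i
    ring
  have hXm : ∀ p, Measurable[sigmaFamily X] (X p) := fun p =>
    Measurable.mono (comap_measurable _) (le_iSup (fun p => MeasurableSpace.comap (X p) _) p) le_rfl
  -- The averages of the squared unit increments of √A B converge to A · 1 by the law of large
  -- numbers.
  let A' : Ω → ℝ := fun ω => limsup (fun n : ℕ =>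
    (∑ i ∈ Finset.range n, X ⟨((i : ℝ), (i : ℝ) + 1), by simp⟩ ω ^ 2) / n) atTop
  have hA'm : Measurable[sigmaFamily X] A' := by
    refine Measurable.limsup fun n => ?_
    refine Measurable.div_const ?_ _
    exact Finset.measurable_fun_sum _ fun i _ => (hXm _).pow_const 2
  have hAA' : A =ᵐ[P] A' := by
    filter_upwards [hB.tendsto_average_sq, hApos] with ω hω hpos
    have h1 := hω.const_mul (A ω)
    rw [mul_one] at h1
    refine Tendsto.limsup_eq (h1.congr fun n => ?_) |>.symm
    simp only [X, mul_pow, Real.sq_sqrt hpos.le, ← Finset.mul_sum]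
    ring
  -- With A recovered, divide the increment between 0 and `t` by √A and use that B_0 = 0 almost
  -- surely.
  have hBt : ∀ t, ∃ b : Ω → ℝ, Measurable[sigmaFamily X] b ∧ B t =ᵐ[P] b := by
    intro t
    rcases le_total 0 t with ht | ht
    · refine ⟨fun ω => X ⟨(0, t), ht⟩ ω / √(A' ω), (hXm _).div hA'm.sqrt, ?_⟩
      filter_upwards [hAA', hApos, hB.zero_ae] with ω h1 h2 h3
      have : √(A ω) ≠ 0 := (Real.sqrt_pos.2 h2).ne'
      simp only [X, ← h1, h3, Pi.zero_apply, sub_zero]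
      field_simp
    · refine ⟨fun ω => -(X ⟨(t, 0), ht⟩ ω / √(A' ω)), ((hXm _).div hA'm.sqrt).neg, ?_⟩
      filter_upwards [hAA', hApos, hB.zero_ae] with ω h1 h2 h3
      have : √(A ω) ≠ 0 := (Real.sqrt_pos.2 h2).ne'
      simp only [X, ← h1, h3, Pi.zero_apply]
      field_simp
      ring
  -- Up to null sets, every event of σ(B, A) is generated by the increments, so `D` integrates to 0
  -- over it.
  have hle : sigmaBA A B ≤ eventuallyMeasurableSpace (sigmaFamily X) (ae P) := by
    refine sup_le ?_ (iSup_le fun t => ?_)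
    · exact measurable_iff_comap_le.1 (hA'm.eventuallyMeasurable_of_eventuallyEq hAA')
    · obtain ⟨b, hb, hbt⟩ := hBt t
      exact measurable_iff_comap_le.1 (hb.eventuallyMeasurable_of_eventuallyEq hbt)
  have hm : sigmaBA A B ≤ ‹MeasurableSpace Ω› :=
    sup_le hA.comap_le (iSup_le fun t => (hBm t).comap_le)
  obtain ⟨D', hD', hDD'⟩ := hD.2
  have hD'i : Integrable D' P := hDi.congr hDD'
  refine hDD'.trans ?_
  refine ae_eq_zero_of_forall_setIntegral_eq_of_finStronglyMeasurable_trim hm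
    (fun S _ _ => hD'i.restrict) (fun S hS _ => ?_) (hD'.finStronglyMeasurable _)
  obtain ⟨S', hS', hSS'⟩ := hle S hS
  rw [setIntegral_congr_set hSS', ← integral_congr_ae (ae_restrict_of_ae hDD'), hzero S' hS']

end Uniqueness

/-! ### The S_A-transform of √A I(f) and the identification of the Itô integral. -/

section Identification

variable {Ω : Type*} [MeasurableSpace Ω] {P : Measure Ω} {B : ℝ → Ω → ℝ} {A : Ω → ℝ}

theorem eLpNorm_add_mul_sq {f g : ℝ → ℝ} (hf : MemLp f 2 volume) (hg : MemLp g 2 volume)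
    (b : ℝ) : (eLpNorm (fun x => 1 * g x + b * f x) 2 volume).toReal ^ 2 =
      (∫ x, g x ^ 2) + 2 * b * (∫ x, f x * g x) + b ^ 2 * ∫ x, f x ^ 2 := by
  have h := eLpNorm_two_toReal_sq ((hg.const_mul 1).add (hf.const_mul b))
  refine h.trans ?_
  have e : (fun x => ((fun x => 1 * g x) + fun x => b * f x) x ^ 2) = fun x =>
      g x ^ 2 + 2 * b * (f x * g x) + b ^ 2 * f x ^ 2 := by
    ext x; simp only [Pi.add_apply]; ring
  have i1 : Integrable (fun x => g x ^ 2) := hg.integrable_sq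
  have i2 : Integrable (fun x => 2 * b * (f x * g x)) := (hf.integrable_mul hg).const_mul _
  have i3 : Integrable (fun x => b ^ 2 * f x ^ 2) := hf.integrable_sq.const_mul _
  have i4 : Integrable (fun x => g x ^ 2 + 2 * b * (f x * g x)) := i1.add i2
  rw [e, integral_add i4 i3, integral_add i1 i2, integral_const_mul, integral_const_mul]

/-- Tilt P by exp(√A W). The generating function of √A Y is then b ↦ E[exp(A ‖g + b f‖² / 2)] up to
a constant. Its derivative at b = 0 is a first moment on one side and, by the chain rule, contains
the factor ⟨f, g⟩ on the other. -/
theorem IsWienerIntegral.integral_mul_self_exp (hB : IsTwoSidedBrownian B P) (hA : Measurable A)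
    (hApos : ∀ᵐ ω ∂P, 0 < A ω) (hAB : IndepFun A (fun ω t => B t ω) P)
    (hexp : ∀ c : ℝ, Integrable (fun ω => Real.exp (c * A ω)) P) {f g : ℝ → ℝ} {Y W : Ω → ℝ}
    (hf : MemLp f 2 volume) (hY : IsWienerIntegral B P f Y)
    (hg : MemLp g 2 volume) (hW : IsWienerIntegral B P g W) :
    ∫ ω, (√(A ω) * Y ω) * Real.exp (√(A ω) * W ω) ∂P =
      (∫ x, f x * g x) * ∫ ω, A ω * Real.exp (√(A ω) * W ω) ∂P := by
  have := hB.gaussian.isProbabilityMeasure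
  have hYm := hY.aemeasurable
  have hWm := hW.aemeasurable
  have hWi := hW.integrable_exp hB hA hApos hAB hexp hg
  set Q := P.tilted fun ω => √(A ω) * W ω with hQ
  set c := ∫ ω, Real.exp (√(A ω) * W ω) ∂P with hc
  have hc0 : 0 < c := integral_exp_pos hWi
  have hcomb : ∀ b : ℝ, IsWienerIntegral B P (fun x => 1 * g x + b * f x)
      (fun ω => 1 * W ω + b * Y ω) := fun b => hW.comb hB hg hf hY 1 b
  have hmem : ∀ b : ℝ, MemLp (fun x => 1 * g x + b * f x) 2 volume := fun b =>
    (hg.const_mul 1).add (hf.const_mul b)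
  have e : ∀ b ω, Real.exp (√(A ω) * W ω) * Real.exp (b * (√(A ω) * Y ω)) =
      Real.exp (√(A ω) * (1 * W ω + b * Y ω)) := fun b ω => by
    rw [← Real.exp_add]; ring_nf
  have hset : integrableExpSet (fun ω => √(A ω) * Y ω) Q = univ := by
    refine eq_univ_of_forall fun b => ?_
    rw [integrableExpSet, mem_ofPred_eq, hQ, integrable_tilted_iff hWi]
    simp only [smul_eq_mul, e]
    exact (hcomb b).integrable_exp hB hA hApos hAB hexp (hmem b)
  have hmgf : ∀ b, mgf (fun ω => √(A ω) * Y ω) Q b = c⁻¹ * mgf A P (((∫ x, g x ^ 2) +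
      2 * b * (∫ x, f x * g x) + b ^ 2 * ∫ x, f x ^ 2) / 2) := fun b => by
    rw [← eLpNorm_add_mul_sq hf hg, ← (hcomb b).integral_exp hB hA hApos hAB hexp (hmem b), mgf,
      integral_tilted, ← integral_const_mul]
    refine integral_congr_ae (ae_of_all _ fun ω => ?_)
    simp only [smul_eq_mul, ← e]
    ring
  have d1 := hasDerivAt_mgf (X := fun ω => √(A ω) * Y ω) (μ := Q) (t := 0) (by simp [hset])
  have hsetA : integrableExpSet A P = univ := eq_univ_of_forall hexp
  have d2 : HasDerivAt (fun b => c⁻¹ * mgf A P (((∫ x, g x ^ 2) +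
      2 * b * (∫ x, f x * g x) + b ^ 2 * ∫ x, f x ^ 2) / 2))
      (c⁻¹ * ((∫ ω, A ω * Real.exp ((∫ x, g x ^ 2) / 2 * A ω) ∂P) * ∫ x, f x * g x)) 0 := by
    have hq : HasDerivAt (fun b : ℝ => ((∫ x, g x ^ 2) +
        2 * b * (∫ x, f x * g x) + b ^ 2 * ∫ x, f x ^ 2) / 2) (∫ x, f x * g x) 0 := by
      have h1 := ((((hasDerivAt_id (0 : ℝ)).const_mul 2).mul_const
        (∫ x, f x * g x)).const_add (∫ x, g x ^ 2)).add
        (((hasDerivAt_id (0 : ℝ)).pow 2).mul_const (∫ x, f x ^ 2)) |>.div_const 2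
      refine h1.congr_deriv ?_
      simp
    have hm := hasDerivAt_mgf (X := A) (μ := P) (t := (∫ x, g x ^ 2) / 2) (by simp [hsetA])
    have h0 : ((∫ x, g x ^ 2) + 2 * (0 : ℝ) * (∫ x, f x * g x) + 0 ^ 2 * ∫ x, f x ^ 2) / 2 =
        (∫ x, g x ^ 2) / 2 := by ring
    rw [← h0] at hm
    have h2 := (hm.comp (0 : ℝ) hq).const_mul c⁻¹
    rw [h0] at h2
    exact h2
  rw [funext hmgf] at d1
  have d3 := d1.unique d2
  rw [integral_tilted] at d3
  have hAexp := integrable_pow_mul_exp_of_mem_interior_integrableExpSet (X := A) (μ := P)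
    (v := (eLpNorm g 2 volume).toReal ^ 2 / 2) (by simp [hsetA]) 1
  simp only [pow_one] at hAexp
  have hAW := (hW.integral_mul_exp hB hA hApos hAB hg (w := fun a => a) (by fun_prop) hAexp).2
  rw [hAW, eLpNorm_two_toReal_sq hg, mul_comm (∫ x, f x * g x)]
  refine mul_left_cancel₀ (inv_ne_zero hc0.ne') (Eq.trans ?_ d3)
  rw [← integral_const_mul]
  refine integral_congr_ae (ae_of_all _ fun ω => ?_)
  simp only [zero_mul, Real.exp_zero, mul_one, smul_eq_mul, ← hc]
  ring

theorem IsWienerIntegral.memL2A (hB : IsTwoSidedBrownian B P) (hA : Measurable A)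
    (hApos : ∀ᵐ ω ∂P, 0 < A ω) (hAB : IndepFun A (fun ω t => B t ω) P)
    (hexp : ∀ c : ℝ, Integrable (fun ω => Real.exp (c * A ω)) P) {f : ℝ → ℝ} {Y : Ω → ℝ}
    (hY : IsWienerIntegral B P f Y) : MemL2A A B P fun ω => √(A ω) * Y ω := by
  have hYm := hY.aemeasurable
  constructor
  · rw [memLp_two_iff_integrable_sq (by fun_prop)]
    have hset : integrableExpSet A P = univ := eq_univ_of_forall hexp
    have hAi : Integrable A P := by
      simpa using integrable_pow_of_mem_interior_integrableExpSet (X := A) (μ := P)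
        (by simp [hset]) 1
    have hind : IndepFun A (fun ω => Y ω ^ 2) P :=
      (hY.indepFun hB hAB).comp (φ := id) (ψ := fun x => x ^ 2) measurable_id (by fun_prop)
    refine (hind.integrable_mul hAi hY.1.integrable_sq).congr ?_
    filter_upwards [hApos] with ω hω
    simp [mul_pow, Real.sq_sqrt hω.le]
  · obtain ⟨G, hG, hYG⟩ := hY.exists_ae_eq_comp hB
    have h1 : Measurable[sigmaBA A B] A :=
      Measurable.mono (comap_measurable A) le_sup_left le_rfl
    have h2 : ∀ t, Measurable[sigmaBA A B] (B t) := fun t =>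
      Measurable.mono (comap_measurable (B t))
        ((le_iSup (fun t => MeasurableSpace.comap (B t) inferInstance) t).trans le_sup_right) le_rfl
    have h3 : Measurable[sigmaBA A B] fun ω t => B t ω := by
      rw [@measurable_pi_iff]
      exact h2
    have h4 : Measurable[sigmaBA A B] fun ω => √(A ω) * G fun t => B t ω :=
      h1.sqrt.mul (hG.comp h3)
    refine ⟨_, h4.stronglyMeasurable, ?_⟩
    filter_upwards [hYG] with ω hω
    rw [hω]

/-- If `f` represents the functional `η ↦ ∫_M ν M_+^H η` on Schwartz functions, then the fractional
Itô integral of the deterministic function `ν` over `M` is `√A I(f)`. -/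
theorem IsFracItoIntegral.ae_eq (hB : IsTwoSidedBrownian B P) (hA : Measurable A)
    (hApos : ∀ᵐ ω ∂P, 0 < A ω) (hAB : IndepFun A (fun ω t => B t ω) P)
    (hexp : ∀ c : ℝ, Integrable (fun ω => Real.exp (c * A ω)) P)
    (hR : laplaceRadius A P = ⊤) {H : ℝ} {M : Set ℝ} {ν f : ℝ → ℝ} {Θ Y : Ω → ℝ}
    (hΘ : IsFracItoIntegral A B P H M (fun s _ => ν s) Θ) (hf : MemLp f 2 volume)
    (hparts : ∀ η : 𝓢(ℝ, ℝ), ∫ x, f x * η x = ∫ s in M, ν s * opPlus H (fun x => η x) s)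
    (hY : IsWienerIntegral B P f Y) : Θ =ᵐ[P] fun ω => √(A ω) * Y ω := by
  have hYA := hY.memL2A hB hA hApos hAB hexp
  have hD : MemL2A A B P fun ω => Θ ω - √(A ω) * Y ω :=
    ⟨hΘ.2.1.1.sub hYA.1, hΘ.2.1.2.sub hYA.2⟩
  suffices h : (fun ω => Θ ω - √(A ω) * Y ω) =ᵐ[P] 0 by
    filter_upwards [h] with ω hω
    exact sub_eq_zero.1 hω
  refine ae_eq_zero_of_integral_mul_exp_eq_zero hB hA hApos hAB hexp hD fun η => ?_
  have hη : MemLp (fun x => η x) 2 volume := η.memLp 2 volume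
  have hW := isWienerIntegral_wienerIntegral hB hη
  set W := wienerIntegral B P fun x => η x with hWdef
  have hWe := hW.memLp_exp hB hA hApos hAB hexp hη
  have hc0 : 0 < ∫ ω, Real.exp (√(A ω) * W ω) ∂P := by
    have := hB.gaussian.isProbabilityMeasure
    exact integral_exp_pos (hW.integrable_exp hB hA hApos hAB hexp hη)
  -- An infinite radius admits every Schwartz function as a test function.
  have hmem : η ∈ admissible A P := by
    rw [admissible, mem_ofPred_eq, hR]
    exact ENNReal.mul_lt_top ENNReal.ofNat_lt_top (ENNReal.pow_lt_top hη.2)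
  have hS : ∀ X : Ω → ℝ, sTransform A B P X η =
      (∫ ω, X ω * Real.exp (√(A ω) * W ω) ∂P) / ∫ ω, Real.exp (√(A ω) * W ω) ∂P := fun X => by
    rw [← integral_div]
    refine integral_congr_ae (ae_of_all _ fun ω => ?_)
    simp only [wickExp, ← hWdef, mul_div_assoc]
  have h1 := (hΘ.2.2 η hmem).2
  simp only [hS] at h1
  -- The integrand ν is deterministic, so the transform of A ν(s) is ν(s) times a factor that does
  -- not depend on `s`.
  have h2 : ∀ s, (∫ ω, A ω * ν s * Real.exp (√(A ω) * W ω) ∂P) /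
      (∫ ω, Real.exp (√(A ω) * W ω) ∂P) * opPlus H (fun x => η x) s =
      (∫ ω, A ω * Real.exp (√(A ω) * W ω) ∂P) / (∫ ω, Real.exp (√(A ω) * W ω) ∂P) *
        (ν s * opPlus H (fun x => η x) s) := fun s => by
    have : (fun ω => A ω * ν s * Real.exp (√(A ω) * W ω)) =
        fun ω => ν s * (A ω * Real.exp (√(A ω) * W ω)) := by ext; ring
    rw [this, integral_const_mul]
    ring
  simp only [h2] at h1
  rw [integral_const_mul, ← hparts, div_mul_eq_mul_div, div_left_inj' hc0.ne', mul_comm,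
    ← hY.integral_mul_self_exp hB hA hApos hAB hexp hf hη hW] at h1
  have i1 : Integrable (fun ω => Θ ω * Real.exp (√(A ω) * W ω)) P :=
    hΘ.2.1.1.integrable_mul hWe
  have i2 : Integrable (fun ω => (√(A ω) * Y ω) * Real.exp (√(A ω) * W ω)) P :=
    hYA.1.integrable_mul hWe
  simp only [sub_mul]
  rw [integral_sub i1 i2, sub_eq_zero]
  exact h1

end Identification

/-! ### Bounds for Schwartz functions -/

theorem exists_bound_schwartz (η : 𝓢(ℝ, ℝ)) : ∃ M : ℝ, 0 < M ∧ ∀ x, |η x| ≤ M := by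
  refine ⟨‖η.toBoundedContinuousFunction‖ + 1, by positivity, fun x => ?_⟩
  have := η.toBoundedContinuousFunction.norm_coe_le_norm x
  rw [Real.norm_eq_abs] at this
  exact this.trans (by linarith)

theorem exists_lipschitz_schwartz (η : 𝓢(ℝ, ℝ)) :
    ∃ L : ℝ, 0 < L ∧ ∀ x y, |η x - η y| ≤ L * |x - y| := by
  obtain ⟨L, hL, h⟩ := exists_bound_schwartz (SchwartzMap.derivCLM ℝ ℝ η)
  refine ⟨L, hL, fun x y => ?_⟩
  have := Convex.norm_image_sub_le_of_norm_deriv_le (f := η) (C := L) (s := univ) (x := y) (y := x)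
    (fun z _ => η.differentiableAt) (fun z _ => h z) convex_univ (mem_univ _) (mem_univ _)
  simpa using this

/-! ### The fractional derivative of the indicator of an interval -/

section Derivative

variable {p t : ℝ}

/-- The indicator function of `[0, t)`. -/
noncomputable abbrev ind (t : ℝ) : ℝ → ℝ := (Ico 0 t).indicator fun _ => 1

theorem measurable_ind (t : ℝ) : Measurable (ind t) :=
  measurable_const.indicator measurableSet_Ico

theorem ind_of_mem {t x : ℝ} (h : x ∈ Ico 0 t) : ind t x = 1 := indicator_of_mem h _

theorem ind_of_notMem {t x : ℝ} (h : x ∉ Ico 0 t) : ind t x = 0 := indicator_of_notMem h _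

theorem ind_nonneg (t x : ℝ) : 0 ≤ ind t x := indicator_nonneg (fun _ _ => zero_le_one) x

theorem ind_le_one (t x : ℝ) : ind t x ≤ 1 := indicator_le_self' (fun _ _ => zero_le_one) x

theorem abs_ind_sub_ind_le (t x y : ℝ) : |ind t x - ind t y| ≤ 1 := by
  have := ind_nonneg t x
  have := ind_nonneg t y
  have := ind_le_one t x
  have := ind_le_one t y
  rw [abs_le]
  constructor <;> linarith

theorem integrable_ind (t : ℝ) : Integrable (ind t) :=
  (integrable_indicator_iff measurableSet_Ico).2 (by simp)

/-- `∫_0^∞ (1_{[0,t)}(x) - 1_{[0,t)}(x+y)) y^p dy`. -/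
noncomputable def marchaud (p t x : ℝ) : ℝ :=
  ∫ y in Ioi 0, (ind t x - ind t (x + y)) * y ^ p

/-- A majorant for Marchaud integrands: the factor `y` comes from a Lipschitz bound near 0, the
factor 1 from boundedness at infinity. -/
theorem integrableOn_min_mul_rpow (hp : -2 < p) (hp' : p < -1) :
    IntegrableOn (fun y : ℝ => min y 1 * y ^ p) (Ioi 0) := by
  rw [← Ioc_union_Ioi_eq_Ioi (zero_le_one' ℝ)]
  refine IntegrableOn.union ?_ ?_
  · have h := (intervalIntegral.intervalIntegrable_rpow' (a := 0) (b := 1)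
      (show -1 < p + 1 by linarith))
    rw [intervalIntegrable_iff_integrableOn_Ioc_of_le zero_le_one] at h
    refine h.congr_fun (fun y hy => ?_) measurableSet_Ioc
    simp only [min_eq_left hy.2, Real.rpow_add_one hy.1.ne']
    ring
  · refine (integrableOn_Ioi_rpow_of_lt hp' zero_lt_one).congr_fun (fun y hy => ?_)
      measurableSet_Ioi
    simp [min_eq_right (le_of_lt (mem_Ioi.1 hy))]

/-- The interval is closed on the left and open on the right, so its indicator is constant just to
the right of every `x`. The numerator therefore vanishes near the singularity `y = 0`. -/
theorem integrableOn_jump (hp : p < -1) (t x : ℝ) :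
    IntegrableOn (fun y => (ind t x - ind t (x + y)) * y ^ p) (Ioi 0) := by
  obtain ⟨d, hd, hz⟩ : ∃ d > 0, ∀ y ∈ Ioo 0 d, ind t x = ind t (x + y) := by
    rcases lt_or_ge x 0 with hx | hx
    · refine ⟨-x, by linarith, fun y hy => ?_⟩
      rw [ind_of_notMem (x := x), ind_of_notMem (x := x + y)]
      · exact fun h => by linarith [h.1, hy.2]
      · exact fun h => by linarith [h.1]
    rcases lt_or_ge x t with hxt | hxt
    · refine ⟨t - x, by linarith, fun y hy => ?_⟩
      rw [ind_of_mem ⟨hx, hxt⟩, ind_of_mem]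
      exact ⟨by linarith [hy.1], by linarith [hy.2]⟩
    · refine ⟨1, one_pos, fun y hy => ?_⟩
      rw [ind_of_notMem (x := x), ind_of_notMem (x := x + y)]
      · exact fun h => by linarith [h.2, hy.1]
      · exact fun h => by linarith [h.2]
  have hb : Integrable ((Ioi (d / 2)).indicator fun y => y ^ p) :=
    (integrable_indicator_iff measurableSet_Ioi).2 (integrableOn_Ioi_rpow_of_lt hp (by linarith))
  have hm := measurable_ind t
  refine hb.integrableOn.mono' (by fun_prop) ?_
  filter_upwards [ae_restrict_mem measurableSet_Ioi] with y hy
  have hyp : 0 ≤ y ^ p := Real.rpow_nonneg (le_of_lt hy) p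
  rcases lt_or_ge y d with hyd | hyd
  · rw [hz y ⟨hy, hyd⟩, sub_self, zero_mul, norm_zero]
    exact indicator_nonneg (fun z hz => Real.rpow_nonneg (by linarith [mem_Ioi.1 hz]) _) _
  · rw [indicator_of_mem (show y ∈ Ioi (d / 2) by rw [mem_Ioi]; linarith), norm_mul,
      Real.norm_of_nonneg hyp]
    exact mul_le_of_le_one_left hyp (abs_ind_sub_ind_le t _ _)

theorem measurable_marchaud (p t : ℝ) : StronglyMeasurable (marchaud p t) := by
  have hm := measurable_ind t
  have : Measurable fun q : ℝ × ℝ => (ind t q.1 - ind t (q.1 + q.2)) * q.2 ^ p := by fun_prop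
  exact this.stronglyMeasurable.integral_prod_right

/-- Substitute `y = t z`. This self-similarity produces the power t^(2H) of the energy when H < 1/2.
-/
theorem marchaud_mul (ht : 0 < t) (u : ℝ) :
    marchaud p t (t * u) = t ^ (p + 1) * marchaud p 1 u := by
  have hind : ∀ v, ind t (t * v) = ind 1 v := fun v => by
    simp only [indicator, mem_Ico]
    congr 1
    rw [eq_iff_iff]
    constructor
    · rintro ⟨h1, h2⟩
      exact ⟨nonneg_of_mul_nonneg_right h1 ht, by nlinarith⟩
    · rintro ⟨h1, h2⟩
      exact ⟨by positivity, by nlinarith⟩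
  have h := integral_comp_mul_left_Ioi'
    (fun y => (ind t (t * u) - ind t (t * u + y)) * y ^ p) 0 ht
  rw [mul_zero] at h
  rw [marchaud, ← h, marchaud, Real.rpow_add_one ht.ne', mul_comm (t ^ p), mul_assoc, ← integral_const_mul, smul_eq_mul]
  congr 1
  refine setIntegral_congr_fun measurableSet_Ioi fun z hz => ?_
  simp only [← mul_add, hind, Real.mul_rpow ht.le (le_of_lt (mem_Ioi.1 hz))]
  ring

theorem marchaud_zero (x : ℝ) : marchaud p 0 x = 0 := by
  simp [marchaud]

/-- To the right of the interval nothing contributes. For `u` in (0,1), respectively (-1,0), the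
next jump lies at distance `1 - u`, respectively `-u`, and the tail of y^p beyond it is the bound.
For `u ≤ -1` only a window of length one contributes. The null point 0 lies in none of the three
sets. -/
theorem norm_marchaud_one_le (hp : p < -1) (u : ℝ) (hu : u ≠ 0) :
    ‖marchaud p 1 u‖ ≤ (Ioo 0 1).indicator (fun u => (1 - u) ^ (p + 1) / (-(p + 1))) u +
      (Ioo (-1) 0).indicator (fun u => (-u) ^ (p + 1) / (-(p + 1))) u +
      (Iic (-1)).indicator (fun u => (-u) ^ p) u := by
  have hq : 0 < -(p + 1) := by linarith
  have hint := fun c (hc : 0 < c) => integrableOn_Ioi_rpow_of_lt hp hc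
  have n1 : 0 ≤ (Ioo 0 1).indicator (fun u => (1 - u) ^ (p + 1) / (-(p + 1))) u :=
    indicator_nonneg (fun v hv => div_nonneg (Real.rpow_nonneg (by linarith [hv.2]) _) hq.le) _
  have n2 : 0 ≤ (Ioo (-1) 0).indicator (fun u => (-u) ^ (p + 1) / (-(p + 1))) u :=
    indicator_nonneg (fun v hv => div_nonneg (Real.rpow_nonneg (by linarith [hv.2]) _) hq.le) _
  have n3 : 0 ≤ (Iic (-1)).indicator (fun u => (-u) ^ p) u :=
    indicator_nonneg (fun v hv => Real.rpow_nonneg (by linarith [mem_Iic.1 hv]) _) _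
  rcases le_or_gt 1 u with h1 | h1
  · have : marchaud p 1 u = 0 := by
      rw [marchaud]
      refine setIntegral_eq_zero_of_forall_eq_zero fun y hy => ?_
      have hy : 0 < y := hy
      rw [ind_of_notMem (x := u), ind_of_notMem (x := u + y), sub_self, zero_mul]
      · exact fun h => by linarith [h.2]
      · exact fun h => by linarith [h.2]
    rw [this, norm_zero]
    positivity
  have key : ∀ c, 0 < c → (∀ y ∈ Ioo 0 c, ind 1 u = ind 1 (u + y)) →
      ‖marchaud p 1 u‖ ≤ c ^ (p + 1) / (-(p + 1)) := by
    intro c hc hz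
    have e : c ^ (p + 1) / (-(p + 1)) = ∫ y in Ioi 0, (Ici c).indicator (fun y => y ^ p) y := by
      rw [setIntegral_indicator measurableSet_Ici,
        show Ioi 0 ∩ Ici c = Ici c from inter_eq_right.2 fun y hy => hc.trans_le hy,
        integral_Ici_eq_integral_Ioi, integral_Ioi_rpow_of_lt hp hc, div_neg, neg_div]
    rw [e, marchaud]
    refine norm_integral_le_of_norm_le ?_ ?_
    · refine IntegrableOn.integrable (Integrable.integrableOn ?_)
      exact (integrable_indicator_iff measurableSet_Ici).2
        ((integrableOn_Ici_iff_integrableOn_Ioi).2 (hint c hc))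
    · filter_upwards [ae_restrict_mem measurableSet_Ioi] with y hy
      have hyp : 0 ≤ y ^ p := Real.rpow_nonneg (le_of_lt hy) p
      rcases lt_or_ge y c with hyd | hyd
      · rw [hz y ⟨hy, hyd⟩, sub_self, zero_mul, norm_zero]
        exact indicator_nonneg (fun z hz => Real.rpow_nonneg (hc.le.trans hz) _) _
      · rw [indicator_of_mem (mem_Ici.2 hyd), norm_mul, Real.norm_of_nonneg hyp]
        exact mul_le_of_le_one_left hyp (abs_ind_sub_ind_le _ _ _)
  rcases lt_or_gt_of_ne hu with h0 | h0
  · rcases le_or_gt u (-1) with hu1 | hu1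
    · rw [indicator_of_mem (mem_Iic.2 hu1)]
      refine le_trans ?_ (le_add_of_nonneg_left (add_nonneg n1 n2))
      have e : marchaud p 1 u = ∫ y in Ico (-u) (1 - u), -y ^ p := by
        rw [marchaud, ← integral_indicator measurableSet_Ioi,
          ← integral_indicator measurableSet_Ico]
        congr 1
        ext y
        by_cases hy : y ∈ Ico (-u) (1 - u)
        · rw [indicator_of_mem hy, indicator_of_mem (mem_Ioi.2 (by linarith [hy.1])),
            ind_of_notMem (x := u) (fun h => by linarith [h.1]),
            ind_of_mem ⟨by linarith [hy.1], by linarith [hy.2]⟩]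
          ring
        · rw [indicator_of_notMem hy]
          refine indicator_apply_eq_zero.2 fun _ => ?_
          rw [ind_of_notMem (x := u) (fun h => by linarith [h.1]), ind_of_notMem, sub_self,
            zero_mul]
          exact fun h => hy ⟨by linarith [h.1], by linarith [h.2]⟩
      rw [e]
      have := norm_setIntegral_le_of_norm_le_const (μ := volume) (s := Ico (-u) (1 - u))
        (f := fun y => -y ^ p) (C := (-u) ^ p) (by simp) fun y hy => by
          rw [norm_neg, Real.norm_of_nonneg (Real.rpow_nonneg (by linarith [hy.1]) _)]
          exact Real.rpow_le_rpow_of_nonpos (by linarith) hy.1 (by linarith)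
      simpa using this
    · rw [indicator_of_mem (show u ∈ Ioo (-1) 0 from ⟨hu1, h0⟩)]
      refine le_trans (key (-u) (by linarith) fun y hy => ?_) (by linarith)
      rw [ind_of_notMem (x := u), ind_of_notMem (x := u + y)]
      · exact fun h => by linarith [h.1, hy.2]
      · exact fun h => by linarith [h.1]
  · rw [indicator_of_mem (show u ∈ Ioo 0 1 from ⟨h0, h1⟩)]
    refine le_trans (key (1 - u) (by linarith) fun y hy => ?_) (by linarith)
    rw [ind_of_mem ⟨h0.le, h1⟩, ind_of_mem]
    exact ⟨by linarith [hy.1], by linarith [hy.2]⟩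

/-- The squared singularities at the jumps have exponent `2(p+1) > -1`, and the squared tail at -∞
has exponent `2p < -1`. -/
theorem memLp_marchaud_one (hp : -(3 / 2) < p) (hp' : p < -1) : MemLp (marchaud p 1) 2 := by
  have hne : ∀ᵐ u : ℝ, u ≠ 0 := by simp [ae_iff]
  have i0 : IntegrableOn (fun y : ℝ => y ^ (2 * (p + 1))) (Ioc 0 1) := by
    have h := (intervalIntegral.intervalIntegrable_rpow' (a := 0) (b := 1)
      (show -1 < 2 * (p + 1) by linarith))
    rwa [intervalIntegrable_iff_integrableOn_Ioc_of_le zero_le_one] at h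
  have i0' : Integrable ((Ioo 0 1).indicator fun y : ℝ => y ^ (2 * (p + 1))) :=
    (integrable_indicator_iff measurableSet_Ioo).2 (i0.mono_set Ioo_subset_Ioc_self)
  have sqi : ∀ {s : Set ℝ} {g : ℝ → ℝ} {h : ℝ → ℝ}, Integrable h → Measurable g →
      MeasurableSet s → (∀ u, h u = s.indicator (fun u => g u ^ 2) u) →
      MemLp (s.indicator g) 2 volume := by
    intro s g h hh hg hs he
    rw [memLp_two_iff_integrable_sq (hg.indicator hs).aestronglyMeasurable]
    refine hh.congr (ae_of_all _ fun u => ?_)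
    rw [he]
    by_cases hu : u ∈ s <;> simp [hu]
  have hsq : ∀ (y q : ℝ), 0 ≤ y → (y ^ q) ^ 2 = y ^ (2 * q) := fun y q hy => by
    rw [← Real.rpow_natCast, ← Real.rpow_mul hy]
    norm_num
    ring_nf
  have m1 : MemLp ((Ioo 0 1).indicator fun u => (1 - u) ^ (p + 1) / (-(p + 1))) 2 := by
    refine sqi ((i0'.comp_sub_left 1).div_const ((-(p + 1)) ^ 2)) (by fun_prop)
      measurableSet_Ioo fun u => ?_
    by_cases hu : u ∈ Ioo (0 : ℝ) 1
    · have hu' : 1 - u ∈ Ioo (0 : ℝ) 1 := ⟨by linarith [hu.2], by linarith [hu.1]⟩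
      rw [indicator_of_mem hu, indicator_of_mem hu', div_pow, hsq _ _ hu'.1.le]
    · have hu' : 1 - u ∉ Ioo (0 : ℝ) 1 := fun h => hu ⟨by linarith [h.2], by linarith [h.1]⟩
      rw [indicator_of_notMem hu, indicator_of_notMem hu', zero_div]
  have m2 : MemLp ((Ioo (-1) 0).indicator fun u => (-u) ^ (p + 1) / (-(p + 1))) 2 := by
    refine sqi (i0'.comp_neg.div_const ((-(p + 1)) ^ 2)) (by fun_prop) measurableSet_Ioo fun u => ?_
    by_cases hu : u ∈ Ioo (-1 : ℝ) 0
    · have hu' : -u ∈ Ioo (0 : ℝ) 1 := ⟨by linarith [hu.2], by linarith [hu.1]⟩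
      rw [indicator_of_mem hu, indicator_of_mem hu', div_pow, hsq _ _ hu'.1.le]
    · have hu' : -u ∉ Ioo (0 : ℝ) 1 := fun h => hu ⟨by linarith [h.2], by linarith [h.1]⟩
      rw [indicator_of_notMem hu, indicator_of_notMem hu', zero_div]
  have m3 : MemLp ((Iic (-1)).indicator fun u : ℝ => (-u) ^ p) 2 := by
    have i1 : Integrable ((Ici 1).indicator fun y : ℝ => y ^ (2 * p)) :=
      (integrable_indicator_iff measurableSet_Ici).2 ((integrableOn_Ici_iff_integrableOn_Ioi).2
        (integrableOn_Ioi_rpow_of_lt (by linarith) one_pos))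
    refine sqi i1.comp_neg (by fun_prop) measurableSet_Iic fun u => ?_
    by_cases hu : u ∈ Iic (-1 : ℝ)
    · have hu1 : u ≤ -1 := hu
      rw [indicator_of_mem hu, indicator_of_mem (mem_Ici.2 (by linarith)), hsq _ _ (by linarith)]
    · have hu' : -u ∉ Ici (1 : ℝ) := fun h => hu (mem_Iic.2 (by linarith [mem_Ici.1 h]))
      rw [indicator_of_notMem hu, indicator_of_notMem hu']
  refine ((m1.add m2).add m3).mono' (measurable_marchaud p 1).aestronglyMeasurable ?_
  filter_upwards [hne] with u hu
  exact norm_marchaud_one_le hp' u hu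

theorem integrable_sq_marchaud (hp : -(3 / 2) < p) (hp' : p < -1) (ht : 0 ≤ t) :
    Integrable (fun x => marchaud p t x ^ 2) ∧
      ∫ x, marchaud p t x ^ 2 = t ^ (2 * p + 3) * ∫ x, marchaud p 1 x ^ 2 := by
  rcases ht.eq_or_lt with rfl | ht
  · simp only [marchaud_zero]
    rw [Real.zero_rpow (by linarith)]
    simp
  have h1 := (memLp_marchaud_one hp hp').integrable_sq
  have e : ∀ u, marchaud p t (t * u) ^ 2 = (t ^ (p + 1)) ^ 2 * marchaud p 1 u ^ 2 := fun u => by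
    rw [marchaud_mul ht, mul_pow]
  constructor
  · rw [← integrable_comp_mul_left_iff _ ht.ne']
    simp only [e]
    exact h1.const_mul _
  · have h2 := Measure.integral_comp_mul_left (fun x => marchaud p t x ^ 2) t
    simp only [e] at h2
    rw [integral_const_mul, abs_of_pos (inv_pos.2 ht), smul_eq_mul, eq_inv_mul_iff_mul_eq₀ ht.ne']
      at h2
    rw [← h2, ← mul_assoc, ← Real.rpow_natCast, ← Real.rpow_mul ht.le]
    congr 1
    rw [show 2 * p + 3 = (p + 1) * (2 : ℕ) + 1 by push_cast; ring, Real.rpow_add_one ht.ne',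
      mul_comm]

/-- Fractional integration by parts for the indicator of an interval. -/
theorem integral_marchaud_mul (hp : -2 < p) (hp' : p < -1) (ht : 0 ≤ t) (η : 𝓢(ℝ, ℝ)) :
    (∀ s, IntegrableOn (fun y => (η s - η (s - y)) * y ^ p) (Ioi 0)) ∧
    ∫ x, marchaud p t x * η x =
      ∫ s in Ico 0 t, ∫ y in Ioi 0, (η s - η (s - y)) * y ^ p := by
  obtain ⟨M, hM, hηM⟩ := exists_bound_schwartz η
  obtain ⟨L, hL, hηL⟩ := exists_lipschitz_schwartz η
  have hηc := η.continuous
  have hβ := integrableOn_min_mul_rpow hp hp'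
  have hm := measurable_ind t
  have hdiff : ∀ s y, 0 < y → ‖(η s - η (s - y)) * y ^ p‖ ≤
      (L + 2 * M) * (min y 1 * y ^ p) := by
    intro s y hy
    rw [norm_mul, Real.norm_of_nonneg (Real.rpow_nonneg hy.le p), ← mul_assoc]
    refine mul_le_mul_of_nonneg_right ?_ (Real.rpow_nonneg hy.le p)
    have h1 := hηL s (s - y)
    have h2 := hηM s
    have h3 := hηM (s - y)
    rw [sub_sub_cancel, abs_of_pos hy] at h1
    rw [Real.norm_eq_abs]
    rcases le_total y 1 with h | h
    · rw [min_eq_left h]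
      nlinarith
    · rw [min_eq_right h]
      have := abs_sub (η s) (η (s - y))
      linarith
  refine ⟨fun s => (hβ.const_mul (L + 2 * M)).mono' (by fun_prop) ?_, ?_⟩
  · filter_upwards [ae_restrict_mem measurableSet_Ioi] with y hy
    exact hdiff s y hy
  have hi : ∀ y, Integrable (fun x => ind t (x + y)) := fun y =>
    (integrable_ind t).comp_add_right y
  have hswap1 : Integrable (Function.uncurry fun x y =>
      (ind t x - ind t (x + y)) * y ^ p * η x) (volume.prod (volume.restrict (Ioi 0))) := by
    have hmeas : Measurable (Function.uncurry fun x y =>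
        (ind t x - ind t (x + y)) * y ^ p * η x) := by
      unfold Function.uncurry
      fun_prop
    rw [integrable_prod_iff' hmeas.aestronglyMeasurable]
    have hb : ∀ y x, 0 < y → ‖(ind t x - ind t (x + y)) * y ^ p * η x‖ ≤
        M * y ^ p * |ind t x - ind t (x + y)| := by
      intro y x hy
      have h0 := mul_nonneg (abs_nonneg (ind t x - ind t (x + y))) (Real.rpow_nonneg hy.le p)
      rw [norm_mul, norm_mul, Real.norm_of_nonneg (Real.rpow_nonneg hy.le p), Real.norm_eq_abs,
        Real.norm_eq_abs]
      exact (mul_le_mul_of_nonneg_left (hηM x) h0).trans_eq (by ring)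
    -- For small `y` the two indicators differ only on two windows of length `y`; for large `y` the
    -- sum of their masses, `2t`, suffices.
    have hI : ∀ y, 0 < y → ∫ x, |ind t x - ind t (x + y)| ≤ 2 * (t + 1) * min y 1 := by
      intro y hy
      have e0 : ∫ x, ind t x = t := by
        rw [integral_indicator measurableSet_Ico]
        simp [ht]
      have h1 : ∫ x, |ind t x - ind t (x + y)| ≤ 2 * t := by
        have : ∫ x, (ind t x + ind t (x + y)) = 2 * t := by
          rw [integral_add (integrable_ind t) (hi y), integral_add_right_eq_self (ind t) y, e0]
          ring
        rw [← this]
        refine integral_mono (((integrable_ind t).sub (hi y)).abs)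
          ((integrable_ind t).add (hi y)) fun x => ?_
        have := ind_nonneg t x
        have := ind_nonneg t (x + y)
        rw [abs_le]
        constructor <;> linarith
      have h2 : ∫ x, |ind t x - ind t (x + y)| ≤ 2 * y := by
        have j1 : ∀ a : ℝ, Integrable ((Ico (a - y) a).indicator fun _ => (1 : ℝ)) := fun a =>
          (integrable_indicator_iff measurableSet_Ico).2 (by simp)
        have j2 : ∀ a : ℝ, ∫ x, (Ico (a - y) a).indicator (fun _ => (1 : ℝ)) x = y := fun a => by
          rw [integral_indicator measurableSet_Ico]
          simp [hy.le]
        have : ∫ x, ((Ico (0 - y) 0).indicator (fun _ => (1 : ℝ)) x +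
            (Ico (t - y) t).indicator (fun _ => (1 : ℝ)) x) = 2 * y := by
          rw [integral_add (j1 0) (j1 t), j2, j2]
          ring
        rw [← this]
        refine integral_mono (((integrable_ind t).sub (hi y)).abs) ((j1 0).add (j1 t)) fun x => ?_
        simp only [indicator, mem_Ico]
        split_ifs <;> grind
      rcases le_total y 1 with h | h
      · rw [min_eq_left h]
        nlinarith [mul_nonneg ht hy.le]
      · rw [min_eq_right h]
        linarith
    have hmx : ∀ y, AEStronglyMeasurable (fun x => (ind t x - ind t (x + y)) * y ^ p * η x)
        volume := fun y => by fun_prop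
    have hxi : ∀ y, 0 < y → Integrable (fun x => (ind t x - ind t (x + y)) * y ^ p * η x) :=
      fun y hy => (((integrable_ind t).sub (hi y)).abs.const_mul (M * y ^ p)).mono' (hmx y)
        (ae_of_all _ fun x => hb y x hy)
    constructor
    · filter_upwards [ae_restrict_mem measurableSet_Ioi] with y hy
      exact hxi y hy
    · refine (hβ.const_mul (M * (2 * (t + 1)))).mono'
        (hmeas.norm.stronglyMeasurable.integral_prod_left').aestronglyMeasurable ?_
      filter_upwards [ae_restrict_mem measurableSet_Ioi] with y hy
      have hy : 0 < y := hy
      rw [Real.norm_of_nonneg (integral_nonneg fun x => norm_nonneg _)]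
      refine (integral_mono (hxi y hy).norm
        (((integrable_ind t).sub (hi y)).abs.const_mul (M * y ^ p)) (hb y · hy)).trans ?_
      rw [integral_const_mul]
      have h1 := mul_le_mul_of_nonneg_left (hI y hy)
        (mul_nonneg hM.le (Real.rpow_nonneg hy.le p))
      refine h1.trans (le_of_eq ?_)
      ring
  have hswap2 : Integrable (Function.uncurry fun y s =>
      ind t s * ((η s - η (s - y)) * y ^ p)) ((volume.restrict (Ioi 0)).prod volume) := by
    refine ((hβ.const_mul (L + 2 * M)).mul_prod (integrable_ind t)).mono' ?_ ?_
    · have : Measurable (Function.uncurry fun y s => ind t s * ((η s - η (s - y)) * y ^ p)) := by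
        unfold Function.uncurry
        fun_prop
      exact this.aestronglyMeasurable
    · have h : ∀ᵐ q ∂(volume.restrict (Ioi (0 : ℝ))).prod (volume : Measure ℝ), q.1 ∈ Ioi 0 :=
        Measure.quasiMeasurePreserving_fst.ae (ae_restrict_mem measurableSet_Ioi)
      filter_upwards [h] with q hq
      simp only [Function.uncurry]
      rw [norm_mul, Real.norm_of_nonneg (ind_nonneg t _), mul_comm]
      exact mul_le_mul_of_nonneg_right (hdiff q.2 q.1 hq) (ind_nonneg t _)
  calc ∫ x, marchaud p t x * η x
      = ∫ x, ∫ y in Ioi 0, (ind t x - ind t (x + y)) * y ^ p * η x := by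
        simp only [marchaud, integral_mul_const]
    _ = ∫ y in Ioi 0, ∫ x, (ind t x - ind t (x + y)) * y ^ p * η x :=
        integral_integral_swap hswap1
    _ = ∫ y in Ioi 0, ∫ s, ind t s * ((η s - η (s - y)) * y ^ p) := by
        -- For fixed `y` the shift `x = s - y` moves the difference from the indicator to `η`.
        refine setIntegral_congr_fun measurableSet_Ioi fun y hy => ?_
        have i1 : Integrable (fun x => ind t x * η x) :=
          η.integrable.bdd_mul (c := 1) hm.aestronglyMeasurable (ae_of_all _ fun x => by
            rw [Real.norm_of_nonneg (ind_nonneg t x)]; exact ind_le_one t x)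
        have i2 : Integrable (fun x => ind t (x + y) * η x) :=
          η.integrable.bdd_mul (c := 1) (hi y).1 (ae_of_all _ fun x => by
            rw [Real.norm_of_nonneg (ind_nonneg t _)]; exact ind_le_one t _)
        have i3 : Integrable (fun s => ind t s * η (s - y)) := by
          simpa using i2.comp_sub_right y
        have e1 : ∀ x, (ind t x - ind t (x + y)) * y ^ p * η x =
            y ^ p * (ind t x * η x - ind t (x + y) * η x) := fun x => by ring
        have e2 : ∀ s, ind t s * ((η s - η (s - y)) * y ^ p) =
            y ^ p * (ind t s * η s - ind t s * η (s - y)) := fun s => by ring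
        simp only [e1, e2]
        rw [integral_const_mul, integral_const_mul, integral_sub i1 i2, integral_sub i1 i3]
        congr 2
        have := integral_sub_right_eq_self (μ := volume) (fun x => ind t (x + y) * η x) y
        simpa using this.symm
    _ = ∫ s, ∫ y in Ioi 0, ind t s * ((η s - η (s - y)) * y ^ p) :=
        integral_integral_swap hswap2
    _ = ∫ s in Ico 0 t, ∫ y in Ioi 0, (η s - η (s - y)) * y ^ p := by
        rw [← integral_indicator measurableSet_Ico]
        refine integral_congr_ae (ae_of_all _ fun s => ?_)
        simp only [integral_const_mul]
        by_cases hs : s ∈ Ico 0 t <;> simp [hs]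

end Derivative

/-! ### The fractional integral of a function supported in an interval -/

section Riesz

variable {p : ℝ}

/-- The kernel `y ↦ y^p` on `(0, ∞)`, extended by zero. -/
noncomputable def rieszKernel (p : ℝ) : ℝ → ℝ := (Ioi 0).indicator fun y => y ^ p

theorem rieszKernel_of_pos {y : ℝ} (hy : 0 < y) : rieszKernel p y = y ^ p :=
  indicator_of_mem (mem_Ioi.2 hy) _

theorem rieszKernel_of_nonpos {y : ℝ} (hy : y ≤ 0) : rieszKernel p y = 0 :=
  indicator_of_notMem (fun h => absurd (mem_Ioi.1 h) hy.not_gt) _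

theorem measurable_rieszKernel (p : ℝ) : Measurable (rieszKernel p) :=
  Measurable.indicator (by fun_prop) measurableSet_Ioi

theorem rieszKernel_nonneg (p y : ℝ) : 0 ≤ rieszKernel p y :=
  indicator_nonneg (fun _ hz => Real.rpow_nonneg (le_of_lt (mem_Ioi.1 hz)) _) y

theorem setIntegral_Ioi_mul_rpow (f : ℝ → ℝ) (x : ℝ) :
    ∫ s in Ioi x, f s * (s - x) ^ p = ∫ s, f s * rieszKernel p (s - x) := by
  rw [← integral_indicator measurableSet_Ioi]
  congr 1
  ext s
  rcases le_or_gt s x with h | h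
  · rw [rieszKernel_of_nonpos (by linarith), indicator_of_notMem (by simpa using h), mul_zero]
  · rw [rieszKernel_of_pos (by linarith), indicator_of_mem (mem_Ioi.2 h)]

theorem setIntegral_Iio_mul_rpow (f : ℝ → ℝ) (s : ℝ) :
    ∫ x in Iio s, f x * (s - x) ^ p = ∫ x, f x * rieszKernel p (s - x) := by
  rw [← integral_indicator measurableSet_Iio]
  congr 1
  ext x
  rcases le_or_gt s x with h | h
  · rw [rieszKernel_of_nonpos (by linarith), indicator_of_notMem (by simpa using h), mul_zero]
  · rw [rieszKernel_of_pos (by linarith), indicator_of_mem (mem_Iio.2 h)]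

theorem integrable_conv_prod {f g : ℝ → ℝ} (hf : Integrable f) (hg : Integrable g) :
    Integrable (fun z : ℝ × ℝ => f z.2 * g (z.1 - z.2)) (volume.prod volume) :=
  hf.convolution_integrand (ContinuousLinearMap.mul ℝ ℝ) hg

theorem integrableOn_Ioc_rpow (hp : -1 < p) : IntegrableOn (fun y : ℝ => y ^ p) (Ioc 0 1) := by
  have h := intervalIntegral.intervalIntegrable_rpow' (a := 0) (b := 1) hp
  rwa [intervalIntegrable_iff_integrableOn_Ioc_of_le zero_le_one] at h

/-- Split the kernel at distance 1. The near part is integrable and is convolved with `m` while `η`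
is bounded by `M`; the far part is at most 1, leaving the product of two integrable functions. -/
theorem integrable_riesz_prod (hp : -1 < p) (hp' : p ≤ 0) {m η : ℝ → ℝ} (hm : Integrable m)
    (hη : Integrable η) {M : ℝ} (hM : ∀ x, |η x| ≤ M) :
    Integrable (fun z : ℝ × ℝ => m z.2 * rieszKernel p (z.2 - z.1) * η z.1)
      (volume.prod volume) := by
  have h1 : Integrable ((Ioc 0 1).indicator fun y : ℝ => y ^ p) :=
    (integrable_indicator_iff measurableSet_Ioc).2 (integrableOn_Ioc_rpow hp)
  have h2 := (integrable_conv_prod hm h1.comp_neg).norm.const_mul M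
  have h3 := (hη.norm.mul_prod hm.norm)
  refine (h2.add h3).mono' ?_ (ae_of_all _ fun z => ?_)
  · have := measurable_rieszKernel p
    exact (hm.1.comp_snd.mul (this.comp (measurable_snd.sub measurable_fst)).aestronglyMeasurable).mul
      hη.1.comp_fst
  · simp only [Pi.add_apply, neg_sub, norm_mul, Real.norm_eq_abs]
    have hMz := hM z.1
    have hM0 : 0 ≤ M := (abs_nonneg _).trans hMz
    set y := z.2 - z.1
    have a1 := abs_nonneg (m z.2)
    have a2 := abs_nonneg (η z.1)
    rcases le_or_gt y 0 with h | h
    · rw [rieszKernel_of_nonpos h]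
      simp only [abs_zero, mul_zero, zero_mul]
      positivity
    · rw [rieszKernel_of_pos h]
      have hy := Real.rpow_nonneg h.le p
      rw [abs_of_nonneg hy]
      rcases le_or_gt y 1 with h1 | h1
      · rw [indicator_of_mem (show y ∈ Ioc 0 1 from ⟨h, h1⟩), abs_of_nonneg hy]
        have := mul_le_mul_of_nonneg_left hMz (mul_nonneg a1 hy)
        nlinarith [mul_nonneg a1 a2]
      · rw [indicator_of_notMem (fun hh => absurd hh.2 h1.not_ge)]
        have : y ^ p ≤ 1 := Real.rpow_le_one_of_one_le_of_nonpos h1.le hp'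
        have := mul_le_mul_of_nonneg_left this (mul_nonneg a1 a2)
        simp only [abs_zero, mul_zero, zero_add]
        nlinarith

/-- Fractional integration by parts. -/
theorem integral_riesz_mul (hp : -1 < p) (hp' : p ≤ 0) {m η : ℝ → ℝ} (hm : Integrable m)
    (hη : Integrable η) {M : ℝ} (hM : ∀ x, |η x| ≤ M) :
    ∫ x, (∫ s in Ioi x, m s * (s - x) ^ p) * η x =
      ∫ s, m s * ∫ x in Iio s, η x * (s - x) ^ p := by
  simp only [setIntegral_Ioi_mul_rpow, setIntegral_Iio_mul_rpow, ← integral_const_mul,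
    ← integral_mul_const]
  rw [integral_integral_swap (integrable_riesz_prod hp hp' hm hη hM)]
  congr 1
  ext s
  congr 1
  ext x
  ring

/-- The constant `∫_0^∞ y^p (1+y)^p dy`. -/
noncomputable def rieszConst (p : ℝ) : ℝ := ∫ y in Ioi (0 : ℝ), y ^ p * (1 + y) ^ p

theorem integrableOn_rieszConst (hp : -1 < p) (hp' : p < -(1 / 2)) :
    IntegrableOn (fun y : ℝ => y ^ p * (1 + y) ^ p) (Ioi 0) := by
  have hm : Measurable fun y : ℝ => y ^ p * (1 + y) ^ p := by fun_prop
  rw [← Ioc_union_Ioi_eq_Ioi (zero_le_one' ℝ)]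
  refine IntegrableOn.union ((integrableOn_Ioc_rpow hp).mono' hm.aestronglyMeasurable ?_)
    ((integrableOn_Ioi_rpow_of_lt (a := 2 * p) (by linarith) zero_lt_one).mono'
      hm.aestronglyMeasurable ?_)
  · filter_upwards [ae_restrict_mem measurableSet_Ioc] with y hy
    have h1 := Real.rpow_nonneg hy.1.le p
    have h2 := Real.rpow_nonneg (by linarith [hy.1] : 0 ≤ 1 + y) p
    rw [Real.norm_of_nonneg (mul_nonneg h1 h2)]
    exact mul_le_of_le_one_right h1
      (Real.rpow_le_one_of_one_le_of_nonpos (by linarith [hy.1]) (by linarith))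
  · filter_upwards [ae_restrict_mem measurableSet_Ioi] with y hy
    have hy : 1 < y := hy
    have h1 := Real.rpow_nonneg (by linarith : 0 ≤ y) p
    have h2 := Real.rpow_nonneg (by linarith : 0 ≤ 1 + y) p
    rw [Real.norm_of_nonneg (mul_nonneg h1 h2), two_mul, Real.rpow_add (by linarith)]
    exact mul_le_mul_of_nonneg_left
      (Real.rpow_le_rpow_of_nonpos (by linarith) (by linarith) (by linarith)) h1

/-- Put `y = s - x` and scale by `d = r - s`: the kernels contribute d^(2p) and the measure one more
factor `d`. -/
theorem integral_rieszKernel_mul_of_lt (hp : -1 < p) (hp' : p < -(1 / 2)) {s r : ℝ}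
    (h : s < r) :
    Integrable (fun x => rieszKernel p (s - x) * rieszKernel p (r - x)) ∧
      ∫ x, rieszKernel p (s - x) * rieszKernel p (r - x) =
        rieszConst p * |s - r| ^ (2 * p + 1) := by
  set d := r - s with hd
  have hd0 : 0 < d := by linarith
  have e0 : ∀ y, (rieszKernel p y * rieszKernel p (d + y)) =
      (Ioi 0).indicator (fun y => y ^ p * (d + y) ^ p) y := by
    intro y
    rcases le_or_gt y 0 with hy | hy
    · rw [rieszKernel_of_nonpos hy, indicator_of_notMem (by simpa using hy), zero_mul]
    · rw [rieszKernel_of_pos hy, rieszKernel_of_pos (by linarith), indicator_of_mem (mem_Ioi.2 hy)]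
  have e1 : ∀ x, rieszKernel p (s - x) * rieszKernel p (r - x) =
      rieszKernel p (s - x) * rieszKernel p (d + (s - x)) := fun x => by
    rw [hd]; ring_nf
  have e2 : ∀ z ∈ Ioi (0 : ℝ), (d * z) ^ p * (d + d * z) ^ p =
      d ^ (2 * p) * (z ^ p * (1 + z) ^ p) := fun z hz => by
    have hz : 0 < z := hz
    rw [show d + d * z = d * (1 + z) by ring, Real.mul_rpow hd0.le hz.le,
      Real.mul_rpow hd0.le (by linarith), two_mul, Real.rpow_add hd0]
    ring
  have hi : IntegrableOn (fun y : ℝ => y ^ p * (d + y) ^ p) (Ioi 0) := by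
    have := (integrableOn_Ioi_comp_mul_left_iff (fun y : ℝ => y ^ p * (d + y) ^ p) 0 hd0)
    rw [mul_zero] at this
    rw [← this]
    exact IntegrableOn.congr_fun ((integrableOn_rieszConst hp hp').const_mul (d ^ (2 * p)))
      (fun z hz => (e2 z hz).symm) measurableSet_Ioi
  simp only [e1]
  constructor
  · refine Integrable.comp_sub_left (f := fun y => rieszKernel p y * rieszKernel p (d + y)) ?_ s
    simp only [e0]
    exact (integrable_indicator_iff measurableSet_Ioi).2 hi
  · rw [integral_sub_left_eq_self (fun y => rieszKernel p y * rieszKernel p (d + y)) volume s]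
    simp only [e0]
    rw [integral_indicator measurableSet_Ioi]
    have h3 := integral_comp_mul_left_Ioi' (fun y : ℝ => y ^ p * (d + y) ^ p) 0 hd0
    rw [mul_zero, setIntegral_congr_fun measurableSet_Ioi e2, integral_const_mul, smul_eq_mul]
      at h3
    rw [← h3, rieszConst, abs_sub_comm, abs_of_pos hd0, Real.rpow_add_one hd0.ne']
    ring

theorem integral_rieszKernel_mul (hp : -1 < p) (hp' : p < -(1 / 2)) {s r : ℝ} (h : s ≠ r) :
    Integrable (fun x => rieszKernel p (s - x) * rieszKernel p (r - x)) ∧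
      ∫ x, rieszKernel p (s - x) * rieszKernel p (r - x) =
        rieszConst p * |s - r| ^ (2 * p + 1) := by
  rcases lt_or_gt_of_ne h with h | h
  · exact integral_rieszKernel_mul_of_lt hp hp' h
  · have := integral_rieszKernel_mul_of_lt hp hp' h
    rw [abs_sub_comm] at this
    simpa only [mul_comm (rieszKernel p (r - _))] using this

theorem ae_prod_ne : ∀ᵐ z : ℝ × ℝ ∂(volume.prod volume), z.1 ≠ z.2 := by
  have hs : MeasurableSet {z : ℝ × ℝ | z.1 = z.2} :=
    measurableSet_eq_fun measurable_fst measurable_snd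
  have : (volume.prod volume : Measure (ℝ × ℝ)) {z : ℝ × ℝ | z.1 = z.2} = 0 := by
    rw [Measure.measure_prod_null hs]
    refine ae_of_all _ fun x => ?_
    have : Prod.mk x ⁻¹' {z : ℝ × ℝ | z.1 = z.2} = {x} := by
      ext y; simp [eq_comm]
    simp [this]
  rw [ae_iff]
  simpa using this

/-- Both points lie in [0, t), so the kernel may be cut off at distance `t`. It then becomes
integrable, and its convolution with the indicator is a majorant off the null diagonal. -/
theorem integrable_mul_mul_abs_sub_rpow {q t M : ℝ} (hq : -1 < q) {m : ℝ → ℝ}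
    (hm : Measurable m) (hmM : ∀ x, |m x| ≤ M * ind t x) :
    Integrable (fun z : ℝ × ℝ => m z.1 * m z.2 * |z.1 - z.2| ^ q) (volume.prod volume) := by
  rcases le_or_gt t 0 with ht | ht
  · have : ∀ x, m x = 0 := fun x => by
      have := hmM x
      rwa [ind_of_notMem (fun h => by linarith [h.1, h.2]), mul_zero, abs_nonpos_iff] at this
    simp [this]
  have h0 := intervalIntegral.intervalIntegrable_rpow' (a := 0) (b := t) hq
  rw [intervalIntegrable_iff_integrableOn_Ioc_of_le ht.le] at h0
  have h1 : Integrable ((Ioc 0 t).indicator fun y : ℝ => y ^ q) :=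
    (integrable_indicator_iff measurableSet_Ioc).2 h0
  have h2 := (integrable_conv_prod (integrable_ind t) (h1.add h1.comp_neg)).const_mul (M ^ 2)
  refine h2.mono' ?_ ?_
  · exact Measurable.aestronglyMeasurable (by fun_prop)
  filter_upwards [ae_prod_ne] with z hz
  simp only [Pi.add_apply, neg_sub, norm_mul, Real.norm_eq_abs]
  have n0 : 0 ≤ |z.1 - z.2| ^ q := Real.rpow_nonneg (abs_nonneg _) _
  have n1 : ∀ y : ℝ, 0 ≤ (Ioc 0 t).indicator (fun y : ℝ => y ^ q) y := fun y =>
    indicator_nonneg (fun w hw => Real.rpow_nonneg hw.1.le _) _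
  have a1 := hmM z.1
  have a2 := hmM z.2
  rw [abs_of_nonneg n0]
  have hM0 : ∀ x ∈ Ico 0 t, 0 ≤ M := fun x hx => by
    have := hmM x
    rw [ind_of_mem hx, mul_one] at this
    exact (abs_nonneg _).trans this
  by_cases c1 : z.1 ∈ Ico 0 t
  swap
  · rw [ind_of_notMem c1, mul_zero, abs_nonpos_iff] at a1
    rw [a1, abs_zero, zero_mul, zero_mul]
    exact mul_nonneg (sq_nonneg M) (mul_nonneg (ind_nonneg _ _) (add_nonneg (n1 _) (n1 _)))
  by_cases c2 : z.2 ∈ Ico 0 t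
  swap
  · rw [ind_of_notMem c2, mul_zero, abs_nonpos_iff] at a2
    rw [a2, abs_zero, mul_zero, zero_mul]
    exact mul_nonneg (sq_nonneg M) (mul_nonneg (ind_nonneg _ _) (add_nonneg (n1 _) (n1 _)))
  rw [ind_of_mem c1, mul_one] at a1
  rw [ind_of_mem c2, mul_one] at a2
  rw [ind_of_mem c2, one_mul]
  refine mul_le_mul ?_ ?_ n0 (sq_nonneg M)
  · rw [sq]
    exact mul_le_mul a1 a2 (abs_nonneg _) (hM0 _ c1)
  · rcases lt_or_gt_of_ne hz with h | h
    · rw [indicator_of_mem (show z.2 - z.1 ∈ Ioc 0 t from ⟨by linarith, by linarith [c2.2, c1.1]⟩),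
        abs_sub_comm, abs_of_pos (by linarith)]
      exact le_add_of_nonneg_left (n1 _)
    · rw [indicator_of_mem (show z.1 - z.2 ∈ Ioc 0 t from ⟨by linarith, by linarith [c1.2, c2.1]⟩),
        abs_of_pos (by linarith)]
      exact le_add_of_nonneg_right (n1 _)

/-- The `L²` norm of a fractional integral as a Riesz energy. -/
theorem integral_sq_riesz (hp : -1 < p) (hp' : p < -(1 / 2)) {t M : ℝ} {m : ℝ → ℝ}
    (hm : Measurable m) (hmM : ∀ x, |m x| ≤ M * ind t x) :
    Integrable (fun x => (∫ s in Ioi x, m s * (s - x) ^ p) ^ 2) ∧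
      ∫ x, (∫ s in Ioi x, m s * (s - x) ^ p) ^ 2 =
        rieszConst p * ∫ z : ℝ × ℝ, m z.1 * m z.2 * |z.1 - z.2| ^ (2 * p + 1) := by
  have hρ := measurable_rieszKernel p
  have hE := integrable_mul_mul_abs_sub_rpow (q := 2 * p + 1) (by linarith) hm hmM
  set G : ℝ → ℝ × ℝ → ℝ := fun x z =>
    m z.1 * rieszKernel p (z.1 - x) * (m z.2 * rieszKernel p (z.2 - x)) with hG
  have hGe : ∀ x z, G x z =
      m z.1 * m z.2 * (rieszKernel p (z.1 - x) * rieszKernel p (z.2 - x)) := fun x z => by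
    simp only [hG]; ring
  have hGi : Integrable (Function.uncurry G) (volume.prod (volume.prod volume)) := by
    have hmeas : Measurable (Function.uncurry G) := by
      unfold Function.uncurry
      simp only [hG]
      fun_prop
    rw [integrable_prod_iff' hmeas.aestronglyMeasurable]
    constructor
    · filter_upwards [ae_prod_ne] with z hz
      simp only [Function.uncurry, hGe]
      exact (integral_rieszKernel_mul hp hp' hz).1.const_mul _
    · refine (hE.norm.const_mul (rieszConst p)).congr ?_
      filter_upwards [ae_prod_ne] with z hz
      simp only [Function.uncurry, hGe, norm_mul, Real.norm_of_nonneg (rieszKernel_nonneg p _)]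
      rw [integral_const_mul, (integral_rieszKernel_mul hp hp' hz).2,
        Real.norm_of_nonneg (Real.rpow_nonneg (abs_nonneg _) _)]
      ring
  -- Writing the square as a double integral lets Fubini integrate out `x` first, which composes the
  -- two Riesz kernels.
  have hsq : ∀ x, (∫ s in Ioi x, m s * (s - x) ^ p) ^ 2 = ∫ z, G x z ∂(volume.prod volume) := by
    intro x
    rw [setIntegral_Ioi_mul_rpow, sq]
    exact (integral_prod_mul (fun s => m s * rieszKernel p (s - x))
      (fun s => m s * rieszKernel p (s - x))).symm
  simp only [hsq]
  refine ⟨hGi.integral_prod_left, ?_⟩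
  rw [integral_integral_swap hGi, ← integral_const_mul]
  refine integral_congr_ae ?_
  filter_upwards [ae_prod_ne] with z hz
  simp only [hGe]
  rw [integral_const_mul, (integral_rieszKernel_mul hp hp' hz).2]
  ring

/-- The density of the Riesz energy of `ν` on `[0, t]`. -/
noncomputable def energyDensity (q : ℝ) (ν : ℝ → ℝ) (s : ℝ) : ℝ :=
  2 * ν s * (s ^ (q + 1) * ∫ u in (0 : ℝ)..1, ν (s - s * u) * u ^ q)

/-- In the rescaled form the domain and the singular factor u^q do not depend on `s`, so dominated
convergence applies. Continuity of the density makes the energy differentiable. -/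
theorem continuous_energyDensity {q : ℝ} (hq : -1 < q) {ν : ℝ → ℝ} (hν : Continuous ν) :
    Continuous (energyDensity q ν) := by
  have h1 : Continuous fun s : ℝ => s ^ (q + 1) :=
    continuous_id.rpow_const fun _ => Or.inr (by linarith)
  have h2 : Continuous fun s : ℝ => ∫ u in (0 : ℝ)..1, ν (s - s * u) * u ^ q := by
    rw [continuous_iff_continuousAt]
    intro s₀
    obtain ⟨C, hC⟩ := (isCompact_Icc (a := -(|s₀| + 1)) (b := |s₀| + 1)).exists_bound_of_continuousOn
      hν.continuousOn
    refine intervalIntegral.continuousAt_of_dominated_interval (bound := fun u => C * u ^ q)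
      (Eventually.of_forall fun s => Measurable.aestronglyMeasurable (by fun_prop)) ?_
      ((intervalIntegral.intervalIntegrable_rpow' hq).const_mul C)
      (ae_of_all _ fun u _ => by fun_prop)
    filter_upwards [Metric.ball_mem_nhds s₀ one_pos] with s hs
    refine ae_of_all _ fun u hu => ?_
    rw [uIoc_of_le zero_le_one] at hu
    rw [norm_mul, Real.norm_of_nonneg (Real.rpow_nonneg hu.1.le q)]
    refine mul_le_mul_of_nonneg_right (hC _ ?_) (Real.rpow_nonneg hu.1.le q)
    rw [Metric.mem_ball, Real.dist_eq] at hs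
    have hs' : |s| ≤ |s₀| + 1 := by
      have := abs_sub_abs_le_abs_sub s s₀
      linarith
    rw [mem_Icc, ← abs_le, show s - s * u = s * (1 - u) by ring, abs_mul,
      abs_of_nonneg (by linarith [hu.2] : 0 ≤ 1 - u)]
    nlinarith [abs_nonneg s, hu.1]
  unfold energyDensity
  fun_prop

theorem integral_Ioo_mul_sub_rpow {q s : ℝ} (hs : 0 < s) (ν : ℝ → ℝ) :
    ∫ r in Ioo 0 s, ν r * (s - r) ^ q =
      s ^ (q + 1) * ∫ u in (0 : ℝ)..1, ν (s - s * u) * u ^ q := by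
  have h := intervalIntegral.integral_comp_sub_mul (a := 0) (b := 1)
    (fun r => ν r * (s - r) ^ q) hs.ne' s
  simp only [mul_one, sub_self, mul_zero, sub_zero, sub_sub_cancel, smul_eq_mul] at h
  rw [eq_inv_mul_iff_mul_eq₀ hs.ne'] at h
  rw [← integral_Ioc_eq_integral_Ioo, ← intervalIntegral.integral_of_le hs.le, ← h,
    Real.rpow_add_one hs.ne', mul_comm (s ^ q), mul_assoc,
    ← intervalIntegral.integral_const_mul (s ^ q)]
  congr 1
  refine intervalIntegral.integral_congr fun u hu => ?_
  rw [uIcc_of_le zero_le_one] at hu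
  simp only [Real.mul_rpow hs.le hu.1]
  ring

/-- The integrand is symmetric and the diagonal is null, so the energy is twice the integral over
the triangle `z.2 < z.1`. Integrating over the smaller variable first gives the density. -/
theorem integral_energy {q t M : ℝ} (hq : -1 < q) (ht : 0 ≤ t) {ν : ℝ → ℝ}
    (hν : Measurable ((Ico 0 t).indicator ν))
    (hνM : ∀ x, |(Ico 0 t).indicator ν x| ≤ M * ind t x) :
    ∫ z : ℝ × ℝ, (Ico 0 t).indicator ν z.1 * (Ico 0 t).indicator ν z.2 * |z.1 - z.2| ^ q =
      ∫ s in (0 : ℝ)..t, energyDensity q ν s := by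
  set m := (Ico 0 t).indicator ν with hm
  have hE := integrable_mul_mul_abs_sub_rpow hq hν hνM
  set F : ℝ × ℝ → ℝ := fun z => m z.1 * m z.2 * |z.1 - z.2| ^ q with hF
  have hT : MeasurableSet {z : ℝ × ℝ | z.2 < z.1} :=
    measurableSet_lt measurable_snd measurable_fst
  have h1 := hE.indicator hT
  have e1 : ∫ z, F z = ∫ z, ({z : ℝ × ℝ | z.2 < z.1}.indicator F z +
      {z : ℝ × ℝ | z.2 < z.1}.indicator F z.swap) := by
    refine integral_congr_ae ?_
    filter_upwards [ae_prod_ne] with z hz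
    rcases lt_or_gt_of_ne hz with h | h
    · rw [indicator_of_notMem (show z ∉ {z : ℝ × ℝ | z.2 < z.1} from not_lt.2 h.le),
        indicator_of_mem (show z.swap ∈ {z : ℝ × ℝ | z.2 < z.1} from h)]
      simp only [hF, Prod.fst_swap, Prod.snd_swap]
      rw [abs_sub_comm]
      ring
    · rw [indicator_of_mem (show z ∈ {z : ℝ × ℝ | z.2 < z.1} from h),
        indicator_of_notMem (show z.swap ∉ {z : ℝ × ℝ | z.2 < z.1} from not_lt.2 h.le), add_zero]
  have e2 : ∫ z, ({z : ℝ × ℝ | z.2 < z.1}.indicator F z +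
      {z : ℝ × ℝ | z.2 < z.1}.indicator F z.swap) =
      2 * ∫ z, {z : ℝ × ℝ | z.2 < z.1}.indicator F z := by
    rw [two_mul]
    refine (integral_add h1 h1.swap).trans ?_
    congr 1
    exact integral_prod_swap (μ := (volume : Measure ℝ)) (ν := (volume : Measure ℝ))
      ({z : ℝ × ℝ | z.2 < z.1}.indicator F)
  rw [e1, e2, Measure.volume_eq_prod, integral_prod _ h1, ← integral_const_mul,
    intervalIntegral.integral_of_le ht, integral_Ioc_eq_integral_Ioo,
    ← integral_indicator measurableSet_Ioo]
  have h0 : ∀ᵐ s : ℝ, s ≠ 0 := by simp [ae_iff]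
  refine integral_congr_ae ?_
  filter_upwards [h0] with s hs0
  by_cases hs : s ∈ Ioo 0 t
  · rw [indicator_of_mem hs, energyDensity, ← integral_Ioo_mul_sub_rpow hs.1,
      ← integral_Ico_eq_integral_Ioo, ← integral_indicator measurableSet_Ico, mul_assoc,
      ← integral_const_mul (ν s)]
    congr 1
    refine integral_congr_ae (ae_of_all _ fun r => ?_)
    simp only [indicator, mem_ofPred_eq, hF, hm, mem_Ico]
    split_ifs with a1 a2 a3 a4
    all_goals grind [hs.1, hs.2]
  · rw [indicator_of_notMem hs]
    have : m s = 0 := indicator_of_notMem (fun h => hs ⟨lt_of_le_of_ne h.1 (Ne.symm hs0), h.2⟩) _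
    simp [indicator, hF, this]

end Riesz

/-! ### The integrands `M_-^H (ν 1_{[0,t)})` -/

/-- `V` is the energy `t ↦ ‖M_-^H (ν 1_{[0,t)})‖²`, it is continuous on `[0, ∞)`, vanishes at `0`
and is differentiable on `(0, ∞)`; moreover `M_-^H (ν 1_{[0,t)})` satisfies the
integration by parts formula. -/
structure IsEnergy (H : ℝ) (ν V : ℝ → ℝ) : Prop where
  continuousOn : ContinuousOn V (Ici 0)
  zero : V 0 = 0
  differentiableAt : ∀ t, 0 < t → DifferentiableAt ℝ V t
  memLp : ∀ t, 0 ≤ t → MemLp (opMinus H ((Ico 0 t).indicator ν)) 2 volume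
  eq : ∀ t, 0 ≤ t → ∫ x, opMinus H ((Ico 0 t).indicator ν) x ^ 2 = V t
  parts : ∀ t, 0 ≤ t → ∀ η : 𝓢(ℝ, ℝ), ∫ x, opMinus H ((Ico 0 t).indicator ν) x * η x =
    ∫ s in Ico 0 t, ν s * opPlus H (fun x => η x) s

theorem integrable_of_abs_le_ind {t M : ℝ} {m : ℝ → ℝ} (hm : Measurable m)
    (hM : ∀ x, |m x| ≤ M * ind t x) : Integrable m :=
  ((integrable_ind t).const_mul M).mono' hm.aestronglyMeasurable (ae_of_all _ hM)

theorem exists_bound_indicator {ν : ℝ → ℝ} (hν : Continuous ν) (t : ℝ) :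
    Measurable ((Ico 0 t).indicator ν) ∧ ∃ M, ∀ x, |(Ico 0 t).indicator ν x| ≤ M * ind t x := by
  refine ⟨hν.measurable.indicator measurableSet_Ico, ?_⟩
  obtain ⟨M, hM⟩ := (isCompact_Icc (a := 0) (b := t)).exists_bound_of_continuousOn hν.continuousOn
  refine ⟨M, fun x => ?_⟩
  by_cases hx : x ∈ Ico 0 t
  · rw [indicator_of_mem hx, ind_of_mem hx, mul_one]
    exact hM x (Ico_subset_Icc_self hx)
  · rw [indicator_of_notMem hx, ind_of_notMem hx, mul_zero, abs_zero]

theorem IsEnergy.congr {H : ℝ} {ν ν' V : ℝ → ℝ} (h : IsEnergy H ν V)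
    (he : ∀ s, 0 ≤ s → ν' s = ν s) : IsEnergy H ν' V := by
  have e1 : ∀ t, (Ico 0 t).indicator ν' = (Ico 0 t).indicator ν := fun t =>
    indicator_congr fun s hs => he s hs.1
  refine ⟨h.continuousOn, h.zero, h.differentiableAt, fun t ht => ?_, fun t ht => ?_,
    fun t ht η => ?_⟩
  · rw [e1]; exact h.memLp t ht
  · rw [e1]; exact h.eq t ht
  · rw [e1, h.parts t ht η]
    exact setIntegral_congr_fun measurableSet_Ico fun s hs => by simp only [he s hs.1]

/-- Extends ν continuously to the left of 0; by `IsEnergy.congr` the values there do not matter. -/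
theorem continuous_comp_max {ν : ℝ → ℝ} (hν : ContinuousOn ν (Ici 0)) :
    Continuous fun s => ν (max s 0) :=
  hν.comp_continuous (by fun_prop) fun _ => mem_Ici.2 (le_max_right _ _)

theorem continuousOn_primitive_real {g : ℝ → ℝ} (hg : Continuous g) :
    ContinuousOn (fun t => ∫ s in (0 : ℝ)..t, g s) (Ici 0) ∧
      ∀ t, 0 < t → DifferentiableAt ℝ (fun t => ∫ s in (0 : ℝ)..t, g s) t :=
  ⟨fun t _ => (hg.integral_hasStrictDerivAt 0 t).hasDerivAt.continuousAt.continuousWithinAt,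
    fun t _ => (hg.integral_hasStrictDerivAt 0 t).hasDerivAt.differentiableAt⟩

theorem isEnergy_half {ν : ℝ → ℝ} (hν : Continuous ν) :
    IsEnergy (1 / 2) ν fun t => ∫ s in (0 : ℝ)..t, ν s ^ 2 := by
  have e : ∀ f, opMinus (1 / 2) f = f := fun f => by ext x; simp [opMinus]
  have e' : ∀ f, opPlus (1 / 2) f = f := fun f => by ext x; simp [opPlus]
  have hi : ∀ t x, (Ico 0 t).indicator ν x ^ 2 = (Ico 0 t).indicator (fun s => ν s ^ 2) x :=
    fun t x => by by_cases hx : x ∈ Ico 0 t <;> simp [hx]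
  have hc := continuousOn_primitive_real (hν.pow 2)
  refine ⟨hc.1, by simp, hc.2, fun t ht => ?_, fun t ht => ?_, fun t ht η => ?_⟩
  · rw [e, memLp_two_iff_integrable_sq (hν.measurable.indicator measurableSet_Ico).aestronglyMeasurable]
    simp only [hi]
    refine (integrable_indicator_iff measurableSet_Ico).2 ?_
    exact ((hν.pow 2).continuousOn.integrableOn_Icc (a := 0) (b := t)).mono_set Ico_subset_Icc_self
  · simp only [e, hi]
    rw [integral_indicator measurableSet_Ico, intervalIntegral.integral_of_le ht,
      integral_Ioc_eq_integral_Ioo, integral_Ico_eq_integral_Ioo]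
  · rw [e, e', ← integral_indicator measurableSet_Ico]
    congr 1
    ext x
    by_cases hx : x ∈ Ico 0 t <;> simp [hx]

/-- Here p = H - 3/2 lies in (-1, -1/2), and the energy kernel has exponent 2p + 1 = 2H - 2 > -1. -/
theorem isEnergy_of_half_lt {H : ℝ} (hH : 1 / 2 < H) (hH1 : H < 1) {ν : ℝ → ℝ}
    (hν : Continuous ν) :
    IsEnergy H ν fun t => ∫ s in (0 : ℝ)..t, (constK H / Real.Gamma (H - 1 / 2)) ^ 2 *
      rieszConst (H - 3 / 2) * energyDensity (2 * (H - 3 / 2) + 1) ν s := by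
  set C := constK H / Real.Gamma (H - 1 / 2) with hC
  have e : ∀ f, opMinus H f = fun x => C * ∫ s in Ioi x, f s * (s - x) ^ (H - 3 / 2) := fun f => by
    ext x; simp only [opMinus, hH.ne', hH, if_true, if_false, hC]
  have e' : ∀ f, opPlus H f = fun x => C * ∫ s in Iio x, f s * (x - s) ^ (H - 3 / 2) := fun f => by
    ext x; simp only [opPlus, hH.ne', hH, if_true, if_false, hC]
  have hq : -1 < 2 * (H - 3 / 2) + 1 := by linarith
  have hc := continuousOn_primitive_real
    ((continuous_energyDensity hq hν).const_mul (C ^ 2 * rieszConst (H - 3 / 2)))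
  refine ⟨hc.1, by simp, hc.2, fun t ht => ?_, fun t ht => ?_, fun t ht η => ?_⟩
  · obtain ⟨hm, M, hM⟩ := exists_bound_indicator hν t
    rw [e]
    refine MemLp.const_mul ?_ C
    rw [memLp_two_iff_integrable_sq]
    · exact (integral_sq_riesz (by linarith) (by linarith) hm hM).1
    · simp only [setIntegral_Ioi_mul_rpow]
      have hr := measurable_rieszKernel (H - 3 / 2)
      have : Measurable fun z : ℝ × ℝ =>
        (Ico 0 t).indicator ν z.2 * rieszKernel (H - 3 / 2) (z.2 - z.1) := by fun_prop
      exact this.stronglyMeasurable.integral_prod_right.aestronglyMeasurable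
  · obtain ⟨hm, M, hM⟩ := exists_bound_indicator hν t
    simp only [e, mul_pow]
    rw [integral_const_mul, (integral_sq_riesz (by linarith) (by linarith) hm hM).2,
      integral_energy hq ht hm hM, intervalIntegral.integral_const_mul, mul_assoc]
  · obtain ⟨hm, M, hM⟩ := exists_bound_indicator hν t
    obtain ⟨M', -, hM'⟩ := exists_bound_schwartz η
    simp only [e, e', mul_assoc]
    rw [integral_const_mul, integral_riesz_mul (by linarith) (by linarith)
      (integrable_of_abs_le_ind hm hM) η.integrable hM', ← integral_const_mul,
      ← integral_indicator measurableSet_Ico]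
    congr 1
    ext x
    by_cases hx : x ∈ Ico 0 t
    · simp only [indicator_of_mem hx]
      ring
    · simp [hx]

theorem tendsto_setIntegral_Ioi {g : ℝ → ℝ} (hg : IntegrableOn g (Ioi 0)) :
    Tendsto (fun ε => ∫ y in Ioi ε, g y) (𝓝[>] 0) (𝓝 (∫ y in Ioi 0, g y)) := by
  have h := (aecover_Ioi_of_Ioi (μ := volume) (a := fun ε : ℝ => ε) (A := 0) (l := 𝓝[>] 0)
    (tendsto_nhdsWithin_of_tendsto_nhds tendsto_id)).integral_tendsto_of_countably_generated hg
  refine h.congr' ?_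
  filter_upwards [self_mem_nhdsWithin] with ε hε
  rw [Measure.restrict_restrict measurableSet_Ioi,
    inter_eq_left.2 (Ioi_subset_Ioi (le_of_lt hε))]

theorem limUnder_marchaud {C q : ℝ} {g : ℝ → ℝ}
    (hg : IntegrableOn (fun y => g y * y ^ (-q)) (Ioi 0)) :
    limUnder (𝓝[>] (0 : ℝ)) (fun ε => C * ∫ y in Ioi ε, g y / y ^ q) =
      C * ∫ y in Ioi 0, g y * y ^ (-q) := by
  refine Tendsto.limUnder_eq (((tendsto_setIntegral_Ioi hg).const_mul C).congr' ?_)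
  filter_upwards [self_mem_nhdsWithin] with ε hε
  congr 1
  refine setIntegral_congr_fun measurableSet_Ioi fun y hy => ?_
  have : 0 < y := (mem_Ioi.1 hε).trans hy
  simp only [Real.rpow_neg this.le, div_eq_mul_inv]

/-- For constant ν the integrand is a multiple of the Marchaud derivative of an indicator, so
scaling alone determines the energy. -/
theorem isEnergy_of_lt_half {H : ℝ} (hH0 : 0 < H) (hH : H < 1 / 2) (c : ℝ) :
    IsEnergy H (fun _ => c) fun t =>
      (constK H * (1 / 2 - H) / Real.Gamma (1 / 2 + H) * c) ^ 2 *
        (t ^ (2 * H) * ∫ x, marchaud (H - 3 / 2) 1 x ^ 2) := by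
  set C := constK H * (1 / 2 - H) / Real.Gamma (1 / 2 + H) with hC
  have hp : -(3 / 2 - H) = H - 3 / 2 := by ring
  have e : ∀ t, opMinus H ((Ico 0 t).indicator fun _ => c) =
      fun x => C * c * marchaud (H - 3 / 2) t x := fun t => by
    ext x
    have hi : ∀ x, (Ico 0 t).indicator (fun _ => c) x = c * ind t x := fun x => by
      by_cases hx : x ∈ Ico 0 t <;> simp [hx]
    have h1 := (integrableOn_jump (p := H - 3 / 2) (by linarith) t x).const_mul c
    simp only [← mul_assoc] at h1
    simp only [opMinus, hH.ne, hH.not_gt, if_false, hi, ← mul_sub, ← hC]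
    rw [limUnder_marchaud (by rwa [hp]), hp, marchaud, mul_assoc, ← integral_const_mul c]
    simp only [mul_assoc]
  have e' : ∀ η : 𝓢(ℝ, ℝ), opPlus H (fun x => η x) =
      fun s => C * ∫ y in Ioi 0, (η s - η (s - y)) * y ^ (H - 3 / 2) := fun η => by
    ext s
    have h1 := (integral_marchaud_mul (p := H - 3 / 2) (by linarith) (by linarith) le_rfl η).1 s
    simp only [opPlus, hH.ne, hH.not_gt, if_false, ← hC]
    rw [limUnder_marchaud (by rwa [hp]), hp]
  have hpw : 2 * (H - 3 / 2) + 3 = 2 * H := by ring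
  have hq := fun {t : ℝ} (ht : 0 ≤ t) =>
    integrable_sq_marchaud (p := H - 3 / 2) (by linarith) (by linarith) ht
  refine ⟨?_, ?_, fun t ht => ?_, fun t ht => ?_, fun t ht => ?_, fun t ht η => ?_⟩
  · refine Continuous.continuousOn ?_
    have : Continuous fun t : ℝ => t ^ (2 * H) :=
      continuous_id.rpow_const fun _ => Or.inr (by linarith)
    fun_prop
  · simp only [Real.zero_rpow (by linarith : 2 * H ≠ 0), zero_mul, mul_zero]
  · have : DifferentiableAt ℝ (fun t : ℝ => t ^ (2 * H)) t :=
      Real.differentiableAt_rpow_const_of_ne _ ht.ne'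
    fun_prop
  · rw [e]
    exact ((memLp_two_iff_integrable_sq (measurable_marchaud _ t).aestronglyMeasurable).2
      (hq ht).1).const_mul _
  · simp only [e, mul_pow (C * c)]
    rw [integral_const_mul, (hq ht).2, hpw]
  · simp only [e, e', mul_assoc]
    rw [integral_const_mul, integral_const_mul,
      (integral_marchaud_mul (by linarith) (by linarith) ht η).2, ← integral_const_mul,
      ← integral_const_mul]
    congr 1
    ext s
    ring

theorem exists_isEnergy {H : ℝ} (hH0 : 0 < H) (hH1 : H < 1) {ν : ℝ → ℝ}
    (h1 : 1 / 2 ≤ H → ContinuousOn ν (Ici 0))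
    (h2 : H < 1 / 2 → ∃ c : ℝ, ∀ s, 0 ≤ s → ν s = c) : ∃ V, IsEnergy H ν V := by
  rcases lt_trichotomy H (1 / 2) with h | rfl | h
  · obtain ⟨c, hc⟩ := h2 h
    exact ⟨_, (isEnergy_of_lt_half hH0 h c).congr hc⟩
  · exact ⟨_, (isEnergy_half (continuous_comp_max (h1 le_rfl))).congr fun s hs => by
      rw [max_eq_left hs]⟩
  · exact ⟨_, (isEnergy_of_half_lt h hH1 (continuous_comp_max (h1 h.le))).congr fun s hs => by
      rw [max_eq_left hs]⟩

/-! ### Regularity of σ_ν, deduced from its energy V. -/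

section TimeChange

variable {H : ℝ} {ν V : ℝ → ℝ}

theorem IsEnergy.eLpNorm_sq (h : IsEnergy H ν V) {t : ℝ} (ht : 0 ≤ t) :
    (eLpNorm (opMinus H ((Ico 0 t).indicator ν)) 2 volume).toReal ^ 2 = V t := by
  rw [eLpNorm_two_toReal_sq (h.memLp t ht), h.eq t ht]

theorem IsEnergy.timeChange_rpow (h : IsEnergy H ν V) (hH0 : 0 < H) {t : ℝ} (ht : 0 ≤ t) :
    timeChange H ν t ^ (2 * H) = V t := by
  rw [← h.eLpNorm_sq ht, timeChange, ← Real.rpow_mul ENNReal.toReal_nonneg, ← Real.rpow_natCast]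
  congr 1
  field_simp
  norm_num

theorem timeChange_nonneg (H : ℝ) (ν : ℝ → ℝ) (t : ℝ) : 0 ≤ timeChange H ν t :=
  Real.rpow_nonneg ENNReal.toReal_nonneg _

theorem IsEnergy.timeChange_eq (h : IsEnergy H ν V) (hH0 : 0 < H) {t : ℝ} (ht : 0 ≤ t) :
    timeChange H ν t = V t ^ (1 / (2 * H)) := by
  rw [← h.timeChange_rpow hH0 ht, ← Real.rpow_mul (timeChange_nonneg H ν t)]
  rw [mul_one_div_cancel (by positivity), Real.rpow_one]

theorem IsEnergy.continuousOn_timeChange (h : IsEnergy H ν V) (hH0 : 0 < H) :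
    ContinuousOn (timeChange H ν) (Ici 0) :=
  (h.continuousOn.rpow_const fun _ _ => Or.inr (by positivity)).congr fun _ ht =>
    h.timeChange_eq hH0 ht

theorem IsEnergy.timeChange_zero (h : IsEnergy H ν V) (hH0 : 0 < H) : timeChange H ν 0 = 0 := by
  rw [h.timeChange_eq hH0 le_rfl, h.zero, Real.zero_rpow (by positivity)]

/-- Near `t` one has σ = V^(1/(2H)), and this power is differentiable away from V = 0. -/
theorem IsEnergy.differentiableAt_timeChange (h : IsEnergy H ν V) (hH0 : 0 < H) {t : ℝ}
    (ht : 0 < t) (hσ : 0 < timeChange H ν t) : DifferentiableAt ℝ (timeChange H ν) t := by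
  have hV : V t ≠ 0 := by
    rw [← h.timeChange_rpow hH0 ht.le]
    exact (Real.rpow_pos_of_pos hσ _).ne'
  refine ((h.differentiableAt t ht).rpow_const (p := 1 / (2 * H)) (Or.inl hV)).congr_of_eventuallyEq
    ?_
  filter_upwards [lt_mem_nhds ht] with s hs
  exact h.timeChange_eq hH0 (le_of_lt hs)

end TimeChange

/-! ### Fourier representation of the flow -/

section Fourier

open FourierTransform

/-- The Fourier transform of a real Schwartz function. -/
noncomputable def realFourier (w : 𝓢(ℝ, ℝ)) : 𝓢(ℝ, ℂ) :=
  𝓕 (w.postcompCLM Complex.ofRealCLM)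

/-- The plane wave `ξ ↦ exp(2πiξx)`. -/
noncomputable def planeWave (ξ x : ℝ) : ℂ := Complex.exp ((2 * Real.pi * ξ * x : ℝ) * Complex.I)

theorem norm_planeWave (ξ x : ℝ) : ‖planeWave ξ x‖ = 1 := Complex.norm_exp_ofReal_mul_I _

theorem planeWave_add (ξ x y : ℝ) : planeWave ξ (x + y) = planeWave ξ x * planeWave ξ y := by
  rw [planeWave, planeWave, planeWave, ← Complex.exp_add]
  congr 1
  push_cast
  ring

theorem continuous_planeWave : Continuous fun z : ℝ × ℝ => planeWave z.1 z.2 := by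
  unfold planeWave
  fun_prop

theorem realFourier_inversion (w : 𝓢(ℝ, ℝ)) (x : ℝ) :
    (w x : ℂ) = ∫ ξ, planeWave ξ x * realFourier w ξ := by
  have h : (𝓕⁻ (realFourier w)) x = (w x : ℂ) := by
    rw [realFourier, fourierInv_fourier_eq]
    rfl
  rw [← h, SchwartzMap.fourierInv_coe, Real.fourierInv_eq']
  congr 1
  ext ξ
  rw [smul_eq_mul, planeWave]
  simp only [RCLike.inner_apply, conj_trivial]
  congr 4
  ring

theorem realFourier_deriv (w : 𝓢(ℝ, ℝ)) (ξ : ℝ) :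
    realFourier (SchwartzMap.derivCLM ℝ ℝ w) ξ =
      2 * Real.pi * Complex.I * ξ * realFourier w ξ := by
  have hd : ⇑((SchwartzMap.derivCLM ℝ ℝ w).postcompCLM Complex.ofRealCLM) =
      deriv (w.postcompCLM Complex.ofRealCLM) := by
    ext x
    exact ((w.hasDerivAt x).ofReal_comp.deriv).symm
  rw [realFourier, SchwartzMap.fourier_coe, hd,
    Real.fourier_deriv (SchwartzMap.integrable _) (SchwartzMap.differentiable _)
      (by rw [← hd]; exact SchwartzMap.integrable _)]
  rfl

theorem realFourier_deriv_deriv (w : 𝓢(ℝ, ℝ)) (ξ : ℝ) :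
    realFourier (SchwartzMap.derivCLM ℝ ℝ (SchwartzMap.derivCLM ℝ ℝ w)) ξ =
      ((-(4 * Real.pi ^ 2 * ξ ^ 2) : ℝ) : ℂ) * realFourier w ξ := by
  rw [realFourier_deriv, realFourier_deriv]
  push_cast
  linear_combination (4 * Real.pi ^ 2 * ξ ^ 2 * realFourier w ξ : ℂ) * Complex.I_sq

variable {Φ : ℝ → ℝ}

/-- The function `∫ ŵ(ξ) exp(2πiξx) Φ(2π²ξ²v) dξ`. -/
noncomputable def fourierFlow (Φ : ℝ → ℝ) (w : 𝓢(ℝ, ℝ)) (v x : ℝ) : ℂ :=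
  ∫ ξ, planeWave ξ x * realFourier w ξ * (Φ (2 * Real.pi ^ 2 * ξ ^ 2 * v) : ℂ)

theorem norm_fourierFlow_integrand_le (hΦ1 : ∀ z, 0 ≤ z → |Φ z| ≤ 1) (w : 𝓢(ℝ, ℝ)) {v : ℝ}
    (hv : 0 ≤ v) (x ξ : ℝ) :
    ‖planeWave ξ x * realFourier w ξ * (Φ (2 * Real.pi ^ 2 * ξ ^ 2 * v) : ℂ)‖ ≤
      ‖realFourier w ξ‖ := by
  rw [norm_mul, norm_mul, norm_planeWave, one_mul, Complex.norm_real]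
  exact mul_le_of_le_one_right (norm_nonneg _) (hΦ1 _ (by positivity))

theorem continuous_fourierFlow_integrand (hΦ : Continuous Φ) (w : 𝓢(ℝ, ℝ)) :
    Continuous fun q : (ℝ × ℝ) × ℝ => planeWave q.2 q.1.2 * realFourier w q.2 *
      (Φ (2 * Real.pi ^ 2 * q.2 ^ 2 * q.1.1) : ℂ) := by
  have h1 := continuous_planeWave
  have h2 := (realFourier w).continuous
  have h3 : Continuous fun q : (ℝ × ℝ) × ℝ => planeWave q.2 q.1.2 :=
    h1.comp (continuous_snd.prodMk (continuous_snd.comp continuous_fst))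
  fun_prop

theorem integrable_fourierFlow_integrand (hΦ : Continuous Φ) (hΦ1 : ∀ z, 0 ≤ z → |Φ z| ≤ 1)
    (w : 𝓢(ℝ, ℝ)) {v : ℝ} (hv : 0 ≤ v) (x : ℝ) :
    Integrable fun ξ => planeWave ξ x * realFourier w ξ *
      (Φ (2 * Real.pi ^ 2 * ξ ^ 2 * v) : ℂ) :=
  (realFourier w).integrable.norm.mono'
    ((continuous_fourierFlow_integrand hΦ w).comp
      (Continuous.prodMk_right (v, x))).aestronglyMeasurable
    (ae_of_all _ fun ξ => norm_fourierFlow_integrand_le hΦ1 w hv x ξ)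

theorem continuousOn_fourierFlow (hΦ : Continuous Φ) (hΦ1 : ∀ z, 0 ≤ z → |Φ z| ≤ 1)
    (w : 𝓢(ℝ, ℝ)) :
    ContinuousOn (fun p : ℝ × ℝ => fourierFlow Φ w p.1 p.2) (Ici 0 ×ˢ univ) := by
  have hc := continuous_fourierFlow_integrand hΦ w
  refine continuousOn_of_dominated (bound := fun ξ => ‖realFourier w ξ‖)
    (fun p _ => (hc.comp (Continuous.prodMk_right p)).aestronglyMeasurable)
    (fun p hp => ae_of_all _ fun ξ => norm_fourierFlow_integrand_le hΦ1 w hp.1 p.2 ξ)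
    (realFourier w).integrable.norm
    (ae_of_all _ fun ξ => (hc.comp (Continuous.prodMk_left ξ)).continuousOn)

theorem norm_fourierFlow_le (hΦ1 : ∀ z, 0 ≤ z → |Φ z| ≤ 1) (w : 𝓢(ℝ, ℝ)) {v : ℝ} (hv : 0 ≤ v)
    (x : ℝ) : ‖fourierFlow Φ w v x‖ ≤ ∫ ξ, ‖realFourier w ξ‖ :=
  norm_integral_le_of_norm_le (realFourier w).integrable.norm
    (ae_of_all _ fun ξ => norm_fourierFlow_integrand_le hΦ1 w hv x ξ)

theorem integrable_fourierFlow_prod (hΦ : Continuous Φ) (hΦ1 : ∀ z, 0 ≤ z → |Φ z| ≤ 1)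
    {κ : ℝ → ℝ} {θ : ℝ} (hκ : IntegrableOn κ (Ioo 0 1)) (w : 𝓢(ℝ, ℝ)) {v : ℝ} (hv : 0 ≤ v)
    (x : ℝ) :
    Integrable (Function.uncurry fun (r ξ : ℝ) => ((v * κ r / 2 : ℝ) : ℂ) *
      (planeWave ξ x * realFourier w ξ * (Φ (2 * Real.pi ^ 2 * ξ ^ 2 * (v * r ^ θ)) : ℂ)))
      ((volume.restrict (Ioo 0 1)).prod volume) := by
  have hκ' : IntegrableOn (fun r => v * κ r / 2) (Ioo 0 1) := (hκ.const_mul v).div_const 2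
  refine (hκ'.norm.mul_prod (realFourier w).integrable.norm).mono' ?_ ?_
  · have h1 : AEStronglyMeasurable (fun r => ((v * κ r / 2 : ℝ) : ℂ))
        (volume.restrict (Ioo 0 1)) :=
      Complex.continuous_ofReal.comp_aestronglyMeasurable hκ'.1
    have h2 : Measurable fun q : ℝ × ℝ => planeWave q.2 x * realFourier w q.2 *
        (Φ (2 * Real.pi ^ 2 * q.2 ^ 2 * (v * q.1 ^ θ)) : ℂ) := by
      have h3 : Measurable fun q : ℝ × ℝ => planeWave q.2 x :=
        continuous_planeWave.measurable.comp (measurable_snd.prodMk measurable_const)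
      have h4 := (realFourier w).continuous.measurable
      have h5 := hΦ.measurable
      fun_prop
    exact AEStronglyMeasurable.mul h1.comp_fst h2.aestronglyMeasurable
  · have h : ∀ᵐ q ∂(volume.restrict (Ioo (0 : ℝ) 1)).prod (volume : Measure ℝ),
        q.1 ∈ Ioo 0 1 :=
      Measure.quasiMeasurePreserving_fst.ae (ae_restrict_mem measurableSet_Ioo)
    filter_upwards [h] with q hq
    simp only [Function.uncurry]
    rw [norm_mul, Complex.norm_real]
    exact mul_le_mul_of_nonneg_left (norm_fourierFlow_integrand_le hΦ1 w
      (mul_nonneg hv (Real.rpow_nonneg hq.1.le θ)) x q.2) (norm_nonneg _)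

/-- The integral equation for the flow, in the energy variable. -/
theorem fourierFlow_eq (hΦ : Continuous Φ) (hΦ1 : ∀ z, 0 ≤ z → |Φ z| ≤ 1) {κ : ℝ → ℝ} {θ : ℝ}
    (hκ : IntegrableOn κ (Ioo 0 1))
    (hΦκ : ∀ z, Φ z = 1 - z * ∫ r in Ioo (0 : ℝ) 1, κ r * Φ (z * r ^ θ))
    (w : 𝓢(ℝ, ℝ)) {v : ℝ} (hv : 0 ≤ v) (x : ℝ) :
    fourierFlow Φ w v x = w x + ∫ r in Ioo (0 : ℝ) 1, ((v * κ r / 2 : ℝ) : ℂ) *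
      fourierFlow Φ (SchwartzMap.derivCLM ℝ ℝ (SchwartzMap.derivCLM ℝ ℝ w)) (v * r ^ θ) x := by
  set w2 := SchwartzMap.derivCLM ℝ ℝ (SchwartzMap.derivCLM ℝ ℝ w) with hw2
  have hw : Integrable fun ξ => planeWave ξ x * realFourier w ξ :=
    (realFourier w).integrable.norm.mono'
      ((continuous_planeWave.comp (Continuous.prodMk_left x)).mul
        (realFourier w).continuous).aestronglyMeasurable
      (ae_of_all _ fun ξ => by rw [norm_mul, norm_planeWave, one_mul])
  have hF := integrable_fourierFlow_prod (θ := θ) hΦ hΦ1 hκ w2 hv x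
  -- At frequency ξ the factors `v / 2` and -4π²ξ² multiply to -z with z = 2π²ξ²v, so the inner
  -- integral is Φ(z) - 1 by the functional equation.
  have hsw : ∫ r in Ioo (0 : ℝ) 1, ((v * κ r / 2 : ℝ) : ℂ) * fourierFlow Φ w2 (v * r ^ θ) x =
      ∫ ξ, planeWave ξ x * realFourier w ξ *
        (((Φ (2 * Real.pi ^ 2 * ξ ^ 2 * v) - 1 : ℝ)) : ℂ) := by
    simp only [fourierFlow, ← integral_const_mul]
    rw [integral_integral_swap hF]
    congr 1
    ext ξ
    rw [hΦκ (2 * Real.pi ^ 2 * ξ ^ 2 * v), sub_sub_cancel_left, ← integral_const_mul,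
      ← integral_neg, ← integral_complex_ofReal, ← integral_const_mul]
    congr 1
    ext r
    rw [hw2, realFourier_deriv_deriv]
    simp only [← mul_assoc]
    push_cast
    ring
  rw [hsw, realFourier_inversion w x, ← integral_add hw ?_, fourierFlow]
  · congr 1
    ext ξ
    push_cast
    ring
  · refine ((integrable_fourierFlow_integrand hΦ hΦ1 w hv x).sub hw).congr (ae_of_all _ fun ξ => ?_)
    simp only [Pi.sub_apply]
    push_cast
    ring

/-- The flow driven by a random variable whose characteristic function is `ξ ↦ Φ(ξ²v/2)`. -/
theorem integral_schwartz_eq_fourierFlow {Ω : Type*} [MeasurableSpace Ω] {P : Measure Ω}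
    [IsProbabilityMeasure P] {Z : Ω → ℝ} (hZ : AEMeasurable Z P) {v : ℝ}
    (hchar : ∀ ξ : ℝ, ∫ ω, Complex.exp ((ξ * Z ω : ℝ) * Complex.I) ∂P =
      (Φ (ξ ^ 2 * v / 2) : ℂ)) (w : 𝓢(ℝ, ℝ)) (x : ℝ) :
    ((∫ ω, w (x + Z ω) ∂P : ℝ) : ℂ) = fourierFlow Φ w v x := by
  have hF : Integrable (Function.uncurry fun ω ξ =>
      planeWave ξ (x + Z ω) * realFourier w ξ) (P.prod volume) := by
    refine ((integrable_const (1 : ℝ)).mul_prod (realFourier w).integrable.norm).mono' ?_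
      (ae_of_all _ fun q => ?_)
    · have h1 : AEMeasurable (fun q : Ω × ℝ => planeWave q.2 (x + Z q.1)) (P.prod volume) :=
        continuous_planeWave.measurable.comp_aemeasurable
          (measurable_snd.aemeasurable.prodMk ((hZ.comp_fst).const_add x))
      exact h1.aestronglyMeasurable.mul
        ((realFourier w).continuous.measurable.comp measurable_snd).aestronglyMeasurable
    · simp only [Function.uncurry, norm_mul, norm_planeWave, le_refl]
  calc ((∫ ω, w (x + Z ω) ∂P : ℝ) : ℂ) = ∫ ω, (w (x + Z ω) : ℂ) ∂P := integral_ofReal.symm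
    _ = ∫ ω, ∫ ξ, (planeWave ξ (x + Z ω) * realFourier w ξ) ∂volume ∂P := by
        simp only [realFourier_inversion w]
    _ = ∫ ξ, ∫ ω, planeWave ξ (x + Z ω) * realFourier w ξ ∂P := integral_integral_swap hF
    _ = fourierFlow Φ w v x := by
        rw [fourierFlow]
        congr 1
        ext ξ
        simp only [planeWave_add]
        rw [integral_mul_const, integral_const_mul]
        -- The factor 2π passes from the Fourier convention of `planeWave` to that of characteristic
        -- functions.
        have := hchar (2 * Real.pi * ξ)
        rw [show (2 * Real.pi * ξ) ^ 2 * v / 2 = 2 * Real.pi ^ 2 * ξ ^ 2 * v by ring] at this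
        rw [← this]
        simp only [planeWave]
        ring

end Fourier

/-! ### Space derivatives of the flow -/

section Derivative

variable {Ω : Type*} [MeasurableSpace Ω] {P : Measure Ω} [IsProbabilityMeasure P] {Z : Ω → ℝ}

theorem hasDerivAt_integral_schwartz (hZ : AEMeasurable Z P) (w : 𝓢(ℝ, ℝ)) (x : ℝ) :
    HasDerivAt (fun x => ∫ ω, w (x + Z ω) ∂P)
      (∫ ω, SchwartzMap.derivCLM ℝ ℝ w (x + Z ω) ∂P) x := by
  obtain ⟨M, -, hM⟩ := exists_bound_schwartz w
  obtain ⟨M', -, hM'⟩ := exists_bound_schwartz (SchwartzMap.derivCLM ℝ ℝ w)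
  have hm : ∀ (w : 𝓢(ℝ, ℝ)) (x : ℝ), AEStronglyMeasurable (fun ω => w (x + Z ω)) P := fun w x =>
    (w.continuous.measurable.comp_aemeasurable (hZ.const_add x)).aestronglyMeasurable
  refine (hasDerivAt_integral_of_dominated_loc_of_deriv_le (bound := fun _ => M')
    (F := fun x ω => w (x + Z ω)) (F' := fun x ω => SchwartzMap.derivCLM ℝ ℝ w (x + Z ω)) univ_mem
    (Eventually.of_forall fun x => hm w x)
    ((integrable_const M).mono' (hm w x) (ae_of_all _ fun ω => hM _)) (hm _ x)
    (ae_of_all _ fun ω x _ => hM' _) (integrable_const M') (ae_of_all _ fun ω x _ => ?_)).2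
  exact (w.hasDerivAt (x + Z ω)).comp_add_const x (Z ω)

theorem iteratedDeriv_integral_schwartz (hZ : AEMeasurable Z P) (n : ℕ) (w : 𝓢(ℝ, ℝ)) :
    iteratedDeriv n (fun x => ∫ ω, w (x + Z ω) ∂P) =
      fun x => ∫ ω, (SchwartzMap.derivCLM ℝ ℝ)^[n] w (x + Z ω) ∂P := by
  induction n generalizing w with
  | zero => simp
  | succ n ih =>
    rw [iteratedDeriv_succ']
    have : deriv (fun x => ∫ ω, w (x + Z ω) ∂P) =
        fun x => ∫ ω, SchwartzMap.derivCLM ℝ ℝ w (x + Z ω) ∂P :=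
      funext fun x => (hasDerivAt_integral_schwartz hZ w x).deriv
    rw [this, ih]
    rfl

theorem contDiff_integral_schwartz (hZ : AEMeasurable Z P) (w : 𝓢(ℝ, ℝ)) :
    ContDiff ℝ 2 fun x => ∫ ω, w (x + Z ω) ∂P :=
  contDiff_of_differentiable_iteratedDeriv (n := 2) fun m _ => by
    rw [iteratedDeriv_integral_schwartz hZ]
    exact fun x => (hasDerivAt_integral_schwartz hZ _ x).differentiableAt

end Derivative

/-! ### The change of time -/

section TimeChange

/-- At an endpoint σ may have a corner; then `deriv` takes its default value 0, which fits the
convention for the integrand. -/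
theorem deriv_eq_zero_of_eqOn_Icc {σ : ℝ → ℝ} {a b c s : ℝ} (hab : a < b) (hs : s ∈ Icc a b)
    (h : ∀ r ∈ Icc a b, σ r = c) : deriv σ s = 0 := by
  by_cases hd : DifferentiableAt ℝ σ s
  · rw [← hd.derivWithin (uniqueDiffOn_Icc hab s hs), derivWithin_congr h (h s hs),
      derivWithin_fun_const]
    rfl
  · exact deriv_zero_of_not_differentiableAt hd

variable {σ : ℝ → ℝ} {t : ℝ}

/-- By monotonicity σ is constant on [0, s] if σ(s) = 0, and on [s, t] if σ(s) ≥ σ(t). -/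
theorem deriv_eq_zero_of_notMem (hσ : MonotoneOn σ (Ici 0)) (hσ0 : ∀ s, 0 ≤ s → 0 ≤ σ s)
    {s : ℝ} (hs : s ∈ Ioo 0 t) (h : σ s ∉ Ioo 0 (σ t)) : deriv σ s = 0 := by
  have hs0 : (0 : ℝ) ≤ s := hs.1.le
  rcases (hσ0 s hs0).eq_or_lt with h0 | h0
  · refine deriv_eq_zero_of_eqOn_Icc (c := 0) hs.1 (right_mem_Icc.2 hs0) fun r hr => ?_
    exact le_antisymm (h0 ▸ hσ hr.1 hs0 hr.2) (hσ0 r hr.1)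
  · have ht : σ t ≤ σ s := not_lt.1 fun h' => h ⟨h0, h'⟩
    refine deriv_eq_zero_of_eqOn_Icc (c := σ s) hs.2 (left_mem_Icc.2 hs.2.le) fun r hr => ?_
    have hr0 : (0 : ℝ) ≤ r := hs0.trans hr.1
    exact le_antisymm ((hσ hr0 (hr0.trans hr.2) hr.2).trans ht) (hσ hs0 hr0 hr.1)

theorem image_div_eq_Ioo (hσc : ContinuousOn σ (Ici 0)) (hz : σ 0 = 0) (ht : 0 < t)
    (hσt : 0 < σ t) :
    (fun s => σ s / σ t) '' {s | s ∈ Ioo 0 t ∧ σ s ∈ Ioo 0 (σ t)} = Ioo 0 1 := by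
  ext r
  constructor
  · rintro ⟨s, ⟨-, h1, h2⟩, rfl⟩
    exact ⟨div_pos h1 hσt, (div_lt_one hσt).2 h2⟩
  · rintro ⟨h1, h2⟩
    have hr : r * σ t ∈ Ioo (σ 0) (σ t) := by
      rw [hz]
      exact ⟨mul_pos h1 hσt, mul_lt_of_lt_one_left hσt h2⟩
    obtain ⟨s, hs, hsr⟩ := intermediate_value_Ioo ht.le (hσc.mono Icc_subset_Ici_self) hr
    rw [hz, ← hsr] at hr
    refine ⟨s, ⟨hs, hr⟩, ?_⟩
    simp only [hsr]
    exact mul_div_cancel_right₀ _ hσt.ne'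

/-- Change of variables `r = σ(s) / σ(t)` in an integral with a homogeneous kernel. -/
theorem integral_timeChange {k : ℝ → ℝ → ℝ} {θ : ℝ} (hk : IsHomogeneousKernel k (θ - 1))
    (hσ : MonotoneOn σ (Ici 0)) (hσc : ContinuousOn σ (Ici 0)) (hσ0 : ∀ s, 0 ≤ s → 0 ≤ σ s)
    (hz : σ 0 = 0) (hd : ∀ s, 0 < s → 0 < σ s → DifferentiableAt ℝ σ s) (ht : 0 < t)
    (hσt : 0 < σ t) {g : ℝ → ℝ}
    (hi : IntegrableOn (fun r => σ t ^ θ * k 1 r / 2 * g (σ t ^ θ * r ^ θ)) (Ioo 0 1)) :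
    IntervalIntegrable (fun s => k (σ t) (σ s) * deriv σ s * (1 / 2 * g (σ s ^ θ))) volume 0 t ∧
    ∫ s in (0 : ℝ)..t, k (σ t) (σ s) * deriv σ s * (1 / 2 * g (σ s ^ θ)) =
      ∫ r in Ioo (0 : ℝ) 1, σ t ^ θ * k 1 r / 2 * g (σ t ^ θ * r ^ θ) := by
  -- On `S` the ratio σ(s)/σ(t) lies in (0,1), where homogeneity of the kernel is available; off `S`
  -- the derivative of σ vanishes.
  set S := {s | s ∈ Ioo 0 t ∧ σ s ∈ Ioo 0 (σ t)} with hS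
  have hSt : S ⊆ Ioo 0 t := fun s hs => hs.1
  have hS0 : ∀ s ∈ S, (0 : ℝ) ≤ s := fun s hs => hs.1.1.le
  have hSm : MeasurableSet S := by
    have : S.OrdConnected := ⟨fun a ha b hb c hc => by
      have hac := hσ (hS0 a ha) ((hS0 a ha).trans hc.1) hc.1
      have hcb := hσ ((hS0 a ha).trans hc.1) (hS0 b hb) hc.2
      exact ⟨⟨ha.1.1.trans_le hc.1, hc.2.trans_lt hb.1.2⟩,
        ha.2.1.trans_le hac, hcb.trans_lt hb.2.2⟩⟩
    exact this.measurableSet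
  have himg : (fun s => σ s / σ t) '' S = Ioo 0 1 := image_div_eq_Ioo hσc hz ht hσt
  have hder : ∀ s ∈ S, HasDerivWithinAt (fun s => σ s / σ t) (deriv σ s / σ t) S s := fun s hs =>
    ((hd s hs.1.1 hs.2.1).hasDerivAt.div_const _).hasDerivWithinAt
  have hmono : MonotoneOn (fun s => σ s / σ t) S := fun a ha b hb hab =>
    div_le_div_of_nonneg_right (hσ (hS0 a ha) (hS0 b hb) hab) hσt.le
  -- Homogeneity gives the factor σ(t)^(θ-1); the missing power of σ(t) comes from dr = σ'(s) ds /
  -- σ(t).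
  have e : ∀ s ∈ S, k (σ t) (σ s) * deriv σ s * (1 / 2 * g (σ s ^ θ)) =
      (deriv σ s / σ t) • (σ t ^ θ * k 1 (σ s / σ t) / 2 *
        g (σ t ^ θ * (σ s / σ t) ^ θ)) := by
    intro s hs
    have h1 := hk.homogeneous (σ t) (σ s / σ t) hσt (div_pos hs.2.1 hσt)
      ((div_lt_one hσt).2 hs.2.2)
    rw [mul_div_cancel₀ _ hσt.ne'] at h1
    rw [h1, ← Real.mul_rpow hσt.le (div_pos hs.2.1 hσt).le, mul_div_cancel₀ _ hσt.ne',
      Real.rpow_sub_one hσt.ne', smul_eq_mul]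
    ring
  have hzero : ∀ s ∈ Ioo 0 t \ S, k (σ t) (σ s) * deriv σ s * (1 / 2 * g (σ s ^ θ)) = 0 :=
    fun s hs => by
      rw [deriv_eq_zero_of_notMem hσ hσ0 hs.1 fun h => hs.2 ⟨hs.1, h⟩, mul_zero, zero_mul]
  -- σ need not be injective: the change of variables for monotone functions allows flat pieces.
  have hiS : IntegrableOn (fun s => k (σ t) (σ s) * deriv σ s * (1 / 2 * g (σ s ^ θ))) S := by
    rw [integrableOn_congr_fun e hSm, ← integrableOn_image_iff_integrableOn_deriv_smul_of_monotoneOn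
      hSm hder hmono (fun r => σ t ^ θ * k 1 r / 2 * g (σ t ^ θ * r ^ θ)), himg]
    exact hi
  constructor
  · rw [intervalIntegrable_iff_integrableOn_Ioo_of_le ht.le]
    exact hiS.of_forall_sdiff_eq_zero measurableSet_Ioo hzero
  · rw [intervalIntegral.integral_of_le ht.le, integral_Ioc_eq_integral_Ioo,
      setIntegral_eq_of_subset_of_forall_sdiff_eq_zero measurableSet_Ioo hSt hzero,
      setIntegral_congr_fun hSm e, ← integral_image_eq_integral_deriv_smul_of_monotoneOn
        hSm hder hmono (fun r => σ t ^ θ * k 1 r / 2 * g (σ t ^ θ * r ^ θ)), himg]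

end TimeChange

/-! ### The flow solves the equation -/

theorem abs_laplace_le_one {Ω : Type*} [MeasurableSpace Ω] {P : Measure Ω}
    [IsProbabilityMeasure P] {A : Ω → ℝ} (hApos : ∀ᵐ ω ∂P, 0 < A ω) {z : ℝ} (hz : 0 ≤ z) :
    |laplace A P z| ≤ 1 := by
  have h := norm_integral_le_of_norm_le_const (μ := P) (f := fun ω => Real.exp (-z * A ω)) (C := 1)
    (by
      filter_upwards [hApos] with ω hω
      rw [Real.norm_of_nonneg (Real.exp_pos _).le, Real.exp_le_one_iff]
      nlinarith)
  simpa [laplace] using h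

theorem integrableOn_mul_fourierFlow {Φ κ : ℝ → ℝ} {θ : ℝ} (hΦ : Continuous Φ)
    (hΦ1 : ∀ z, 0 ≤ z → |Φ z| ≤ 1) (hκ : IntegrableOn κ (Ioo 0 1)) (hθ : 0 < θ) (w : 𝓢(ℝ, ℝ))
    {v : ℝ} (hv : 0 ≤ v) (x : ℝ) :
    IntegrableOn (fun r => ((v * κ r / 2 : ℝ) : ℂ) * fourierFlow Φ w (v * r ^ θ) x)
      (Ioo 0 1) := by
  have hκ' : IntegrableOn (fun r => ((v * κ r / 2 : ℝ) : ℂ)) (Ioo 0 1) :=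
    Integrable.ofReal (𝕜 := ℂ) (f := fun r => v * κ r / 2) ((hκ.const_mul v).div_const 2)
  have hmaps : MapsTo (fun r : ℝ => ((v * r ^ θ, x) : ℝ × ℝ)) (Ioo 0 1) (Ici 0 ×ˢ univ) :=
    fun r hr => ⟨mul_nonneg hv (Real.rpow_nonneg hr.1.le θ), mem_univ _⟩
  have hc : Continuous fun r : ℝ => ((v * r ^ θ, x) : ℝ × ℝ) := by
    have : Continuous fun r : ℝ => r ^ θ := continuous_id.rpow_const fun _ => Or.inr hθ.le
    fun_prop
  have hF : ContinuousOn (fun r : ℝ => fourierFlow Φ w (v * r ^ θ) x) (Ioo 0 1) := by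
    have h := (continuousOn_fourierFlow hΦ hΦ1 w).comp hc.continuousOn hmaps
    simpa only [Function.comp_def] using h
  have hb : ∀ᵐ r ∂volume.restrict (Ioo (0 : ℝ) 1),
      ‖fourierFlow Φ w (v * r ^ θ) x‖ ≤ ∫ ξ, ‖realFourier w ξ‖ := by
    filter_upwards [ae_restrict_mem measurableSet_Ioo] with r hr
    exact norm_fourierFlow_le hΦ1 w (mul_nonneg hv (Real.rpow_nonneg hr.1.le θ)) x
  exact Integrable.mul_bdd (f := fun r => ((v * κ r / 2 : ℝ) : ℂ))
    (g := fun r => fourierFlow Φ w (v * r ^ θ) x) hκ'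
    (hF.aestronglyMeasurable measurableSet_Ioo) hb

/-- If the characteristic function of `Z_t` is `ξ ↦ Φ(ξ² σ(t)^θ / 2)`, then
`(t, x) ↦ E[u₀(x + Z_t)]` solves the evolution equation with kernel `k` and time change `σ`. -/
theorem isContinuousSolution_of_charFun {Ω : Type*} [MeasurableSpace Ω] {P : Measure Ω}
    [IsProbabilityMeasure P] {k : ℝ → ℝ → ℝ} {θ : ℝ} (hθ : 0 < θ)
    (hk : IsHomogeneousKernel k (θ - 1)) (hk1 : IntegrableOn (k 1) (Ioo 0 1))
    (hΦ1 : ∀ z, 0 ≤ z → |phi k θ z| ≤ 1) {σ : ℝ → ℝ}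
    (hσ : MonotoneOn σ (Ici 0)) (hσc : ContinuousOn σ (Ici 0)) (hσ0 : ∀ s, 0 ≤ s → 0 ≤ σ s)
    (hz : σ 0 = 0) (hd : ∀ s, 0 < s → 0 < σ s → DifferentiableAt ℝ σ s) {Z : ℝ → Ω → ℝ}
    (hZ : ∀ t, 0 ≤ t → AEMeasurable (Z t) P)
    (hchar : ∀ t, 0 ≤ t → ∀ ξ : ℝ, ∫ ω, Complex.exp ((ξ * Z t ω : ℝ) * Complex.I) ∂P =
      (phi k θ (ξ ^ 2 * σ t ^ θ / 2) : ℂ)) (u₀ : 𝓢(ℝ, ℝ)) :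
    IsContinuousSolution k σ (fun x => u₀ x) (expectationFlow P Z fun x => u₀ x) := by
  have hΦ := continuous_phi hk1 hθ
  set Φ := phi k θ with hΦdef
  set w := SchwartzMap.derivCLM ℝ ℝ (SchwartzMap.derivCLM ℝ ℝ u₀) with hw
  have hu : ∀ t, 0 ≤ t → ∀ x, expectationFlow P Z (fun x => u₀ x) t x =
      (fourierFlow Φ u₀ (σ t ^ θ) x).re := fun t ht x => by
    rw [← integral_schwartz_eq_fourierFlow (hZ t ht) (hchar t ht) u₀ x, Complex.ofReal_re,
      expectationFlow]
  have hu2 : ∀ t, 0 ≤ t → ∀ x, iteratedDeriv 2 (expectationFlow P Z (fun x => u₀ x) t) x =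
      (fourierFlow Φ w (σ t ^ θ) x).re := fun t ht x => by
    rw [← integral_schwartz_eq_fourierFlow (hZ t ht) (hchar t ht) w x, Complex.ofReal_re]
    exact congrFun (iteratedDeriv_integral_schwartz (hZ t ht) 2 u₀) x
  have hv : ∀ t, 0 ≤ t → 0 ≤ σ t ^ θ := fun t ht => Real.rpow_nonneg (hσ0 t ht) θ
  have hint : ∀ v x, 0 ≤ v → IntegrableOn (fun r => ((v * k 1 r / 2 : ℝ) : ℂ) *
      fourierFlow Φ w (v * r ^ θ) x) (Ioo 0 1) := fun v x hv =>
    integrableOn_mul_fourierFlow hΦ hΦ1 hk1 hθ w hv x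
  have hre : ∀ v x, 0 ≤ v → (fourierFlow Φ u₀ v x).re = u₀ x +
      ∫ r in Ioo (0 : ℝ) 1, v * k 1 r / 2 * (fourierFlow Φ w (v * r ^ θ) x).re := by
    intro v x hv
    rw [fourierFlow_eq hΦ hΦ1 hk1 (phi_eq_one_sub hk1 hθ) u₀ hv x, Complex.add_re,
      Complex.ofReal_re]
    congr 1
    have := integral_re (hint v x hv)
    simp only [RCLike.re_eq_complex_re, Complex.re_ofReal_mul] at this
    exact this.symm
  have key : ∀ t x : ℝ, 0 < t → IntervalIntegrable (fun s => k (σ t) (σ s) * deriv σ s *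
      (1 / 2 * (fourierFlow Φ w (σ s ^ θ) x).re)) volume 0 t ∧
      (fourierFlow Φ u₀ (σ t ^ θ) x).re = u₀ x + ∫ s in (0 : ℝ)..t, k (σ t) (σ s) * deriv σ s *
        (1 / 2 * (fourierFlow Φ w (σ s ^ θ) x).re) := by
    intro t x ht
    rw [hre _ x (hv t ht.le)]
    rcases (hσ0 t ht.le).eq_or_lt with h0 | h0
    -- If σ(t) = 0, the integrand vanishes on (0, t) and both sides reduce to u₀(x).
    · have e : EqOn (fun s => k (σ t) (σ s) * deriv σ s *
          (1 / 2 * (fourierFlow Φ w (σ s ^ θ) x).re)) (fun _ => 0) (Ioo 0 t) := fun s hs => by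
        simp only
        rw [deriv_eq_zero_of_notMem hσ hσ0 hs (by rw [← h0, Ioo_self]; exact notMem_empty _),
          mul_zero, zero_mul]
      rw [intervalIntegrable_iff_integrableOn_Ioo_of_le ht.le,
        intervalIntegral.integral_of_le ht.le, integral_Ioc_eq_integral_Ioo,
        integrableOn_congr_fun e measurableSet_Ioo, setIntegral_congr_fun measurableSet_Ioo e,
        ← h0, Real.zero_rpow hθ.ne']
      simp
    · have hi : IntegrableOn (fun r => σ t ^ θ * k 1 r / 2 *
          (fourierFlow Φ w (σ t ^ θ * r ^ θ) x).re) (Ioo 0 1) := by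
        have := (hint _ x (hv t ht.le)).re
        simp only [RCLike.re_eq_complex_re, Complex.re_ofReal_mul] at this
        exact this
      have h := integral_timeChange (g := fun v => (fourierFlow Φ w v x).re) hk hσ hσc hσ0 hz hd
        ht h0 hi
      exact ⟨h.1, by rw [h.2]⟩
  have hae : ∀ t x : ℝ, 0 < t → EqOn (fun s => k (σ t) (σ s) * deriv σ s * (1 / 2 *
        iteratedDeriv 2 (expectationFlow P Z (fun x => u₀ x) s) x))
      (fun s => k (σ t) (σ s) * deriv σ s * (1 / 2 * (fourierFlow Φ w (σ s ^ θ) x).re))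
      (uIcc 0 t) := fun t x ht s hs => by
    rw [uIcc_of_le ht.le] at hs
    simp only [hu2 s hs.1 x]
  refine ⟨?_, fun t ht => contDiff_integral_schwartz (hZ t ht) u₀, fun t x ht => ?_,
    fun t x ht => ?_⟩
  · have h1 : ContinuousOn (fun p : ℝ × ℝ => ((σ p.1 ^ θ, p.2) : ℝ × ℝ)) (Ici 0 ×ˢ univ) := by
      refine ContinuousOn.prodMk ?_ continuousOn_snd
      refine ContinuousOn.rpow_const ?_ fun _ _ => Or.inr hθ.le
      exact hσc.comp continuousOn_fst fun p hp => hp.1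
    have h2 := (continuousOn_fourierFlow hΦ hΦ1 u₀).comp h1 fun p hp => ⟨hv p.1 hp.1, mem_univ _⟩
    exact (Complex.continuous_re.comp_continuousOn h2).congr fun p hp => hu p.1 hp.1 p.2
  · exact (key t x ht).1.congr fun s hs => (hae t x ht (uIoc_subset_uIcc hs)).symm
  · rw [hu t ht.le x, (key t x ht).2, intervalIntegral.integral_congr (hae t x ht)]

end FracIto

/-! ### The law of Z_t and the conclusion. -/

theorem mainTheorem8 {Ω : Type*} [MeasurableSpace Ω] (P : Measure Ω) [IsProbabilityMeasure P]
    (B : ℝ → Ω → ℝ) (hB : FracIto.IsTwoSidedBrownian B P)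
    (A : Ω → ℝ) (hA : Measurable A) (hApos : ∀ᵐ ω ∂P, 0 < A ω)
    (hAB : IndepFun A (fun ω t => B t ω) P)
    (H : ℝ) (hH0 : 0 < H) (hH1 : H < 1)
    (k : ℝ → ℝ → ℝ) (hk : FracIto.IsHomogeneousKernel k (2 * H - 1))
    (hkL : ∃ ε : ℝ, 0 < ε ∧
      MemLp (fun s => k 1 s) (ENNReal.ofReal (1 + ε)) (volume.restrict (Ioo (0 : ℝ) 1)))
    (hΦ : FracIto.IsCompletelyMonotone (FracIto.phi k (2 * H)))
    (hLA : ∀ t : ℝ, 0 ≤ t → FracIto.laplace A P t = FracIto.phi k (2 * H) t)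
    (ν : ℝ → ℝ) (Z : ℝ → Ω → ℝ) (hZ : FracIto.IsDI A B P H ν Z)
    (hσ : MonotoneOn (FracIto.timeChange H ν) (Ici 0))
    (u₀ : 𝓢(ℝ, ℝ)) :
    FracIto.IsContinuousSolution k (FracIto.timeChange H ν) (fun x => u₀ x)
      (FracIto.expectationFlow P Z fun x => u₀ x) := by
  have hθ : 0 < 2 * H := by positivity
  obtain ⟨ε, hε, hkε⟩ := hkL
  have hk1 : IntegrableOn (k 1) (Ioo 0 1) :=
    hkε.integrable (by rw [ENNReal.one_le_ofReal]; linarith)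
  have hF := FracIto.differentiable_phiC hk1 hθ
  have hFL : ∀ t : ℝ, 0 ≤ t → FracIto.phiC k (2 * H) t = (FracIto.laplace A P t : ℂ) :=
    fun t ht => by rw [FracIto.phiC_ofReal, hLA t ht]
  have hR := FracIto.laplaceRadius_eq_top hF hFL
  have hexp := FracIto.integrable_exp_mul_of_entire hA hApos hF hFL
  obtain ⟨V, hV⟩ := FracIto.exists_isEnergy hH0 hH1 hZ.1 hZ.2.1
  refine FracIto.isContinuousSolution_of_charFun hθ hk hk1
    (fun z hz => by rw [← hLA z hz]; exact FracIto.abs_laplace_le_one hApos hz) hσ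
    (hV.continuousOn_timeChange hH0) (fun s _ => FracIto.timeChange_nonneg H ν s)
    (hV.timeChange_zero hH0) (fun s hs hs' => hV.differentiableAt_timeChange hH0 hs hs')
    (fun t ht => (hZ.2.2 t ht).2.1.1.1.aemeasurable) (fun t ht ξ => ?_) u₀
  -- Z_t agrees almost surely with √A times this Wiener integral, whose variance is V(t) =
  -- σ(t)^(2H).
  have hY := FracIto.isWienerIntegral_wienerIntegral hB (hV.memLp t ht)
  have hZY := (hZ.2.2 t ht).ae_eq hB hA hApos hAB hexp hR (hV.memLp t ht) (hV.parts t ht) hY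
  have hc := hY.integral_cexp hB hA hApos hAB (hV.memLp t ht) ξ
  rw [hV.eLpNorm_sq ht, hLA _ (by rw [← hV.eLpNorm_sq ht]; positivity),
    ← hV.timeChange_rpow hH0 ht] at hc
  rw [← hc]
  refine integral_congr_ae ?_
  filter_upwards [hZY] with ω hω
  rw [hω]
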